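/- **Setting.** Let $M\ge 1$. A scalar lattice Poisson bracket of order at most $M$ is a shift-invariant Poisson bracket on functions of sequences $(u_n)_{n\in\mathbb Z}$, given by $$\{u_n,u_{n+k}\}=g_k(u_n,\dots,u_{n+k})\quad(1\le k\le M),\qquad \{u_n,u_{n+k}\}=0\quad(k>M),$$ extended by skew-symmetry and the Leibniz rule and satisfying the Jacobi identity. Here $u_n$ takes values in a nonempty connected open set $D\subseteq\mathbb C$ (the range of a coordinate on the one-dimensional target) and each $g_k$ is analytic on $D^{k+1}$. Let $\alpha\ge1$ and $\xi\ge0$ be integers, and put $M=2\alpha+\xi$ and $\theta=\min(\alpha,\xi)$. An *$(\alpha,\xi)$-bracket* is such a bracket with $$g_M(u_n,\dots,u_{n+M})=f(u_{n+\alpha},\dots,u_{n+\alpha+\xi}),$$ where $f$ is analytic on $D^{\xi+1}$, the product of the derivatives of $f$ in its first and in its last variable is not identically zero, and each $g_k$ $(1\le k\le M)$ is a linear combination with constant coefficients of the shifts $f(u_{n+s},\dots,u_{n+s+\xi})$, $0\le s\le k-\xi$. Two $(\alpha,\xi)$-brackets are identified if they are joined by a finite chain of local changes of the coordinate $u_n\mapsto\varphi(u_n)$,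 with $\varphi$ analytic and injective on a nonempty connected open subset of the domain. **Notation.** For a sequence $\mathbf a=(a_0,a_1,\dots)$ let $A_r(\mathbf a)$ be the $r\times r$ matrix with entries $a_{1+i-j}$, where $a_q=0$ for $q<0$ (and $\det A_0=1$). For $\tau_0\tau_\xi\neq0$, and with $\tau_s=0$ for $s>\xi$, put $$\lambda^\alpha_{\alpha-r}=\det A_r\big(\{(-1)^s\tau_0^{-1}\tau_s\}_{s\ge0}\big)\ (0\le r\le\alpha-1),\qquad \lambda^\alpha_0=\tau_0\tau_\xi^{-1},\qquad \lambda^\alpha_{\alpha-r}=0\ (r>\alpha),$$ and $\sigma_q=(-1)^q\lambda^\alpha_{\alpha-q}$. These depend only on $\tau_0,\dots,\tau_{\theta-1},\tau_\xi$. **Theorem.** The classes of $(\alpha,\xi)$-brackets are in one-to-one correspondence with the common points having $\tau_0\tau_\xi\ne0$ of the following $\theta$ hypersurfaces in $\mathbb{CP}^\theta$ with homogeneous coordinates $[\tau_0:\dots:\tau_{\theta-1}:\tau_\xi]$: (i) if $\xi\ge2\alpha-1$, for $p=0,\dots,\alpha-1$, $$\tau_0^{\,p+1}\det A_{\xi-p}(\{\sigma_q\}_{q\ge0})=(-1)^{\alpha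 p}\,\tau_\xi^{\,p+1}\det A_p(\{\sigma_{\alpha-q}\}_{q\ge0});$$ (ii) if $\xi<\alpha$, for $p=0,\dots,\xi-1$, $$\tau_0^{\,\xi-p}\,\tau_p=(-1)^{\alpha(\xi-p)}\,\tau_\xi^{\,\xi-p+1}\det A_{\xi-p}(\{\sigma_{\alpha-q}\}_{q\ge0});$$ (iii) if $\alpha\le\xi<2\alpha-1$, the equations in (i) for $p=0,\dots,\xi-\alpha$ and the equations in (ii) for $p=\xi-\alpha+1,\dots,\alpha-1$. Multiplied by a suitable power of $\tau_0\tau_\xi$, the difference of the two sides of each equation is a nonzero homogeneous polynomial in $\tau_0,\dots,\tau_{\theta-1},\tau_\xi$. Moreover, for every $(\alpha,\xi)$-bracket, $f$ has the form $f(u_n,\dots,u_{n+\xi})=c\exp\big(\sum_{i=0}^{\xi}\tau_iu_{n+i}\big)$ with a constant $c\ne0$, the corresponding point is $[\tau_0:\dots:\tau_{\theta-1}:\tau_\xi]$, and $$g_k(u_n,\dots,u_{n+k})=\sum_{\substack{0\le s,r\le\alpha\\ s-r=k-\alpha-\xi}}\lambda^\alpha_{\alpha-r}\,(\lambda^\alpha_0)^{-1}\lambda^\alpha_{\alpha-s}\,f(u_{n+s},\dots,u_{n+s+\xi})\qquad(k\ge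 1).$$ -/

import Mathlib

open scoped BigOperators

namespace LatticePB

/-- Complex partial derivative of `F` in the variable with index `j`. -/
noncomputable def pderiv {ι : Type} [DecidableEq ι] (j : ι) (F : (ι → ℂ) → ℂ) (u : ι → ℂ) : ℂ :=
  deriv (fun t : ℂ => F (Function.update u j t)) (u j)

/-- The tuple `(u_n, u_{n+1}, …, u_{n+k})` of consecutive lattice variables. -/
def window (u : ℤ → ℂ) (n : ℤ) (k : ℕ) : Fin (k + 1) → ℂ := fun i => u (n + ((i : ℕ) : ℤ))

/-- The bracket `{u_n, u_m}` of two lattice variables, as a function of the sequence `u`, for the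
coefficients `g`: it is `g_{m-n}(u_n, …, u_m)` if `n ≤ m`, and is extended by skew-symmetry. -/
noncomputable def coordBracket (g : (k : ℕ) → (Fin (k + 1) → ℂ) → ℂ) (n m : ℤ) (u : ℤ → ℂ) : ℂ :=
  if n ≤ m then g (m - n).toNat (window u n (m - n).toNat)
  else -g (n - m).toNat (window u m (n - m).toNat)

/-- The iterated bracket `{{u_n, u_m}, u_l} = ∑_j ∂{u_n, u_m}/∂u_j · {u_j, u_l}` (Leibniz rule).
Only the finitely many `j` between `n` and `m` contribute. -/
noncomputable def iteratedBracket (g : (k : ℕ) → (Fin (k + 1) → ℂ) → ℂ) (n m l : ℤ)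
    (u : ℤ → ℂ) : ℂ :=
  ∑ᶠ j : ℤ, pderiv j (coordBracket g n m) u * coordBracket g j l u

/-- A scalar-valued, shift-invariant local lattice Poisson bracket of order at most `M`,
`{u_n, u_{n+k}} = g_k(u_n, …, u_{n+k})` for `1 ≤ k ≤ M` and `{u_n, u_{n+k}} = 0` for `k > M`,
written in a coordinate of the one-dimensional target that ranges over the domain `dom ⊆ ℂ`. -/
structure Bracket (M : ℕ) where
  dom : Set ℂ
  dom_open : IsOpen dom
  dom_connected : IsConnected dom
  g : (k : ℕ) → (Fin (k + 1) → ℂ) → ℂ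
  analytic : ∀ k, AnalyticOnNhd ℂ (g k) {x | ∀ i, x i ∈ dom}
  g_zero : ∀ x : Fin (0 + 1) → ℂ, (∀ i, x i ∈ dom) → g 0 x = 0
  g_gt : ∀ k, M < k → ∀ x : Fin (k + 1) → ℂ, (∀ i, x i ∈ dom) → g k x = 0
  jacobi : ∀ n m l : ℤ, ∀ u : ℤ → ℂ, (∀ i, u i ∈ dom) →
    iteratedBracket g n m l u + iteratedBracket g m l n u + iteratedBracket g l n m u = 0

/-- `P` is an `(α, ξ)`-bracket: its order is `M = 2α + ξ`, in the given (canonical) coordinate its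
leading coefficient is `g_M(u_n, …, u_{n+M}) = f(u_{n+α}, …, u_{n+α+ξ})`, where `f` depends
effectively on its first and on its last variable, and each coefficient `g_k` is a linear
combination of those shifts `f(u_{n+s}, …, u_{n+s+ξ})` that only involve `u_n, …, u_{n+k}`, that
is, `0 ≤ s ≤ k - ξ` (there are none if `k < ξ`). -/
def IsAlphaXi (α ξ : ℕ) (P : Bracket (2 * α + ξ)) : Prop :=
  ∃ f : (Fin (ξ + 1) → ℂ) → ℂ,
    AnalyticOnNhd ℂ f {x | ∀ i, x i ∈ P.dom} ∧
    (∃ x : Fin (ξ + 1) → ℂ, (∀ i, x i ∈ P.dom) ∧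
      pderiv 0 f x * pderiv (Fin.last ξ) f x ≠ 0) ∧
    (∀ u : ℤ → ℂ, (∀ i, u i ∈ P.dom) →
      P.g (2 * α + ξ) (window u 0 (2 * α + ξ)) = f (window u (α : ℤ) ξ)) ∧
    (∀ k : ℕ, 1 ≤ k → k ≤ 2 * α + ξ → ∃ b : ℕ → ℂ, ∀ u : ℤ → ℂ, (∀ i, u i ∈ P.dom) →
      P.g k (window u 0 k) = ∑ s ∈ Finset.range (k + 1 - ξ), b s * f (window u (s : ℤ) ξ))

/-- The type of `(α, ξ)`-brackets. -/
def AlphaXiBracket (α ξ : ℕ) : Type := {P : Bracket (2 * α + ξ) // IsAlphaXi α ξ P}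

/-- `Q` is obtained from `P` by a local change of the coordinate, `v_n = φ(u_n)`, where `φ` is
analytic and injective on a nonempty connected open part `U` of the domain of `P`. -/
def LocalChange {α ξ : ℕ} (P Q : AlphaXiBracket α ξ) : Prop :=
  ∃ (U : Set ℂ) (φ : ℂ → ℂ), IsOpen U ∧ IsConnected U ∧ U ⊆ P.1.dom ∧
    AnalyticOnNhd ℂ φ U ∧ Set.InjOn φ U ∧ Set.MapsTo φ U Q.1.dom ∧
    ∀ k : ℕ, ∀ u : ℤ → ℂ, (∀ i, u i ∈ U) →
      Q.1.g k (window (fun i => φ (u i)) 0 k) =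
        deriv φ (u 0) * deriv φ (u (k : ℤ)) * P.1.g k (window u 0 k)

/-- Equivalence classes of `(α, ξ)`-brackets; `Quot` identifies brackets that are joined by a
finite chain of local changes of the coordinate (in either direction). -/
def BracketClass (α ξ : ℕ) : Type := Quot (LocalChange (α := α) (ξ := ξ))

/-- The `r × r` band Toeplitz matrix with `a_1` on the diagonal, `a_0` just above it, zeros above
that, and `a_2, a_3, …, a_r` below the diagonal. -/
def toeplitz (r : ℕ) (a : ℕ → ℂ) : Matrix (Fin r) (Fin r) ℂ :=
  Matrix.of fun i j => if (j : ℕ) ≤ (i : ℕ) + 1 then a ((i : ℕ) + 1 - (j : ℕ)) else 0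

/-- The parameters `τ_i` read off from homogeneous coordinates
`v = (τ_0, …, τ_{θ-1}, τ_ξ)`, `θ = min α ξ`; only `i < θ` and `i ≥ ξ` (with `τ_i = 0` for `i > ξ`)
are ever used. -/
def tauOf (α ξ : ℕ) (v : Fin (min α ξ + 1) → ℂ) (i : ℕ) : ℂ :=
  if h : i < min α ξ then v ⟨i, Nat.lt_succ_of_lt h⟩
  else if i = ξ then v (Fin.last (min α ξ)) else 0

/-- `lam α ξ v r` is `λ^α_{α-r}`: the determinant of the `r × r` Toeplitz matrix of the sequence
`(-1)^s τ_s / τ_0` for `r < α`, then `λ^α_0 = τ_0 / τ_ξ` for `r = α`, and `0` for `r > α`. -/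
noncomputable def lam (α ξ : ℕ) (v : Fin (min α ξ + 1) → ℂ) (r : ℕ) : ℂ :=
  if r < α then (toeplitz r fun s => (-1) ^ s * (v 0)⁻¹ * tauOf α ξ v s).det
  else if r = α then v 0 * (v (Fin.last (min α ξ)))⁻¹ else 0

/-- `σ_q = (-1)^q λ^α_{α-q}`. -/
noncomputable def sig (α ξ : ℕ) (v : Fin (min α ξ + 1) → ℂ) (q : ℕ) : ℂ :=
  (-1) ^ q * lam α ξ v q

/-- The reversed sequence `σ_{α-q}`, `q ≥ 0` (with `σ` zero at negative indices). -/
noncomputable def sigRev (α ξ : ℕ) (v : Fin (min α ξ + 1) → ℂ) (q : ℕ) : ℂ :=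
  if q ≤ α then sig α ξ v (α - q) else 0

/-- Left side minus right side of
`τ_0^{p+1} det A_{ξ-p}(σ_q) = (-1)^{αp} τ_ξ^{p+1} det A_p(σ_{α-q})`. -/
noncomputable def eqnA (α ξ p : ℕ) (v : Fin (min α ξ + 1) → ℂ) : ℂ :=
  v 0 ^ (p + 1) * (toeplitz (ξ - p) (sig α ξ v)).det
    - (-1) ^ (α * p) * v (Fin.last (min α ξ)) ^ (p + 1) * (toeplitz p (sigRev α ξ v)).det

/-- Left side minus right side of
`τ_0^{ξ-p} τ_p = (-1)^{α(ξ-p)} τ_ξ^{ξ-p+1} det A_{ξ-p}(σ_{α-q})`. -/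
noncomputable def eqnB (α ξ p : ℕ) (v : Fin (min α ξ + 1) → ℂ) : ℂ :=
  v 0 ^ (ξ - p) * tauOf α ξ v p
    - (-1) ^ (α * (ξ - p)) * v (Fin.last (min α ξ)) ^ (ξ - p + 1)
        * (toeplitz (ξ - p) (sigRev α ξ v)).det

/-- The equation with number `p`, `0 ≤ p < θ = min α ξ`, in the three cases `ξ ≥ 2α - 1`, `ξ < α`
and `α ≤ ξ < 2α - 1`. -/
noncomputable def eqn (α ξ p : ℕ) (v : Fin (min α ξ + 1) → ℂ) : ℂ :=
  if 2 * α ≤ ξ + 1 then eqnA α ξ p v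
  else if ξ < α then eqnB α ξ p v
  else if p + α ≤ ξ then eqnA α ξ p v
  else eqnB α ξ p v

/-- The vector `(τ_0, …, τ_{θ-1}, τ_ξ)` of homogeneous coordinates, `θ = min α ξ`. -/
def coords (α ξ : ℕ) (τ : ℕ → ℂ) : Fin (min α ξ + 1) → ℂ :=
  fun i => if (i : ℕ) < min α ξ then τ i else τ ξ

end LatticePB

/-! Write N = α + ξ and f_a = f(u_a, …, u_{a+ξ}). Everything is controlled by one polynomial
identity T L = τ_0 (1 + z^N), where T = ∑ τ_i z^i has degree ξ and L = ∑ ℓ_j z^j has degree α with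
ℓ_0 = 1 (`Factorization`). Classes of brackets correspond to such T up to a scalar.

From brackets to factorizations. The Jacobi identity for u_0, u_M, u_{M+α+j} separates variables: j
= ξ shows that the derivatives of f in its first and last variables are multiples of f, and
descending induction on j gives the same for the remaining ones (`HasCoeffs.exists_exponents`).
Hence f = c exp(∑ τ_i x_i). The Jacobi expression is then a quadratic form in the exponentials f_a.
Distinct products f_a f_c are independent characters, so the form vanishes exactly when its
coefficient matrix is antisymmetric (`add_swap_eq_zero_of_sum_expChar`). For suitable triples this
gives recursions for the coefficients b_{k,s} of f_s in g_k, whose only solutions are b_{k,s} =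
ℓ_α⁻¹ ℓ_s ℓ_{s+N-k} with T L = τ_0 (1 + z^N) (`exists_factorization_of_jacobi`). Conversely,
convolution of these b with τ is supported on three diagonals, where the remaining terms cancel
(`Factorization.jacobiCoeff_std`).

From factorizations to the hypersurfaces. Modulo z^N the identity says T = τ_0 / L; reversing the
coefficients gives the same statement from the top. Toeplitz determinants are coefficients of
inverse power series, so L is the sequence λ^α, determined by τ_0, …, τ_{θ-1}, τ_ξ. The θ equations
say that the coefficients of T computed from the bottom and from the top agree
(`Factorization.eqn_eq_zero`, `exists_factorization`).

Equivalence. Comparing leading coefficients shows that a change of coordinate only rescales τ.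
Conversely, an affine change realizes any rescaling and normalizes c, because T(1) L(1) = 2 τ_0
forces T(1) ≠ 0. -/

namespace LatticePB
open Finset

/-! ### Toeplitz determinants and inverse power series. -/

/-- Determinants of band Toeplitz matrices are the coefficients of the inverse power series. -/
theorem det_toeplitz {c d : ℕ → ℂ} (r : ℕ) (h0 : c 0 * d 0 = 1)
    (h : ∀ n, n ≠ 0 → n ≤ r → ∑ p ∈ antidiagonal n, c p.1 * d p.2 = 0) :
    (toeplitz r fun s => (-1) ^ s * c s).det = c 0 ^ (r + 1) * d r := by
  set A : Matrix (Fin (r + 1)) (Fin (r + 1)) ℂ :=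
    Matrix.of fun i j => if (j : ℕ) ≤ (i : ℕ) then c ((i : ℕ) - j) else 0 with hA
  have hdet : A.det = c 0 ^ (r + 1) := by
    rw [Matrix.det_of_isLowerTriangular]
    · simp [hA]
    · intro i j hij
      simp only [hA, Matrix.of_apply]
      rw [if_neg]
      simpa using hij
  have hmul : A.mulVec (fun j => d j) = Pi.single 0 1 := by
    funext i
    have h1 : A.mulVec (fun j => d j) i = ∑ p ∈ antidiagonal (i : ℕ), c p.1 * d p.2 := by
      rw [← Finset.Nat.sum_antidiagonal_swap, Finset.Nat.sum_antidiagonal_eq_sum_range_succ_mk]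
      simp only [Matrix.mulVec, dotProduct, hA, Matrix.of_apply, Prod.swap]
      rw [Fin.sum_univ_eq_sum_range (fun j => (if j ≤ (i : ℕ) then c ((i : ℕ) - j) else 0) * d j)]
      symm
      rw [← Finset.sum_subset (Finset.range_mono (show (i : ℕ) + 1 ≤ r + 1 by omega))]
      · refine Finset.sum_congr rfl fun j hj => ?_
        rw [if_pos (by rw [Finset.mem_range] at hj; omega)]
      · intro j _ hj
        rw [if_neg (by rw [Finset.mem_range] at hj; omega), zero_mul]
    rw [h1]
    by_cases hi : i = 0
    · subst hi; simpa using h0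
    · rw [h i (fun h' => hi (Fin.ext h')) (by omega), Pi.single_eq_of_ne hi]
  -- Cramer's rule for A d = e_0, read in the last component.
  have hcr : A.cramer (Pi.single 0 1) (Fin.last r) = c 0 ^ (r + 1) * d r := by
    rw [← hmul, Matrix.cramer_eq_adjugate_mulVec, Matrix.mulVec_mulVec, Matrix.adjugate_mul, hdet]
    simp [Matrix.smul_mulVec]
  -- The last column is now e_0, so the Laplace expansion leaves the single minor without row 0 and
  -- without the last column; this minor is the band matrix of c.
  rw [← hcr, Matrix.cramer_apply, Matrix.det_succ_column _ (Fin.last r),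
    Finset.sum_eq_single 0]
  · set B : Matrix (Fin r) (Fin r) ℂ := Matrix.of fun i j =>
      if (j : ℕ) ≤ (i : ℕ) + 1 then c ((i : ℕ) + 1 - j) else 0 with hB
    have hsub : (A.updateCol (Fin.last r) (Pi.single 0 1)).submatrix (Fin.succAbove 0)
        (Fin.last r).succAbove = B := by
      ext i j
      rw [Matrix.submatrix_apply, Fin.succAbove_zero, Fin.succAbove_last,
        Matrix.updateCol_ne (Fin.castSucc_ne_last j)]
      simp only [hA, hB, Matrix.of_apply, Fin.val_succ, Fin.val_castSucc]
    -- The alternating signs of the sequence are row and column signs of the matrix; together they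
    -- contribute (-1)^r, which cancels the sign of the Laplace expansion.
    have hT : (toeplitz r fun s => (-1) ^ s * c s) =
        Matrix.of fun i j : Fin r => (-1) ^ ((i : ℕ) + 1) *
          (Matrix.of fun i j : Fin r => (-1) ^ (j : ℕ) * B i j) i j := by
      ext i j
      simp only [toeplitz, hB, Matrix.of_apply]
      split_ifs with hij
      · rw [← mul_assoc, ← pow_add]
        congr 1
        obtain ⟨k, hk⟩ := Nat.exists_eq_add_of_le hij
        rw [hk, Nat.add_sub_cancel_left, show (j : ℕ) + k + j = 2 * j + k by ring, pow_add, pow_mul]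
        simp
      · simp
    rw [hsub, hT, Matrix.det_mul_column, Matrix.det_mul_row, ← mul_assoc, ← Finset.prod_mul_distrib]
    simp only [Matrix.updateCol_self, Pi.single_eq_same, mul_one]
    congr 1
    rw [Finset.prod_congr rfl (g := fun _ => (-1 : ℂ))]
    · simp
    · intro x _
      rw [← pow_add, show (x : ℕ) + 1 + x = 2 * x + 1 by ring, pow_succ, pow_mul]
      simp
  · intro i _ hi
    simp [hi]
  · simp

/-- The coefficients of the inverse of the power series with coefficients `c`. -/
noncomputable def invSeq (c : ℕ → ℂ) (n : ℕ) : ℂ := PowerSeries.coeff n (PowerSeries.mk c)⁻¹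

theorem sum_mul_invSeq {c : ℕ → ℂ} (h0 : c 0 ≠ 0) (n : ℕ) :
    ∑ p ∈ antidiagonal n, c p.1 * invSeq c p.2 = if n = 0 then 1 else 0 := by
  have h : PowerSeries.mk c * (PowerSeries.mk c)⁻¹ = 1 := PowerSeries.mul_inv_cancel _ (by simpa)
  have := congrArg (PowerSeries.coeff n) h
  rw [PowerSeries.coeff_mul, PowerSeries.coeff_one] at this
  simpa [invSeq] using this

theorem mul_invSeq_zero {c : ℕ → ℂ} (h0 : c 0 ≠ 0) : c 0 * invSeq c 0 = 1 := by
  simpa using sum_mul_invSeq h0 0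

theorem det_toeplitz_eq_invSeq {c : ℕ → ℂ} (h0 : c 0 ≠ 0) (r : ℕ) :
    (toeplitz r fun s => (-1) ^ s * c s).det = c 0 ^ (r + 1) * invSeq c r :=
  det_toeplitz r (mul_invSeq_zero h0) fun n hn _ => by rw [sum_mul_invSeq h0, if_neg hn]

/-- A convolution with a sequence that does not vanish at zero can be cancelled. -/
theorem conv_cancel {c x y : ℕ → ℂ} {m : ℕ} (h0 : c 0 ≠ 0)
    (h : ∀ n < m, ∑ p ∈ antidiagonal n, c p.1 * x p.2 = ∑ p ∈ antidiagonal n, c p.1 * y p.2) :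
    ∀ n < m, x n = y n := by
  intro n
  induction n using Nat.strong_induction_on with
  | _ n ih =>
    intro hn
    have h1 := h n hn
    have hmem : (0, n) ∈ antidiagonal n := by simp
    rw [← Finset.add_sum_erase _ _ hmem, ← Finset.add_sum_erase _ _ hmem] at h1
    rw [Finset.sum_congr rfl (g := fun p => c p.1 * y p.2)] at h1
    · exact mul_left_cancel₀ h0 (add_right_cancel h1)
    · intro p hp
      rw [Finset.mem_erase, HasAntidiagonal.mem_antidiagonal] at hp
      have hlt : p.2 < n := by
        by_contra hcon
        exact hp.1 (Prod.ext (by simp; omega) (by simp; omega))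
      rw [ih p.2 hlt (hlt.trans hn)]

/-! ### The numbers λ and the equations in terms of inverse series. -/

section
variable {α ξ : ℕ} {v : Fin (min α ξ + 1) → ℂ}

theorem tauOf_zero (hα : 1 ≤ α) : tauOf α ξ v 0 = v 0 := by
  unfold tauOf
  split_ifs with h h'
  · rfl
  · congr 1
    ext
    simp
    omega
  · omega

theorem tauOf_last : tauOf α ξ v ξ = v (Fin.last _) := by
  unfold tauOf
  rw [dif_neg (by omega), if_pos rfl]

theorem tauOf_gt {i : ℕ} (h : ξ < i) : tauOf α ξ v i = 0 := by
  unfold tauOf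
  rw [dif_neg (by omega), if_neg (by omega)]

theorem lam_zero (hα : 1 ≤ α) : lam α ξ v 0 = 1 := by
  simp [lam, show 0 < α from hα]

theorem lam_self : lam α ξ v α = v 0 * (v (Fin.last (min α ξ)))⁻¹ := by
  simp [lam]

theorem lam_gt {r : ℕ} (h : α < r) : lam α ξ v r = 0 := by
  simp [lam, h.not_gt, h.ne']

theorem lam_of_lt (h0 : v 0 ≠ 0) {r : ℕ} (h : r < α) :
    lam α ξ v r = v 0 * invSeq (tauOf α ξ v) r := by
  have ht : tauOf α ξ v 0 = v 0 := tauOf_zero (by omega)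
  rw [lam, if_pos h]
  simp_rw [mul_assoc]
  rw [det_toeplitz (d := fun r => v 0 * invSeq (tauOf α ξ v) r), ht, inv_mul_cancel₀ h0]
  · simp
  · rw [ht, inv_mul_cancel₀ h0, ← ht, mul_invSeq_zero (by rwa [ht]), one_mul]
  · intro n hn _
    have := sum_mul_invSeq (c := tauOf α ξ v) (by rwa [ht]) n
    rw [if_neg hn] at this
    rw [← this]
    refine Finset.sum_congr rfl fun p _ => ?_
    field_simp

theorem sum_tauOf_mul_lam (h0 : v 0 ≠ 0) {n : ℕ} (h : n < α) :
    ∑ p ∈ antidiagonal n, tauOf α ξ v p.1 * lam α ξ v p.2 = if n = 0 then v 0 else 0 := by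
  have ht : tauOf α ξ v 0 = v 0 := tauOf_zero (by omega)
  have := sum_mul_invSeq (c := tauOf α ξ v) (by rwa [ht]) n
  rw [Finset.sum_congr rfl (g := fun p => v 0 * (tauOf α ξ v p.1 * invSeq (tauOf α ξ v) p.2)),
    ← Finset.mul_sum, this]
  · simp
  · intro p hp
    rw [HasAntidiagonal.mem_antidiagonal] at hp
    rw [lam_of_lt h0 (by omega)]
    ring

/-- The reversed sequence `λ^α_q`, `0 ≤ q ≤ α`. -/
noncomputable def lamRev (α ξ : ℕ) (v : Fin (min α ξ + 1) → ℂ) (q : ℕ) : ℂ :=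
  if q ≤ α then lam α ξ v (α - q) else 0

theorem lamRev_zero : lamRev α ξ v 0 = v 0 * (v (Fin.last (min α ξ)))⁻¹ := by
  simp [lamRev, lam_self]

theorem det_sig (hα : 1 ≤ α) (r : ℕ) :
    (toeplitz r (sig α ξ v)).det = invSeq (lam α ξ v) r := by
  have := det_toeplitz_eq_invSeq (c := lam α ξ v) (by rw [lam_zero hα]; exact one_ne_zero) r
  rw [lam_zero hα, one_pow, one_mul] at this
  exact this

/-- Since σ_{α-q} = (-1)^q (-1)^α λ^α_q, the determinant is a coefficient of the inverse of the
reversed sequence; the prefactors absorb the sign (-1)^α and the leading term τ_0 / τ_ξ. -/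
theorem det_sigRev (h0 : v 0 ≠ 0) (h1 : v (Fin.last _) ≠ 0) (m : ℕ) :
    (-1) ^ (α * m) * v (Fin.last (min α ξ)) ^ (m + 1) * (toeplitz m (sigRev α ξ v)).det =
      v 0 ^ (m + 1) * invSeq (lamRev α ξ v) m := by
  have hs : ((-1 : ℂ) ^ α) * (-1) ^ α = 1 := by rw [← pow_add, ← two_mul, pow_mul]; simp
  have hne : lamRev α ξ v 0 ≠ 0 := by
    rw [lamRev_zero]; exact mul_ne_zero h0 (inv_ne_zero h1)
  have hfun : sigRev α ξ v = fun q => (-1) ^ q * ((-1) ^ α * lamRev α ξ v q) := by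
    funext q
    unfold sigRev lamRev sig
    split_ifs with hq
    · rw [← mul_assoc]
      congr 1
      obtain ⟨k, rfl⟩ := Nat.exists_eq_add_of_le hq
      rw [Nat.add_sub_cancel_left, ← pow_add, show q + (q + k) = 2 * q + k by ring, pow_add,
        pow_mul]
      simp
    · simp
  rw [hfun, det_toeplitz (d := fun q => (-1) ^ α * invSeq (lamRev α ξ v) q), lamRev_zero]
  · have h3 : (-1 : ℂ) ^ (α * m) * (((-1) ^ α) ^ (m + 1) * (-1) ^ α) = 1 := by
      rw [pow_mul, pow_succ, mul_assoc, hs, mul_one, ← mul_pow, hs, one_pow]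
    rw [mul_pow, mul_pow, inv_pow]
    have h4 := mul_inv_cancel₀ (pow_ne_zero (m + 1) h1)
    generalize v (Fin.last (min α ξ)) ^ (m + 1) = V, ((-1 : ℂ) ^ α) ^ (m + 1) = S at *
    linear_combination v 0 ^ (m + 1) * invSeq (lamRev α ξ v) m * (V * V⁻¹ * h3 + h4)
  · have := mul_invSeq_zero hne
    linear_combination lamRev α ξ v 0 * invSeq (lamRev α ξ v) 0 * hs + this
  · intro n hn _
    have := sum_mul_invSeq hne n
    rw [if_neg hn] at this
    rw [← this]
    refine Finset.sum_congr rfl fun p _ => ?_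
    linear_combination lamRev α ξ v p.1 * invSeq (lamRev α ξ v) p.2 * hs

/-- Both sides are τ_{ξ-p} / τ_0: the left one computed from the bottom of T L = τ_0 (1 + z^N), the
right one from the top. -/
theorem eqnA_eq_zero_iff (hα : 1 ≤ α) (h0 : v 0 ≠ 0) (h1 : v (Fin.last _) ≠ 0) (p : ℕ) :
    eqnA α ξ p v = 0 ↔ invSeq (lam α ξ v) (ξ - p) = invSeq (lamRev α ξ v) p := by
  rw [eqnA, det_sig hα, det_sigRev h0 h1, ← mul_sub, mul_eq_zero, sub_eq_zero]
  simp [h0]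

/-- Here τ_p is itself one of the coordinates, and it is compared with its value computed from the
top. -/
theorem eqnB_eq_zero_iff (h0 : v 0 ≠ 0) (h1 : v (Fin.last _) ≠ 0) (p : ℕ) :
    eqnB α ξ p v = 0 ↔ tauOf α ξ v p = v 0 * invSeq (lamRev α ξ v) (ξ - p) := by
  rw [eqnB, det_sigRev h0 h1, pow_succ, mul_assoc, ← mul_sub, mul_eq_zero, sub_eq_zero]
  simp [h0]

end

/-! ### Factorizations of 1 + z^(α+ξ). -/

/-- Convolutions of finitely supported sequences, read from the top. -/
theorem sum_antidiagonal_reverse {α ξ m n : ℕ} {τ ℓ : ℕ → ℂ} (hτ : ∀ i, ξ < i → τ i = 0)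
    (hℓ : ∀ j, α < j → ℓ j = 0) (h : m + n = α + ξ) :
    ∑ p ∈ antidiagonal n, τ p.1 * ℓ p.2 =
      ∑ p ∈ antidiagonal m, (if p.1 ≤ ξ then τ (ξ - p.1) else 0) *
        (if p.2 ≤ α then ℓ (α - p.2) else 0) := by
  rw [← Finset.sum_filter_of_ne (p := fun p : ℕ × ℕ => p.1 ≤ ξ ∧ p.2 ≤ α),
    ← Finset.sum_filter_of_ne (s := antidiagonal m) (p := fun p : ℕ × ℕ => p.1 ≤ ξ ∧ p.2 ≤ α)]
  · refine Finset.sum_nbij' (fun p => (ξ - p.1, α - p.2)) (fun p => (ξ - p.1, α - p.2)) ?_ ?_ ?_ ?_ ?_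
    · intro p hp
      simp only [Finset.mem_filter, HasAntidiagonal.mem_antidiagonal] at hp ⊢
      omega
    · intro p hp
      simp only [Finset.mem_filter, HasAntidiagonal.mem_antidiagonal] at hp ⊢
      omega
    · intro p hp
      simp only [Finset.mem_filter] at hp
      ext <;> simp <;> omega
    · intro p hp
      simp only [Finset.mem_filter] at hp
      ext <;> simp <;> omega
    · intro p hp
      simp only [Finset.mem_filter] at hp
      rw [if_pos (by simp), if_pos (by simp), Nat.sub_sub_self hp.2.1, Nat.sub_sub_self hp.2.2]
  · intro p _ hp
    constructor <;> by_contra hc <;> simp [hc] at hp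
  · intro p _ hp
    constructor <;> by_contra hc
    · simp [hτ _ (not_le.1 hc)] at hp
    · simp [hℓ _ (not_le.1 hc)] at hp

/-- `T L = τ_0 (1 + z ^ (α + ξ))` for `T = ∑ τ_i z ^ i` of degree `ξ`, `L = ∑ ℓ_j z ^ j` of degree
at most `α`. -/
structure Factorization (α ξ : ℕ) (τ ℓ : ℕ → ℂ) : Prop where
  zero_ne : τ 0 ≠ 0
  last_ne : τ ξ ≠ 0
  tau_gt : ∀ i, ξ < i → τ i = 0
  ell_gt : ∀ j, α < j → ℓ j = 0
  conv : ∀ n, ∑ p ∈ antidiagonal n, τ p.1 * ℓ p.2 = if n = 0 ∨ n = α + ξ then τ 0 else 0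

theorem coords_zero {α ξ : ℕ} (hα : 1 ≤ α) (τ : ℕ → ℂ) : coords α ξ τ 0 = τ 0 := by
  unfold coords
  split_ifs with h
  · rfl
  · congr 1
    simp at h
    omega

theorem coords_last {α ξ : ℕ} (τ : ℕ → ℂ) : coords α ξ τ (Fin.last _) = τ ξ := by
  simp [coords]

theorem tauOf_coords_of_lt {α ξ : ℕ} {τ : ℕ → ℂ} (hτ : ∀ i, ξ < i → τ i = 0) {i : ℕ}
    (hi : i < α) : tauOf α ξ (coords α ξ τ) i = τ i := by
  unfold tauOf
  split_ifs with h h'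
  · simp [coords]
    omega
  · rw [coords_last, h']
  · rw [hτ]
    omega

namespace Factorization
variable {α ξ : ℕ} {τ ℓ : ℕ → ℂ}

theorem smul (h : Factorization α ξ τ ℓ) {a : ℂ} (ha : a ≠ 0) :
    Factorization α ξ (a • τ) ℓ where
  zero_ne := mul_ne_zero ha h.zero_ne
  last_ne := mul_ne_zero ha h.last_ne
  tau_gt i hi := by simp [h.tau_gt i hi]
  ell_gt := h.ell_gt
  conv n := by
    have := h.conv n
    simp only [Pi.smul_apply, smul_eq_mul, mul_assoc, ← Finset.mul_sum, this]
    split_ifs <;> simp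

theorem ell_zero (h : Factorization α ξ τ ℓ) : ℓ 0 = 1 := by
  have := h.conv 0
  simpa [h.zero_ne] using this

theorem ell_self (h : Factorization α ξ τ ℓ) : ℓ α = τ 0 * (τ ξ)⁻¹ := by
  have := h.conv (α + ξ)
  rw [sum_antidiagonal_reverse h.tau_gt h.ell_gt (zero_add _)] at this
  have h2 : τ ξ * ℓ α = τ 0 := by simpa using this
  rw [← h2, mul_comm, inv_mul_cancel_left₀ h.last_ne]

/-- Modulo z^α the identity inverts T, which determines ℓ_r for r < α from the τ_i with i < α; these
are all visible in the coordinates. The coefficient of z^N gives ℓ_α. -/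
theorem ell_eq (h : Factorization α ξ τ ℓ) (hα : 1 ≤ α) : ℓ = lam α ξ (coords α ξ τ) := by
  have h0 : coords α ξ τ 0 ≠ 0 := by rw [coords_zero hα]; exact h.zero_ne
  funext r
  rcases lt_trichotomy r α with hr | rfl | hr
  · refine conv_cancel (c := τ) (m := α) h.zero_ne (fun n hn => ?_) r hr
    rw [h.conv, Finset.sum_congr rfl (g := fun p : ℕ × ℕ =>
      tauOf α ξ (coords α ξ τ) p.1 * lam α ξ (coords α ξ τ) p.2), sum_tauOf_mul_lam h0 hn,
      coords_zero hα]
    · simp [show n ≠ α + ξ by omega]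
    · intro p hp
      rw [HasAntidiagonal.mem_antidiagonal] at hp
      rw [tauOf_coords_of_lt h.tau_gt (by omega)]
  · rw [h.ell_self, lam_self, coords_zero hα, coords_last]
  · rw [h.ell_gt r hr, lam_gt hr]

/-- This is T = τ_0 / L modulo z^N. -/
theorem invSeq_lam (h : Factorization α ξ τ ℓ) {n : ℕ} (hn : n < α + ξ) :
    τ n = τ 0 * invSeq ℓ n := by
  have hne : ℓ 0 ≠ 0 := by rw [h.ell_zero]; exact one_ne_zero
  refine conv_cancel (c := ℓ) (x := τ) (y := fun n => τ 0 * invSeq ℓ n) hne (fun k hk => ?_) n hn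
  rw [← Finset.Nat.sum_antidiagonal_swap]
  simp only [Prod.swap, mul_comm (ℓ _) (τ _)]
  rw [h.conv]
  simp only [← mul_assoc, mul_comm (ℓ _) (τ 0)]
  simp only [mul_assoc, ← Finset.mul_sum, sum_mul_invSeq hne]
  simp [hk.ne]

/-- The identity is symmetric under reversal of coefficients, so the reversed T is τ_0 divided by
the reversed L, up to degree ξ. -/
theorem invSeq_lamRev (h : Factorization α ξ τ ℓ) (hα : 1 ≤ α) {p : ℕ} (hp : p ≤ ξ) :
    τ (ξ - p) = τ 0 * invSeq (lamRev α ξ (coords α ξ τ)) p := by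
  have hne : lamRev α ξ (coords α ξ τ) 0 ≠ 0 := by
    rw [lamRev_zero, coords_zero hα, coords_last]
    exact mul_ne_zero h.zero_ne (inv_ne_zero h.last_ne)
  have := conv_cancel (c := lamRev α ξ (coords α ξ τ))
    (x := fun p => if p ≤ ξ then τ (ξ - p) else 0) (m := ξ + 1)
    (y := fun n => τ 0 * invSeq (lamRev α ξ (coords α ξ τ)) n) hne (fun k hk => ?_) p (by omega)
  · simpa [hp] using this
  · rw [← Finset.Nat.sum_antidiagonal_swap]
    simp only [Prod.swap, lamRev, ← h.ell_eq hα]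
    rw [Finset.sum_congr rfl fun x _ => mul_comm (if x.2 ≤ α then ℓ (α - x.2) else 0)
      (if x.1 ≤ ξ then τ (ξ - x.1) else 0)]
    rw [← sum_antidiagonal_reverse h.tau_gt h.ell_gt (n := α + ξ - k) (by omega), h.conv]
    have h2 := sum_mul_invSeq hne k
    simp only [← mul_assoc, mul_comm (ite _ _ _) (τ 0)]
    simp only [mul_assoc, ← Finset.mul_sum]
    simp only [lamRev, ← h.ell_eq hα] at h2
    rw [h2]
    by_cases hk0 : k = 0
    · simp [hk0]
    · rw [if_neg (by omega), if_neg hk0, mul_zero]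

theorem eqn_eq_zero (h : Factorization α ξ τ ℓ) (hα : 1 ≤ α) {p : ℕ} (hp : p < min α ξ) :
    eqn α ξ p (coords α ξ τ) = 0 := by
  have h0 : coords α ξ τ 0 ≠ 0 := by rw [coords_zero hα]; exact h.zero_ne
  have h1 : coords α ξ τ (Fin.last _) ≠ 0 := by rw [coords_last]; exact h.last_ne
  have hA : eqnA α ξ p (coords α ξ τ) = 0 := by
    rw [eqnA_eq_zero_iff hα h0 h1]
    refine mul_left_cancel₀ h.zero_ne ?_
    rw [← h.invSeq_lamRev hα (by omega), ← h.ell_eq hα, ← h.invSeq_lam (by omega)]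
  have hB : eqnB α ξ p (coords α ξ τ) = 0 := by
    rw [eqnB_eq_zero_iff h0 h1, tauOf_coords_of_lt h.tau_gt (by omega), coords_zero hα,
      ← h.invSeq_lamRev hα (by omega), Nat.sub_sub_self (by omega)]
  unfold eqn
  split_ifs <;> assumption

/-- The coordinates omit some τ_i when ξ > α, but they determine L, and then T = τ_0 / L modulo z^N.
-/
theorem eq_of_coords_eq {τ' ℓ' : ℕ → ℂ} (h : Factorization α ξ τ ℓ) (h' : Factorization α ξ τ' ℓ')
    (hα : 1 ≤ α) (hc : coords α ξ τ = coords α ξ τ') : τ = τ' := by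
  have hℓ : ℓ = ℓ' := by rw [h.ell_eq hα, h'.ell_eq hα, hc]
  have h0 : τ 0 = τ' 0 := by rw [← coords_zero (ξ := ξ) hα τ, hc, coords_zero hα]
  funext n
  rcases le_or_gt n ξ with hn | hn
  · rw [h.invSeq_lam (by omega), h'.invSeq_lam (by omega), hℓ, h0]
  · rw [h.tau_gt n hn, h'.tau_gt n hn]

/-- Evaluation at z = 1 gives T(1) L(1) = 2 τ_0 if N > 0, and τ_0 if N = 0. This is what later
allows the constant c to be normalized by a translation. -/
theorem sum_ne_zero (h : Factorization α ξ τ ℓ) : ∑ i ∈ range (ξ + 1), τ i ≠ 0 := by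
  intro hs
  have h1 : (∑ i ∈ range (ξ + 1), τ i) * ∑ j ∈ range (α + 1), ℓ j =
      ∑ k ∈ range (α + ξ + 1), ∑ p ∈ antidiagonal k, τ p.1 * ℓ p.2 := by
    rw [Finset.sum_mul_sum, ← Finset.sum_product', Finset.sum_sigma']
    symm
    refine Finset.sum_bij_ne_zero (fun x _ _ => x.2) ?_ ?_ ?_ ?_
    · rintro ⟨k, i, j⟩ _ hne
      simp only [Finset.mem_product, Finset.mem_range]
      constructor
      · by_contra hc; exact hne (by simp [h.tau_gt i (by omega)])
      · by_contra hc; exact hne (by simp [h.ell_gt j (by omega)])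
    · rintro ⟨k, i, j⟩ hx _ ⟨k', i', j'⟩ hx' _ heq
      simp only [Finset.mem_sigma, HasAntidiagonal.mem_antidiagonal] at hx hx' heq
      obtain ⟨rfl, rfl⟩ := Prod.mk.inj heq
      obtain rfl : k = k' := hx.2.symm.trans hx'.2
      rfl
    · rintro ⟨i, j⟩ hx hne
      simp only [Finset.mem_product, Finset.mem_range] at hx
      exact ⟨⟨i + j, i, j⟩, by simp; omega, hne, rfl⟩
    · intros; rfl
  rw [hs, zero_mul] at h1
  simp only [h.conv] at h1
  rw [Finset.sum_range_succ] at h1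
  rcases Nat.eq_zero_or_pos (α + ξ) with hz | hz
  · exact h.zero_ne (by simpa [hz] using h1.symm)
  · rw [Finset.sum_eq_single_of_mem 0 (by simpa using hz)] at h1
    · have h3 : τ 0 + τ 0 = 0 := by simpa using h1.symm
      exact h.zero_ne (by linear_combination h3 / 2)
    · intro b hb hb0
      rw [if_neg (by simp at hb; omega)]

end Factorization

/-- T is built so that the low coefficients of T L are right by construction; the equations say that
its top coefficients are those of the reversed inverse, which makes the high coefficients of T L
right as well. -/
theorem exists_factorization {α ξ : ℕ} (hα : 1 ≤ α) {v : Fin (min α ξ + 1) → ℂ} (h0 : v 0 ≠ 0)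
    (h1 : v (Fin.last _) ≠ 0) (heq : ∀ p < min α ξ, eqn α ξ p v = 0) :
    ∃ τ, coords α ξ τ = v ∧ Factorization α ξ τ (lam α ξ v) := by
  have hl0 : lam α ξ v 0 ≠ 0 := by rw [lam_zero hα]; exact one_ne_zero
  have hr0 : lamRev α ξ v 0 ≠ 0 := by rw [lamRev_zero]; exact mul_ne_zero h0 (inv_ne_zero h1)
  have hlast : v (Fin.last _) = v 0 * invSeq (lamRev α ξ v) 0 := by
    have := mul_invSeq_zero hr0
    rw [lamRev_zero] at this
    field_simp at this
    exact this.symm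
  -- the low coefficients of `T`
  have hlow : ∀ n < α, tauOf α ξ v n = v 0 * invSeq (lam α ξ v) n := by
    refine conv_cancel (c := lam α ξ v) hl0 fun k hk => ?_
    rw [← Finset.Nat.sum_antidiagonal_swap]
    simp only [Prod.swap, mul_comm (lam _ _ _ _) (tauOf _ _ _ _)]
    rw [sum_tauOf_mul_lam h0 hk]
    simp only [← mul_assoc, mul_comm (lam _ _ _ _) (v 0)]
    simp only [mul_assoc, ← Finset.mul_sum, sum_mul_invSeq hl0]
    simp
  obtain ⟨τ, hcoords, hgt, hbot, htop⟩ : ∃ τ : ℕ → ℂ, coords α ξ τ = v ∧ (∀ i, ξ < i → τ i = 0) ∧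
      (∀ n, n ≤ ξ ∨ n < α → ∑ p ∈ antidiagonal n, τ p.1 * lam α ξ v p.2 =
        if n = 0 then v 0 else 0) ∧
      (∀ a, a < α → a ≤ ξ → τ (ξ - a) = v 0 * invSeq (lamRev α ξ v) a) := by
    rcases le_or_gt α ξ with hle | hlt
    -- For α ≤ ξ take T to be the truncation of τ_0 / L at degree ξ. Its top α coefficients must
    -- match the inverse of the reversed L.
    · have htop : ∀ a < α, invSeq (lam α ξ v) (ξ - a) = invSeq (lamRev α ξ v) a := by
        intro a ha
        have h2 := heq a (by omega)
        unfold eqn at h2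
        split_ifs at h2 with c1 c2 c3
        · exact (eqnA_eq_zero_iff hα h0 h1 a).1 h2
        · omega
        · exact (eqnA_eq_zero_iff hα h0 h1 a).1 h2
        -- For equations of the second kind, the condition on τ_{ξ-a} is equation number ξ - a; this
        -- number is again below α and in the same range.
        · have h3 := heq (ξ - a) (by omega)
          unfold eqn at h3
          rw [if_neg c1, if_neg c2, if_neg (by omega), eqnB_eq_zero_iff h0 h1,
            hlow _ (by omega), Nat.sub_sub_self (by omega)] at h3
          exact mul_left_cancel₀ h0 h3
      refine ⟨fun i => if i ≤ ξ then v 0 * invSeq (lam α ξ v) i else 0, ?_, ?_, ?_, ?_⟩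
      · funext i
        unfold coords
        dsimp only
        by_cases hi : (i : ℕ) < min α ξ
        · rw [if_pos hi, if_pos (by omega), ← hlow _ (by omega), tauOf, dif_pos hi]
        · rw [if_neg hi, if_pos le_rfl]
          obtain rfl : i = Fin.last _ := Fin.ext (by simp; omega)
          rw [hlast, ← htop 0 (by omega), Nat.sub_zero]
      · intro i hi
        exact if_neg (by omega)
      · intro n hn
        have := sum_mul_invSeq hl0 n
        rw [← Finset.Nat.sum_antidiagonal_swap] at this
        simp only [Prod.swap] at this
        rw [Finset.sum_congr rfl (g := fun p : ℕ × ℕ =>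
          v 0 * (lam α ξ v p.2 * invSeq (lam α ξ v) p.1)), ← Finset.mul_sum, this]
        · simp
        · intro p hp
          rw [HasAntidiagonal.mem_antidiagonal] at hp
          dsimp only
          rw [if_pos (by omega)]
          ring
      · intro a ha haξ
        dsimp only
        rw [if_pos (by omega), htop a ha]
    -- For ξ < α every τ_i is a coordinate, so T is given.
    · refine ⟨tauOf α ξ v, ?_, fun i hi => tauOf_gt hi,
        fun n hn => sum_tauOf_mul_lam h0 (by omega), ?_⟩
      · funext i
        unfold coords
        by_cases hi : (i : ℕ) < min α ξ
        · rw [if_pos hi, tauOf, dif_pos hi]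
        · rw [if_neg hi, tauOf_last]
          obtain rfl : i = Fin.last _ := Fin.ext (by simp; omega)
          rfl
      · intro a ha haξ
        rcases Nat.eq_zero_or_pos a with rfl | ha0
        · rw [Nat.sub_zero, tauOf_last, hlast]
        · have h3 := heq (ξ - a) (by omega)
          unfold eqn at h3
          rw [if_neg (by omega), if_pos hlt, eqnB_eq_zero_iff h0 h1,
            Nat.sub_sub_self (by omega)] at h3
          exact h3
  have hτ0 : τ 0 = v 0 := by rw [← hcoords, coords_zero hα]
  have hτξ : τ ξ = v (Fin.last _) := by rw [← hcoords, coords_last]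
  refine ⟨τ, hcoords, by rwa [hτ0], by rwa [hτξ], hgt, fun j hj => lam_gt hj, fun n => ?_⟩
  rw [hτ0]
  -- Low degrees are settled from the bottom. Otherwise m = N - n satisfies m < α and m ≤ ξ, the
  -- range in which the top coefficients of T are known.
  by_cases hn : n ≤ ξ ∨ n < α
  · rw [hbot n hn]
    simp [show n ≠ α + ξ by omega]
  rcases le_or_gt n (α + ξ) with hnN | hnN
  · obtain ⟨m, hm⟩ : ∃ m, m + n = α + ξ := ⟨α + ξ - n, by omega⟩
    rw [sum_antidiagonal_reverse hgt (fun j hj => lam_gt hj) hm,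
      Finset.sum_congr rfl (g := fun p : ℕ × ℕ =>
        v 0 * (lamRev α ξ v p.2 * invSeq (lamRev α ξ v) p.1)), ← Finset.mul_sum]
    · have := sum_mul_invSeq hr0 m
      rw [← Finset.Nat.sum_antidiagonal_swap] at this
      simp only [Prod.swap] at this
      rw [this]
      by_cases hm0 : m = 0
      · rw [if_pos hm0, if_pos (by omega), mul_one]
      · rw [if_neg hm0, if_neg (by omega), mul_zero]
    · intro p hp
      rw [HasAntidiagonal.mem_antidiagonal] at hp
      rw [if_pos (by omega), htop _ (by omega) (by omega), lamRev]
      ring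
  · rw [if_neg (by omega)]
    refine Finset.sum_eq_zero fun p hp => ?_
    rw [HasAntidiagonal.mem_antidiagonal] at hp
    rcases le_or_gt p.1 ξ with h2 | h2
    · rw [lam_gt (by omega), mul_zero]
    · rw [hgt _ h2, zero_mul]

/-! ### Homogeneity of the equations. -/

/-- `φ` is, away from `v_0 v_θ = 0`, a homogeneous polynomial of degree `d + 2 m` divided by
`(v_0 v_θ) ^ m`. -/
def IsHomLaurent {θ : ℕ} (d : ℤ) (φ : (Fin (θ + 1) → ℂ) → ℂ) : Prop :=
  ∃ (m n : ℕ) (F : MvPolynomial (Fin (θ + 1)) ℂ), F.IsHomogeneous n ∧ (n : ℤ) = d + 2 * m ∧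
    ∀ v, v 0 ≠ 0 → v (Fin.last θ) ≠ 0 →
      MvPolynomial.eval v F = (v 0 * v (Fin.last θ)) ^ m * φ v

namespace IsHomLaurent
open MvPolynomial
variable {θ : ℕ} {d e : ℤ} {φ ψ : (Fin (θ + 1) → ℂ) → ℂ}

theorem congr (h : IsHomLaurent d φ) (hφ : ∀ v, v 0 ≠ 0 → v (Fin.last θ) ≠ 0 → ψ v = φ v) :
    IsHomLaurent d ψ := by
  obtain ⟨m, n, F, hF, hn, h⟩ := h
  exact ⟨m, n, F, hF, hn, fun v h0 h1 => by rw [h v h0 h1, hφ v h0 h1]⟩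

/-- Multiplying by powers of v_0 v_θ makes every larger m admissible, so that sums can be put over a
common denominator. -/
theorem raise (h : IsHomLaurent d φ) : ∃ m₀ : ℕ, ∀ m ≥ m₀, ∃ (n : ℕ)
    (F : MvPolynomial (Fin (θ + 1)) ℂ), F.IsHomogeneous n ∧ (n : ℤ) = d + 2 * m ∧
    ∀ v, v 0 ≠ 0 → v (Fin.last θ) ≠ 0 →
      MvPolynomial.eval v F = (v 0 * v (Fin.last θ)) ^ m * φ v := by
  obtain ⟨m, n, F, hF, hn, h⟩ := h
  refine ⟨m, fun m' hm' => ⟨n + 2 * (m' - m), F * (X 0 * X (Fin.last θ)) ^ (m' - m), ?_, ?_, ?_⟩⟩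
  · exact hF.mul (((isHomogeneous_X ℂ _).mul (isHomogeneous_X ℂ _)).pow _)
  · push_cast [Nat.cast_sub hm']
    linarith
  · intro v h0 h1
    obtain ⟨k, rfl⟩ := Nat.exists_eq_add_of_le hm'
    simp only [map_mul, map_pow, eval_X, h v h0 h1, Nat.add_sub_cancel_left, pow_add]
    ring

theorem zero : IsHomLaurent (θ := θ) d fun _ => 0 :=
  -- The degree d may be negative; m = |d| makes d + 2m nonnegative.
  ⟨d.natAbs, (d + 2 * d.natAbs).toNat, 0, isHomogeneous_zero _ _ _, by omega, by simp⟩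

theorem const (c : ℂ) : IsHomLaurent (θ := θ) 0 fun _ => c :=
  ⟨0, 0, C c, isHomogeneous_C _ _, by simp, by simp⟩

theorem coord (i : Fin (θ + 1)) : IsHomLaurent (θ := θ) 1 fun v => v i :=
  ⟨0, 1, X i, isHomogeneous_X _ _, by simp, by simp⟩

theorem inv_zero : IsHomLaurent (θ := θ) (-1) fun v => (v 0)⁻¹ :=
  ⟨1, 1, X (Fin.last θ), isHomogeneous_X _ _, by simp, fun v h0 _ => by
    simp only [eval_X]; field_simp⟩

theorem inv_last : IsHomLaurent (θ := θ) (-1) fun v => (v (Fin.last θ))⁻¹ :=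
  ⟨1, 1, X 0, isHomogeneous_X _ _, by simp, fun v _ h1 => by
    simp only [eval_X]; field_simp⟩

theorem add (h : IsHomLaurent d φ) (h' : IsHomLaurent d ψ) :
    IsHomLaurent d fun v => φ v + ψ v := by
  obtain ⟨m₁, h⟩ := h.raise
  obtain ⟨m₂, h'⟩ := h'.raise
  obtain ⟨n, F, hF, hn, h⟩ := h (max m₁ m₂) (le_max_left _ _)
  obtain ⟨n', F', hF', hn', h'⟩ := h' (max m₁ m₂) (le_max_right _ _)
  obtain rfl : n = n' := by omega
  exact ⟨_, n, F + F', hF.add hF', hn, fun v h0 h1 => by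
    rw [map_add, h v h0 h1, h' v h0 h1, mul_add]⟩

theorem mul (h : IsHomLaurent d φ) (h' : IsHomLaurent e ψ) :
    IsHomLaurent (d + e) fun v => φ v * ψ v := by
  obtain ⟨m, n, F, hF, hn, h⟩ := h
  obtain ⟨m', n', F', hF', hn', h'⟩ := h'
  refine ⟨m + m', n + n', F * F', hF.mul hF', by push_cast; linarith, fun v h0 h1 => ?_⟩
  rw [map_mul, h v h0 h1, h' v h0 h1]
  ring

theorem const_mul (c : ℂ) (h : IsHomLaurent d φ) : IsHomLaurent d fun v => c * φ v := by
  simpa using (const (θ := θ) c).mul h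

theorem sub (h : IsHomLaurent d φ) (h' : IsHomLaurent d ψ) :
    IsHomLaurent d fun v => φ v - ψ v :=
  (h.add (h'.const_mul (-1))).congr fun v _ _ => by ring

theorem pow (h : IsHomLaurent d φ) (k : ℕ) : IsHomLaurent (k * d) fun v => φ v ^ k := by
  induction k with
  | zero => simpa using const (θ := θ) 1
  | succ k ih =>
    have := ih.mul h
    simp only [← pow_succ] at this
    convert this using 1
    push_cast
    ring

theorem sum {ι : Type*} (s : Finset ι) {f : ι → (Fin (θ + 1) → ℂ) → ℂ}
    (h : ∀ i ∈ s, IsHomLaurent d (f i)) : IsHomLaurent d fun v => ∑ i ∈ s, f i v := by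
  classical
  induction s using Finset.induction_on with
  | empty => simpa using zero
  | insert a s ha ih =>
    simp only [Finset.sum_insert ha]
    exact (h a (by simp)).add (ih fun i hi => h i (by simp [hi]))

theorem prod {ι : Type*} (s : Finset ι) {f : ι → (Fin (θ + 1) → ℂ) → ℂ}
    (h : ∀ i ∈ s, IsHomLaurent 0 (f i)) : IsHomLaurent 0 fun v => ∏ i ∈ s, f i v := by
  classical
  induction s using Finset.induction_on with
  | empty => simpa using const 1
  | insert a s ha ih =>
    simp only [Finset.prod_insert ha]
    simpa using (h a (by simp)).mul (ih fun i hi => h i (by simp [hi]))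

theorem det_toeplitz (r : ℕ) {a : (Fin (θ + 1) → ℂ) → ℕ → ℂ}
    (h : ∀ q, IsHomLaurent 0 fun v => a v q) : IsHomLaurent 0 fun v => (toeplitz r (a v)).det := by
  simp only [Matrix.det_apply']
  refine sum _ fun σ _ => const_mul _ (prod _ fun i _ => ?_)
  simp only [toeplitz, Matrix.of_apply]
  split_ifs
  · exact h _
  · exact zero

end IsHomLaurent

section
variable (α ξ : ℕ)

theorem isHomLaurent_tauOf (i : ℕ) : IsHomLaurent 1 fun v => tauOf α ξ v i := by
  unfold tauOf
  split_ifs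
  · exact .coord _
  · exact .coord _
  · exact .zero

theorem isHomLaurent_lam (r : ℕ) : IsHomLaurent 0 fun v => lam α ξ v r := by
  unfold lam
  split_ifs
  · refine .det_toeplitz r fun q => ?_
    simp only [mul_assoc]
    exact .const_mul _ (IsHomLaurent.inv_zero.mul (isHomLaurent_tauOf α ξ q))
  · exact (IsHomLaurent.coord 0).mul .inv_last
  · exact .zero

theorem isHomLaurent_sig (q : ℕ) : IsHomLaurent 0 fun v => sig α ξ v q :=
  .const_mul _ (isHomLaurent_lam α ξ q)

theorem isHomLaurent_sigRev (q : ℕ) : IsHomLaurent 0 fun v => sigRev α ξ v q := by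
  unfold sigRev
  split_ifs
  · exact isHomLaurent_sig α ξ _
  · exact .zero

theorem isHomLaurent_eqnA (p : ℕ) : IsHomLaurent (p + 1) (eqnA α ξ p) := by
  refine IsHomLaurent.sub ?_ ?_
  · simpa using ((IsHomLaurent.coord 0).pow (p + 1)).mul
      (.det_toeplitz (ξ - p) (isHomLaurent_sig α ξ))
  · simpa using (((IsHomLaurent.coord (Fin.last _)).pow (p + 1)).const_mul _).mul
      (.det_toeplitz p (isHomLaurent_sigRev α ξ))

theorem isHomLaurent_eqnB (p : ℕ) : IsHomLaurent ((ξ - p : ℕ) + 1) (eqnB α ξ p) := by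
  refine IsHomLaurent.sub ?_ ?_
  · simpa using ((IsHomLaurent.coord 0).pow (ξ - p)).mul (isHomLaurent_tauOf α ξ p)
  · simpa using (((IsHomLaurent.coord (Fin.last _)).pow (ξ - p + 1)).const_mul _).mul
      (.det_toeplitz (ξ - p) (isHomLaurent_sigRev α ξ))

theorem exists_isHomLaurent_eqn (p : ℕ) : ∃ d, IsHomLaurent d (eqn α ξ p) := by
  unfold eqn
  split_ifs
  exacts [⟨_, isHomLaurent_eqnA α ξ p⟩, ⟨_, isHomLaurent_eqnB α ξ p⟩, ⟨_, isHomLaurent_eqnA α ξ p⟩,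
    ⟨_, isHomLaurent_eqnB α ξ p⟩]

end

/-! ### The equations are not identically zero. -/

theorem continuous_det_toeplitz {a : ℂ → ℕ → ℂ} (r : ℕ) (h : ∀ q, Continuous fun s => a s q) :
    Continuous fun s => (toeplitz r (a s)).det := by
  refine Continuous.matrix_det (continuous_matrix fun i j => ?_)
  simp only [toeplitz, Matrix.of_apply]
  split_ifs
  · exact h _
  · exact continuous_const

theorem exists_ne_of_continuous {G : ℂ → ℂ} (hG : Continuous G) (h0 : G 0 ≠ 0) :
    ∃ s, s ≠ 0 ∧ G s ≠ 0 := by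
  have h1 := hG.continuousAt.eventually_ne h0
  obtain ⟨s, hs, hs0⟩ := ((eventually_nhdsWithin_of_eventually_nhds h1).and
    (self_mem_nhdsWithin (s := {0}ᶜ))).exists
  exact ⟨s, hs0, hs⟩

theorem det_toeplitz_mul (r : ℕ) (s : ℂ) (a : ℕ → ℂ) :
    (toeplitz r fun q => s * a q).det = s ^ r * (toeplitz r a).det := by
  have : (toeplitz r fun q => s * a q) = s • toeplitz r a := by
    ext i j
    simp [toeplitz]
  rw [this, Matrix.det_smul, Fintype.card_fin]

theorem det_toeplitz_of_zero (r : ℕ) {a : ℕ → ℂ} (h : a 0 = 0) :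
    (toeplitz r a).det = a 1 ^ r := by
  rw [Matrix.det_of_isLowerTriangular]
  · simp [toeplitz]
  · intro i j hij
    have hij : (i : ℕ) < j := hij
    simp only [toeplitz, Matrix.of_apply]
    split_ifs
    · rw [show (i : ℕ) + 1 - j = 0 by omega, h]
    · rfl

/-- Put all coordinates equal to 1 except τ_ξ = s. As s → 0 the difference of the two sides tends to
1. -/
theorem exists_eqnB_ne_zero {α ξ p : ℕ} (hp : p < min α ξ) :
    ∃ v : Fin (min α ξ + 1) → ℂ, v 0 ≠ 0 ∧ v (Fin.last _) ≠ 0 ∧ eqnB α ξ p v ≠ 0 := by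
  set w : ℂ → Fin (min α ξ + 1) → ℂ := fun s => Function.update (fun _ => 1) (Fin.last _) s with hw
  have hlast : ∀ s, w s (Fin.last _) = s := fun s => by simp [hw]
  have hne : ∀ i : Fin (min α ξ + 1), (i : ℕ) < min α ξ → ∀ s, w s i = 1 := by
    intro i hi s
    rw [hw]
    exact Function.update_of_ne (fun h => by rw [h] at hi; simp at hi) _ _
  have h0 : ∀ s, w s 0 = 1 := hne 0 (by simpa using Nat.zero_lt_of_lt hp)
  have htau : ∀ i, Continuous fun s => tauOf α ξ (w s) i := by
    intro i
    unfold tauOf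
    split_ifs with h
    · simp only [hne ⟨i, _⟩ h]
      exact continuous_const
    · simp only [hlast]
      exact continuous_id
    · exact continuous_const
  -- The reversed sequence has the single pole λ^α_α = 1/s at q = 0. Multiplying it by s gives a
  -- sequence continuous at s = 0, at the cost of s^(ξ-p) out of the available s^(ξ-p+1).
  set μ : ℂ → ℕ → ℂ := fun s q => if q = 0 then (-1) ^ α else s * sigRev α ξ (w s) q with hμ
  have hμc : ∀ q, Continuous fun s => μ s q := by
    intro q
    simp only [hμ]
    split_ifs with hq
    · exact continuous_const
    · refine continuous_id.mul ?_
      unfold sigRev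
      split_ifs with hqα
      · unfold sig lam
        simp only [if_pos (show α - q < α by omega), h0]
        refine continuous_const.mul (continuous_det_toeplitz _ fun i => ?_)
        exact continuous_const.mul (htau i)
      · exact continuous_const
  have hμs : ∀ s ≠ 0, μ s = fun q => s * sigRev α ξ (w s) q := by
    intro s hs
    funext q
    simp only [hμ]
    split_ifs with hq
    · subst hq
      simp only [sigRev, sig, Nat.zero_le, if_true, Nat.sub_zero, lam_self, h0, hlast]
      field_simp
    · rfl
  obtain ⟨s, hs, hG⟩ := exists_ne_of_continuous
    (G := fun s => 1 - (-1) ^ (α * (ξ - p)) * s * (toeplitz (ξ - p) (μ s)).det)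
    (continuous_const.sub ((continuous_const.mul continuous_id).mul
      (continuous_det_toeplitz _ hμc))) (by simp)
  refine ⟨w s, by rw [h0]; exact one_ne_zero, by rwa [hlast], ?_⟩
  convert hG using 1
  rw [hμs s hs, det_toeplitz_mul, eqnB, h0, hlast, tauOf, dif_pos hp, hne _ hp]
  ring

/-- Take T to agree with 1 - z below degree α, so that the entries of λ below index α are 1, and τ_ξ
= 1/s, so that the last one is s. After multiplication by s^(p+1) the limit s → 0 keeps only the
second determinant. There the reversed sequence starts with 0, so the matrix is triangular with
diagonal entries ±1. -/
theorem exists_eqnA_ne_zero {α ξ p : ℕ} (hα : α ≤ ξ) (hp : p < α) :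
    ∃ v : Fin (min α ξ + 1) → ℂ, v 0 ≠ 0 ∧ v (Fin.last _) ≠ 0 ∧ eqnA α ξ p v ≠ 0 := by
  set w : ℂ → Fin (min α ξ + 1) → ℂ := fun s =>
    Function.update (fun i => PowerSeries.coeff (i : ℕ) (1 - PowerSeries.X)) (Fin.last _) s⁻¹ with hw
  have hlast : ∀ s, w s (Fin.last _) = s⁻¹ := fun s => by simp [hw]
  have hne : ∀ i : Fin (min α ξ + 1), (i : ℕ) < min α ξ → ∀ s,
      w s i = PowerSeries.coeff (i : ℕ) (1 - PowerSeries.X) := by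
    intro i hi s
    rw [hw]
    exact Function.update_of_ne (fun h => by rw [h] at hi; simp at hi) _ _
  have h0 : ∀ s, w s 0 = 1 := fun s => by
    rw [hne 0 (by simp; omega)]
    simp
  have htau : ∀ s, ∀ i < α, tauOf α ξ (w s) i = PowerSeries.coeff i (1 - PowerSeries.X) := by
    intro s i hi
    rw [tauOf, dif_pos (by omega), hne _ (by simp; omega)]
  have hlam : ∀ s, ∀ r < α, lam α ξ (w s) r = 1 := by
    intro s
    have ht0 : tauOf α ξ (w s) 0 = 1 := by rw [tauOf_zero (by omega), h0]
    refine conv_cancel (c := tauOf α ξ (w s)) (y := fun _ => 1) (by rw [ht0]; exact one_ne_zero)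
      fun n hn => ?_
    rw [sum_tauOf_mul_lam (by rw [h0]; exact one_ne_zero) hn, h0]
    have h2 := congrArg (PowerSeries.coeff n) (PowerSeries.mk_one_mul_one_sub_eq_one ℂ)
    rw [mul_comm, PowerSeries.coeff_mul, PowerSeries.coeff_one] at h2
    rw [← h2]
    refine Finset.sum_congr rfl fun x hx => ?_
    rw [HasAntidiagonal.mem_antidiagonal] at hx
    rw [htau s _ (by omega), PowerSeries.coeff_mk]
    rfl
  set a : ℂ → ℕ → ℂ := fun s q => (-1) ^ q * (if q < α then 1 else if q = α then s else 0) with ha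
  have hac : ∀ q, Continuous fun s => a s q := by
    intro q
    simp only [ha]
    refine continuous_const.mul ?_
    split_ifs
    exacts [continuous_const, continuous_id, continuous_const]
  have hsig : ∀ s, sig α ξ (w s) = a s := by
    intro s
    funext q
    simp only [sig, ha]
    congr 1
    split_ifs with c1 c2
    · exact hlam s q c1
    · rw [c2, lam_self, h0, hlast]
      simp
    · exact lam_gt (by omega)
  have hrev : ∀ s, sigRev α ξ (w s) = fun q => if q ≤ α then a s (α - q) else 0 := by
    intro s
    funext q
    rw [sigRev, hsig]
  have hbc : ∀ q, Continuous fun s => if q ≤ α then a s (α - q) else 0 := by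
    intro q
    split_ifs
    exacts [hac _, continuous_const]
  have hb0 : (toeplitz p fun q => if q ≤ α then a 0 (α - q) else 0).det ≠ 0 := by
    rw [det_toeplitz_of_zero _ (by simp [ha])]
    refine pow_ne_zero _ ?_
    rw [if_pos (by omega)]
    simp only [ha]
    rw [if_pos (by omega), mul_one]
    exact pow_ne_zero _ (by simp)
  obtain ⟨s, hs, hG⟩ := exists_ne_of_continuous
    (G := fun s => s ^ (p + 1) * (toeplitz (ξ - p) (a s)).det -
      (-1) ^ (α * p) * (toeplitz p fun q => if q ≤ α then a s (α - q) else 0).det)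
    (((continuous_id.pow _).mul (continuous_det_toeplitz _ hac)).sub
      (continuous_const.mul (continuous_det_toeplitz _ hbc))) (by simpa using hb0)
  refine ⟨w s, by rw [h0]; exact one_ne_zero, by rw [hlast]; exact inv_ne_zero hs, fun hA => hG ?_⟩
  rw [eqnA, hsig, hrev, h0, hlast] at hA
  have h3 : s ^ (p + 1) * s⁻¹ ^ (p + 1) = 1 := by rw [← mul_pow, mul_inv_cancel₀ hs, one_pow]
  linear_combination s ^ (p + 1) * hA + (-1) ^ (α * p) *
    (toeplitz p fun q => if q ≤ α then a s (α - q) else 0).det * h3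

theorem exists_eqn_ne_zero {α ξ p : ℕ} (hp : p < min α ξ) :
    ∃ v : Fin (min α ξ + 1) → ℂ, v 0 ≠ 0 ∧ v (Fin.last _) ≠ 0 ∧ eqn α ξ p v ≠ 0 := by
  unfold eqn
  split_ifs with c1 c2
  · exact exists_eqnA_ne_zero (by omega) (by omega)
  · exact exists_eqnB_ne_zero hp
  · exact exists_eqnA_ne_zero (by omega) (by omega)
  · exact exists_eqnB_ne_zero hp

/-- The equations are homogeneous polynomial equations once denominators are cleared. -/
theorem exists_polynomial_eqn (α ξ : ℕ) : ∃ F : Fin (min α ξ) → MvPolynomial (Fin (min α ξ + 1)) ℂ,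
    ∀ p, F p ≠ 0 ∧ (∃ d : ℕ, (F p).IsHomogeneous d) ∧
      ∃ m : ℕ, ∀ v : Fin (min α ξ + 1) → ℂ, v 0 ≠ 0 → v (Fin.last (min α ξ)) ≠ 0 →
        MvPolynomial.eval v (F p) = (v 0 * v (Fin.last (min α ξ))) ^ m * eqn α ξ p v := by
  choose d m n F hF _ hE using fun p : Fin (min α ξ) => exists_isHomLaurent_eqn α ξ p
  refine ⟨F, fun p => ⟨fun h => ?_, ⟨n p, hF p⟩, m p, hE p⟩⟩
  obtain ⟨v, h0, h1, hne⟩ := exists_eqn_ne_zero p.2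
  have := hE p v h0 h1
  rw [h, map_zero] at this
  exact mul_ne_zero (pow_ne_zero _ (mul_ne_zero h0 h1)) hne this.symm

/-! ### The Jacobi identity as an identity between products of shifts of f. -/

/-- The coefficient of `f (u_a, …)` in `{u_i, u_j}` if `b k s` is the coefficient of
`f (u_s, …)` in `g_k`. -/
def brCoeff (b : ℤ → ℤ → ℂ) (i j a : ℤ) : ℂ := b (j - i) (a - i) - b (i - j) (a - j)

/-- The coefficients `b k s` vanish unless `1 ≤ k ≤ M` and `0 ≤ s ≤ k - ξ`. -/
def CoeffSupport (M ξ : ℕ) (b : ℤ → ℤ → ℂ) : Prop :=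
  ∀ k s, b k s ≠ 0 → 1 ≤ k ∧ k ≤ M ∧ 0 ≤ s ∧ s + ξ ≤ k

/-- On sequences with values in `D`, `g_k = ∑_s b_{k,s} f (u_s, …, u_{s+ξ})`. -/
def HasCoeffs (D : Set ℂ) {ξ : ℕ} (f : (Fin (ξ + 1) → ℂ) → ℂ)
    (g : (k : ℕ) → (Fin (k + 1) → ℂ) → ℂ) (b : ℤ → ℤ → ℂ) : Prop :=
  ∀ k : ℕ, ∀ u : ℤ → ℂ, (∀ i, u i ∈ D) →
    g k (window u 0 k) = ∑ s ∈ range (k + 1), b k s * f (window u s ξ)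

/-- The coefficient of `f_b` in `{f_a, u_l} / f_a` for an exponential `f`. -/
def iterCoeff (ξ : ℕ) (τ : ℕ → ℂ) (b : ℤ → ℤ → ℂ) (a l c : ℤ) : ℂ :=
  ∑ i ∈ range (ξ + 1), τ i * brCoeff b (a + i) l c

/-- The coefficient of `f_a f_c` in the Jacobi identity for `u_n, u_m, u_l`. -/
def jacobiCoeff (ξ : ℕ) (τ : ℕ → ℂ) (b : ℤ → ℤ → ℂ) (n m l a c : ℤ) : ℂ :=
  brCoeff b n m a * iterCoeff ξ τ b a l c + brCoeff b m l a * iterCoeff ξ τ b a n c +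
    brCoeff b l n a * iterCoeff ξ τ b a m c

theorem brCoeff_eq_zero {M ξ : ℕ} {b : ℤ → ℤ → ℂ} (hb : CoeffSupport M ξ b) {i j a : ℤ}
    (h : a < min i j ∨ max i j < a + ξ) : brCoeff b i j a = 0 := by
  unfold brCoeff
  have h1 : b (j - i) (a - i) = 0 := by
    by_contra hne
    have := hb _ _ hne
    omega
  have h2 : b (i - j) (a - j) = 0 := by
    by_contra hne
    have := hb _ _ hne
    omega
  rw [h1, h2, sub_zero]

theorem window_shift (u : ℤ → ℂ) (n a : ℤ) (k : ℕ) :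
    window (fun i => u (n + i)) a k = window u (n + a) k := by
  funext i
  simp [window, add_assoc]

theorem window_mem {D : Set ℂ} {u : ℤ → ℂ} (hu : ∀ i, u i ∈ D) (a : ℤ) (k : ℕ) :
    ∀ i, window u a k i ∈ D := fun _ => hu _

theorem update_mem {D : Set ℂ} {u : ℤ → ℂ} (hu : ∀ i, u i ∈ D) (j : ℤ) {t : ℂ} (ht : t ∈ D) :
    ∀ i, Function.update u j t i ∈ D := by
  intro i
  rw [Function.update_apply]
  split_ifs
  exacts [ht, hu i]

theorem window_update_add (u : ℤ → ℂ) (a : ℤ) {k : ℕ} (i : Fin (k + 1)) (t : ℂ) :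
    window (Function.update u (a + ((i : ℕ) : ℤ)) t) a k = Function.update (window u a k) i t := by
  funext i'
  by_cases h : i' = i
  · subst h; simp [window]
  · rw [Function.update_of_ne h]
    exact Function.update_of_ne (fun hh => h (Fin.ext (by omega))) _ _

theorem window_update_of_notMem (u : ℤ → ℂ) {a j : ℤ} {k : ℕ} (h : j < a ∨ a + k < j) (t : ℂ) :
    window (Function.update u j t) a k = window u a k := by
  funext i
  exact Function.update_of_ne (by have := i.2; omega) _ _

theorem pderiv_window_add {ξ : ℕ} (f : (Fin (ξ + 1) → ℂ) → ℂ) (u : ℤ → ℂ) (a : ℤ)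
    (i : Fin (ξ + 1)) : pderiv (a + ((i : ℕ) : ℤ)) (fun u => f (window u a ξ)) u =
      pderiv i f (window u a ξ) := by
  unfold pderiv
  simp only [window_update_add]
  rfl

theorem pderiv_window_of_notMem {ξ : ℕ} (f : (Fin (ξ + 1) → ℂ) → ℂ) (u : ℤ → ℂ) {a j : ℤ}
    (h : j < a ∨ a + ξ < j) : pderiv j (fun u => f (window u a ξ)) u = 0 := by
  unfold pderiv
  simp [window_update_of_notMem u h]

section
variable {D : Set ℂ} {ξ : ℕ} {f : (Fin (ξ + 1) → ℂ) → ℂ}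

theorem differentiableAt_window (hf : AnalyticOnNhd ℂ f {x | ∀ i, x i ∈ D}) {u : ℤ → ℂ}
    (hu : ∀ i, u i ∈ D) (a j : ℤ) :
    DifferentiableAt ℂ (fun t => f (window (Function.update u j t) a ξ)) (u j) := by
  have h1 : DifferentiableAt ℂ f (window (Function.update u j (u j)) a ξ) := by
    rw [Function.update_eq_self]
    exact (hf _ (window_mem hu a ξ)).differentiableAt
  refine DifferentiableAt.comp (g := f) (u j) h1 ?_
  refine differentiableAt_pi.2 fun i => ?_
  simp only [window, Function.update_apply]
  split_ifs
  · exact differentiableAt_id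
  · exact differentiableAt_const _

theorem finsum_pderiv_window_mul (u : ℤ → ℂ) (a : ℤ) (c : ℤ → ℂ) :
    (Function.support fun j => pderiv j (fun u => f (window u a ξ)) u * c j).Finite ∧
    ∑ᶠ j, pderiv j (fun u => f (window u a ξ)) u * c j =
      ∑ i : Fin (ξ + 1), pderiv i f (window u a ξ) * c (a + ((i : ℕ) : ℤ)) := by
  have hsub : (Function.support fun j => pderiv j (fun u => f (window u a ξ)) u * c j) ⊆
      (Finset.image (fun i : Fin (ξ + 1) => a + ((i : ℕ) : ℤ)) Finset.univ : Finset ℤ) := by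
    intro j hj
    by_contra hc
    refine hj ?_
    show _ * _ = (0 : ℂ)
    rw [pderiv_window_of_notMem, zero_mul]
    by_contra hcon
    push Not at hcon
    refine hc ?_
    simp only [Finset.coe_image, Set.mem_image]
    exact ⟨⟨(j - a).toNat, by omega⟩, by simp, by simp; omega⟩
  refine ⟨(Finset.finite_toSet _).subset hsub, ?_⟩
  rw [finsum_eq_sum_of_support_subset _ hsub, Finset.sum_image]
  · simp only [pderiv_window_add]
  · intro i _ i' _ h
    exact Fin.ext (by simpa using h)

variable {M : ℕ} {g : (k : ℕ) → (Fin (k + 1) → ℂ) → ℂ} {b : ℤ → ℤ → ℂ}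

theorem HasCoeffs.window_eq (hg : HasCoeffs D f g b) (hb : CoeffSupport M ξ b) {u : ℤ → ℂ}
    (hu : ∀ i, u i ∈ D) (n : ℤ) (k : ℕ) {S : Finset ℤ} (hS : Icc n (n + k) ⊆ S) :
    g k (window u n k) = ∑ a ∈ S, b k (a - n) * f (window u a ξ) := by
  have h := hg k (fun i => u (n + i)) fun i => hu _
  simp only [window_shift, add_zero] at h
  rw [h, ← Finset.sum_subset hS]
  · refine Finset.sum_nbij' (fun s : ℕ => n + s) (fun a => (a - n).toNat) ?_ ?_ ?_ ?_ ?_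
    · intro s hs
      simp at hs ⊢
      omega
    · intro a ha
      simp at ha ⊢
      omega
    · intro s _
      simp
    · intro a ha
      simp at ha ⊢
      omega
    · intro s _
      simp
  · intro a _ ha
    have : b k (a - n) = 0 := by
      by_contra hne
      have := hb _ _ hne
      simp at ha
      omega
    rw [this, zero_mul]

theorem HasCoeffs.coordBracket_eq (hg : HasCoeffs D f g b) (hb : CoeffSupport M ξ b) {u : ℤ → ℂ}
    (hu : ∀ i, u i ∈ D) {n m : ℤ} {S : Finset ℤ} (hS : Icc (min n m) (max n m) ⊆ S) :
    coordBracket g n m u = ∑ a ∈ S, brCoeff b n m a * f (window u a ξ) := by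
  unfold coordBracket brCoeff
  split_ifs with h
  · rw [min_eq_left h, max_eq_right h] at hS
    rw [hg.window_eq hb hu n _ (S := S) (by convert hS using 2; omega)]
    refine Finset.sum_congr rfl fun a _ => ?_
    have : b (n - m) (a - m) = 0 := by
      by_contra hne
      have := hb _ _ hne
      omega
    rw [this, sub_zero, Int.toNat_of_nonneg (by omega)]
  · rw [min_eq_right (by omega), max_eq_left (by omega)] at hS
    rw [hg.window_eq hb hu m _ (S := S) (by convert hS using 2; omega), ← Finset.sum_neg_distrib]
    refine Finset.sum_congr rfl fun a _ => ?_
    have : b (m - n) (a - n) = 0 := by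
      by_contra hne
      have := hb _ _ hne
      omega
    rw [this, zero_sub, Int.toNat_of_nonneg (by omega), neg_mul]

theorem HasCoeffs.pderiv_coordBracket (hD : IsOpen D) (hf : AnalyticOnNhd ℂ f {x | ∀ i, x i ∈ D})
    (hg : HasCoeffs D f g b) (hb : CoeffSupport M ξ b) {u : ℤ → ℂ}
    (hu : ∀ i, u i ∈ D) {n m : ℤ} {S : Finset ℤ} (hS : Icc (min n m) (max n m) ⊆ S) (j : ℤ) :
    pderiv j (coordBracket g n m) u =
      ∑ a ∈ S, brCoeff b n m a * pderiv j (fun u => f (window u a ξ)) u := by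
  unfold pderiv
  have h1 : (fun t => coordBracket g n m (Function.update u j t)) =ᶠ[nhds (u j)]
      fun t => ∑ a ∈ S, brCoeff b n m a * f (window (Function.update u j t) a ξ) := by
    filter_upwards [hD.mem_nhds (hu j)] with t ht
    exact hg.coordBracket_eq hb (update_mem hu j ht) hS
  rw [h1.deriv_eq, deriv_fun_sum]
  · refine Finset.sum_congr rfl fun a _ => ?_
    rw [deriv_const_mul _ (differentiableAt_window hf hu a j)]
  · exact fun a _ => (differentiableAt_window hf hu a j).const_mul _

/-- This form assumes nothing about f beyond analyticity; it serves to find the exponents before f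
is known to be an exponential. -/
theorem HasCoeffs.iteratedBracket_eq (hD : IsOpen D)
    (hf : AnalyticOnNhd ℂ f {x | ∀ i, x i ∈ D}) (hg : HasCoeffs D f g b)
    (hb : CoeffSupport M ξ b) {u : ℤ → ℂ} (hu : ∀ i, u i ∈ D) {n m : ℤ} (l : ℤ) {S : Finset ℤ}
    (hS : Icc (min n m) (max n m) ⊆ S) :
    iteratedBracket g n m l u = ∑ a ∈ S, brCoeff b n m a *
      ∑ i : Fin (ξ + 1), pderiv i f (window u a ξ) * coordBracket g (a + ((i : ℕ) : ℤ)) l u := by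
  unfold iteratedBracket
  simp only [hg.pderiv_coordBracket hD hf hb hu hS, Finset.sum_mul, mul_assoc]
  rw [finsum_sum_comm]
  · refine Finset.sum_congr rfl fun a _ => ?_
    have h := finsum_pderiv_window_mul (f := f) u a fun j => coordBracket g j l u
    rw [← h.2, mul_finsum]
  · intro a _
    refine (finsum_pderiv_window_mul (f := f) u a fun j => coordBracket g j l u).1.subset ?_
    exact fun j hj hj0 => hj (mul_eq_zero_of_right _ hj0)

/-- The Jacobi expression of a bracket with exponential coefficients as a quadratic form. -/
theorem HasCoeffs.jacobi_eq (hD : IsOpen D)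
    (hf : AnalyticOnNhd ℂ f {x | ∀ i, x i ∈ D}) (hg : HasCoeffs D f g b)
    (hb : CoeffSupport M ξ b) {τ : ℕ → ℂ}
    (hτ : ∀ x : Fin (ξ + 1) → ℂ, (∀ i, x i ∈ D) → ∀ i, pderiv i f x = τ i * f x)
    {u : ℤ → ℂ} (hu : ∀ i, u i ∈ D) {n m l p q : ℤ} (hn : n ∈ Icc p q) (hm : m ∈ Icc p q)
    (hl : l ∈ Icc p q) :
    iteratedBracket g n m l u + iteratedBracket g m l n u + iteratedBracket g l n m u =
      ∑ a ∈ Icc p q, ∑ c ∈ Icc p q,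
        jacobiCoeff ξ τ b n m l a c * (f (window u a ξ) * f (window u c ξ)) := by
  have key : ∀ n m l : ℤ, n ∈ Icc p q → m ∈ Icc p q → l ∈ Icc p q →
      iteratedBracket g n m l u = ∑ a ∈ Icc p q, ∑ c ∈ Icc p q,
        brCoeff b n m a * iterCoeff ξ τ b a l c * (f (window u a ξ) * f (window u c ξ)) := by
    intro n m l hn hm hl
    rw [Finset.mem_Icc] at hn hm hl
    rw [hg.iteratedBracket_eq hD hf hb hu l (S := Icc p q)
      (Finset.Icc_subset_Icc (by omega) (by omega))]
    refine Finset.sum_congr rfl fun a _ => ?_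
    by_cases hC : brCoeff b n m a = 0
    · simp [hC]
    have ha : min n m ≤ a ∧ a + ξ ≤ max n m := by
      by_contra hcon
      exact hC (brCoeff_eq_zero hb (by omega))
    simp only [mul_assoc]
    rw [← Finset.mul_sum]
    congr 1
    simp only [hτ _ (window_mem hu a ξ), iterCoeff, Finset.sum_mul]
    rw [Finset.sum_comm, ← Fin.sum_univ_eq_sum_range
      (fun i => ∑ c ∈ Icc p q, τ i * brCoeff b (a + i) l c * (f (window u a ξ) * f (window u c ξ)))]
    refine Finset.sum_congr rfl fun i _ => ?_
    have hi := i.2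
    rw [hg.coordBracket_eq hb hu (S := Icc p q)
      (Finset.Icc_subset_Icc (by omega) (by omega)), Finset.mul_sum]
    exact Finset.sum_congr rfl fun c _ => by ring
  rw [key n m l hn hm hl, key m l n hm hl hn, key l n m hl hn hm]
  simp only [jacobiCoeff, add_mul, Finset.sum_add_distrib]

end

/-! ### The bracket attached to a factorization. -/

/-- Extension of a sequence by zero to negative indices. -/
def extZ (ℓ : ℕ → ℂ) (m : ℤ) : ℂ := if 0 ≤ m then ℓ m.toNat else 0

theorem extZ_natCast (ℓ : ℕ → ℂ) (m : ℕ) : extZ ℓ m = ℓ m := by simp [extZ]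

theorem sum_antidiagonal_eq_sum_extZ {ξ : ℕ} {τ ℓ : ℕ → ℂ} (hτ : ∀ i, ξ < i → τ i = 0) (n : ℕ) :
    ∑ p ∈ antidiagonal n, τ p.1 * ℓ p.2 = ∑ i ∈ range (ξ + 1), τ i * extZ ℓ (n - i) := by
  have h2 : ∑ p ∈ antidiagonal n, τ p.1 * ℓ p.2 = ∑ i ∈ range (n + 1), τ i * extZ ℓ (n - i) := by
    rw [Finset.Nat.sum_antidiagonal_eq_sum_range_succ (fun i j => τ i * ℓ j)]
    refine Finset.sum_congr rfl fun i hi => ?_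
    rw [Finset.mem_range] at hi
    rw [← extZ_natCast ℓ, Nat.cast_sub (by omega)]
  have h3 : ∀ k ∈ range (n + ξ + 1), ¬ (k ≤ n ∧ k ≤ ξ) → τ k * extZ ℓ (n - k) = 0 := by
    intro k _ hk
    rcases lt_or_ge ξ k with hk' | hk'
    · rw [hτ k hk', zero_mul]
    · rw [extZ, if_neg (by omega), mul_zero]
  rw [h2, Finset.sum_subset (Finset.range_mono (show n + 1 ≤ n + ξ + 1 by omega)),
    Finset.sum_subset (Finset.range_mono (show ξ + 1 ≤ n + ξ + 1 by omega))]
  · intro k hk hk'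
    rw [Finset.mem_range] at hk'
    exact h3 k hk (by omega)
  · intro k hk hk'
    rw [Finset.mem_range] at hk'
    exact h3 k hk (by omega)

/-- `c exp (∑ τ_i x_i)`. -/
noncomputable def expF (ξ : ℕ) (τ : ℕ → ℂ) (c : ℂ) (x : Fin (ξ + 1) → ℂ) : ℂ :=
  c * Complex.exp (∑ i : Fin (ξ + 1), τ i * x i)

theorem expF_window (ξ : ℕ) (τ : ℕ → ℂ) (c : ℂ) (u : ℤ → ℂ) (a : ℤ) :
    expF ξ τ c (window u a ξ) =
      c * Complex.exp (∑ i ∈ range (ξ + 1), τ i * u (a + (i : ℤ))) := by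
  rw [expF, ← Fin.sum_univ_eq_sum_range (fun i => τ i * u (a + (i : ℤ)))]
  rfl

theorem analyticAt_expF (ξ : ℕ) (τ : ℕ → ℂ) (c : ℂ) (x : Fin (ξ + 1) → ℂ) :
    AnalyticAt ℂ (expF ξ τ c) x := by
  unfold expF
  refine analyticAt_const.mul (AnalyticAt.cexp ?_)
  refine Finset.analyticAt_fun_sum _ fun i _ => analyticAt_const.mul ?_
  exact (ContinuousLinearMap.proj (R := ℂ) (φ := fun _ : Fin (ξ + 1) => ℂ) i).analyticAt x

theorem pderiv_expF (ξ : ℕ) (τ : ℕ → ℂ) (c : ℂ) (x : Fin (ξ + 1) → ℂ) (i : Fin (ξ + 1)) :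
    pderiv i (expF ξ τ c) x = τ i * expF ξ τ c x := by
  unfold pderiv
  have h : ∀ t, expF ξ τ c (Function.update x i t) =
      expF ξ τ c x * Complex.exp (τ i * (t - x i)) := by
    intro t
    unfold expF
    rw [mul_assoc, ← Complex.exp_add]
    congr 2
    rw [← Finset.add_sum_erase _ _ (Finset.mem_univ i),
      ← Finset.add_sum_erase _ (fun i : Fin (ξ + 1) => τ i * x i) (Finset.mem_univ i),
      Finset.sum_congr rfl (g := fun i : Fin (ξ + 1) => τ i * x i)]
    · simp only [Function.update_self]
      ring
    · intro j hj
      rw [Function.update_of_ne (Finset.ne_of_mem_erase hj)]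
  simp only [h]
  have hd : HasDerivAt (fun t => expF ξ τ c x * Complex.exp (τ i * (t - x i)))
      (expF ξ τ c x * (Complex.exp (τ i * (x i - x i)) * (τ i * 1))) (x i) :=
    ((((hasDerivAt_id (x i)).sub_const (x i)).const_mul (τ i)).cexp).const_mul _
  rw [hd.deriv]
  simp
  ring

/-- The coefficients `λ_0⁻¹ ℓ_s ℓ_{s + α + ξ - k}`. -/
noncomputable def stdCoeff (α ξ : ℕ) (ℓ : ℕ → ℂ) (k s : ℤ) : ℂ :=
  if 1 ≤ k then (ℓ α)⁻¹ * (extZ ℓ s * extZ ℓ (s + (α + ξ) - k)) else 0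

namespace Factorization
variable {α ξ : ℕ} {τ ℓ : ℕ → ℂ}

theorem extZ_ne (h : Factorization α ξ τ ℓ) {m : ℤ} (hm : extZ ℓ m ≠ 0) : 0 ≤ m ∧ m ≤ α := by
  unfold extZ at hm
  split_ifs at hm with h0
  · refine ⟨h0, ?_⟩
    by_contra hc
    exact hm (h.ell_gt _ (by omega))
  · exact absurd rfl hm

theorem conv_int (h : Factorization α ξ τ ℓ) (m : ℤ) :
    ∑ i ∈ range (ξ + 1), τ i * extZ ℓ (m - i) = if m = 0 ∨ m = α + ξ then τ 0 else 0 := by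
  rcases lt_or_ge m 0 with hm | hm
  · rw [if_neg (by omega)]
    refine Finset.sum_eq_zero fun i _ => ?_
    rw [extZ, if_neg (by omega), mul_zero]
  · obtain ⟨n, rfl⟩ := Int.eq_ofNat_of_zero_le hm
    rw [← sum_antidiagonal_eq_sum_extZ h.tau_gt, h.conv]
    congr 1
    apply propext
    constructor <;> intro hh <;> omega

theorem coeffSupport (h : Factorization α ξ τ ℓ) :
    CoeffSupport (2 * α + ξ) ξ (stdCoeff α ξ ℓ) := by
  intro k s hk
  unfold stdCoeff at hk
  split_ifs at hk with h1
  · have h2 := h.extZ_ne (left_ne_zero_of_mul (right_ne_zero_of_mul hk))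
    have h3 := h.extZ_ne (right_ne_zero_of_mul (right_ne_zero_of_mul hk))
    push_cast
    omega
  · exact absurd rfl hk

/-- One antisymmetric formula covers both orders of i and j, because for either order the unwanted
product vanishes: its indices would have to lie in [0, α], which is impossible. -/
theorem brCoeff_std (h : Factorization α ξ τ ℓ) (i j a : ℤ) :
    brCoeff (stdCoeff α ξ ℓ) i j a = (ℓ α)⁻¹ * (extZ ℓ (a - i) * extZ ℓ (a + (α + ξ) - j) -
      extZ ℓ (a - j) * extZ ℓ (a + (α + ξ) - i)) := by
  have key : ∀ i j, i < j → extZ ℓ (a - j) * extZ ℓ (a + (α + ξ) - i) = 0 := by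
    intro i j hij
    by_contra hne
    have h2 := h.extZ_ne (left_ne_zero_of_mul hne)
    have h3 := h.extZ_ne (right_ne_zero_of_mul hne)
    omega
  have e : ∀ i j : ℤ, a - i + (α + ξ) - (j - i) = a + (α + ξ) - j := fun i j => by ring
  unfold brCoeff stdCoeff
  rw [e, e]
  rcases lt_trichotomy i j with hij | rfl | hij
  · rw [if_pos (by omega), if_neg (by omega), key i j hij]
    ring
  · simp
  · rw [if_neg (by omega), if_pos (by omega), key j i hij]
    ring

/-- Summing against τ turns each factor that depends on i into a coefficient of T L, so only c - a ∈
{-N, 0, N} survives. -/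
theorem iterCoeff_std (h : Factorization α ξ τ ℓ) (a l c : ℤ) :
    iterCoeff ξ τ (stdCoeff α ξ ℓ) a l c = (ℓ α)⁻¹ *
      ((if c - a = 0 ∨ c - a = α + ξ then τ 0 else 0) * extZ ℓ (c + (α + ξ) - l) -
      extZ ℓ (c - l) * (if c + (α + ξ) - a = 0 ∨ c + (α + ξ) - a = α + ξ then τ 0 else 0)) := by
  unfold iterCoeff
  simp only [h.brCoeff_std, ← h.conv_int, Finset.sum_mul, Finset.mul_sum,
    ← Finset.sum_sub_distrib]
  refine Finset.sum_congr rfl fun i _ => ?_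
  rw [show c - (a + i) = c - a - i by ring, show c + (α + ξ) - (a + i) = c + (α + ξ) - a - i by ring]
  ring

/-- Off the diagonals c - a ∈ {-N, 0, N} there is nothing to check. On c = a the cyclic sum
vanishes, and the contributions of c = a + N and c = a - N cancel each other. -/
theorem jacobiCoeff_std (h : Factorization α ξ τ ℓ) (hα : 1 ≤ α) (n m l a c : ℤ) :
    jacobiCoeff ξ τ (stdCoeff α ξ ℓ) n m l a c + jacobiCoeff ξ τ (stdCoeff α ξ ℓ) n m l c a = 0 := by
  have key : ∀ a : ℤ, jacobiCoeff ξ τ (stdCoeff α ξ ℓ) n m l a (a + (α + ξ)) +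
      jacobiCoeff ξ τ (stdCoeff α ξ ℓ) n m l (a + (α + ξ)) a = 0 := by
    intro a
    simp only [jacobiCoeff, h.brCoeff_std, h.iterCoeff_std]
    rw [if_pos (by omega), if_neg (by omega), if_neg (by omega), if_pos (by omega)]
    ring
  by_cases h1 : c = a
  · subst h1
    simp only [jacobiCoeff, h.brCoeff_std, h.iterCoeff_std]
    rw [if_pos (by omega), if_pos (by omega)]
    ring
  by_cases h2 : c = a + (α + ξ)
  · rw [h2]; exact key a
  by_cases h3 : a = c + (α + ξ)
  · rw [h3, add_comm]; exact key c
  simp only [jacobiCoeff, h.iterCoeff_std]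
  rw [if_neg (by omega), if_neg (by omega), if_neg (by omega), if_neg (by omega)]
  ring

end Factorization

/-- The bracket coefficients on `ℂ` with parameters `τ`, `ℓ` and `c`. -/
noncomputable def stdG (α ξ : ℕ) (τ ℓ : ℕ → ℂ) (c : ℂ) (k : ℕ) (x : Fin (k + 1) → ℂ) : ℂ :=
  ∑ s ∈ range (k + 1), stdCoeff α ξ ℓ k s *
    expF ξ τ c (fun i => if h : s + (i : ℕ) < k + 1 then x ⟨s + i, h⟩ else 0)

section
variable {α ξ : ℕ} {τ ℓ : ℕ → ℂ}

theorem hasCoeffs_stdG (h : Factorization α ξ τ ℓ) (c : ℂ) :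
    HasCoeffs Set.univ (expF ξ τ c) (stdG α ξ τ ℓ c) (stdCoeff α ξ ℓ) := by
  intro k u _
  refine Finset.sum_congr rfl fun s _ => ?_
  -- The default value 0 for variables outside the window is met only when the coefficient vanishes.
  by_cases hs : stdCoeff α ξ ℓ k s = 0
  · simp [hs]
  have := h.coeffSupport _ _ hs
  congr 2
  funext i
  have hi := i.2
  rw [dif_pos (by omega)]
  simp [window]

theorem analyticAt_stdG (c : ℂ) (k : ℕ) (x : Fin (k + 1) → ℂ) :
    AnalyticAt ℂ (stdG α ξ τ ℓ c k) x := by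
  unfold stdG
  refine Finset.analyticAt_fun_sum _ fun s _ => analyticAt_const.mul ?_
  refine AnalyticAt.comp (g := expF ξ τ c) (analyticAt_expF ξ τ c _) ?_
  refine AnalyticAt.pi fun i => ?_
  split_ifs with hi
  · exact (ContinuousLinearMap.proj (R := ℂ) (φ := fun _ : Fin (k + 1) => ℂ) ⟨s + i, hi⟩).analyticAt x
  · exact analyticAt_const

theorem sum_sum_eq_zero_of_antisymm {ι : Type*} (S : Finset ι) {X : ι → ι → ℂ} {y : ι → ℂ}
    (h : ∀ a c, X a c + X c a = 0) : ∑ a ∈ S, ∑ c ∈ S, X a c * (y a * y c) = 0 := by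
  have h1 : ∑ a ∈ S, ∑ c ∈ S, X a c * (y a * y c) + ∑ a ∈ S, ∑ c ∈ S, X a c * (y a * y c) = 0 := by
    conv_lhs => rw [Finset.sum_comm (f := fun a c => X a c * (y a * y c)) (s := S) (t := S)]
    nth_rewrite 2 [Finset.sum_comm]
    rw [← Finset.sum_add_distrib]
    refine Finset.sum_eq_zero fun a _ => ?_
    rw [← Finset.sum_add_distrib]
    refine Finset.sum_eq_zero fun c _ => ?_
    linear_combination y a * y c * h a c
  linear_combination h1 / 2

/-- The Poisson bracket on `ℂ` with parameters `τ`, `ℓ` and `c`. -/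
noncomputable def stdBracket (hα : 1 ≤ α) (h : Factorization α ξ τ ℓ) (c : ℂ) :
    Bracket (2 * α + ξ) where
  dom := Set.univ
  dom_open := isOpen_univ
  dom_connected := isConnected_univ
  g := stdG α ξ τ ℓ c
  analytic k x _ := analyticAt_stdG c k x
  g_zero x _ := by simp [stdG, stdCoeff]
  g_gt k hk x _ := by
    refine Finset.sum_eq_zero fun s _ => ?_
    by_cases hs : stdCoeff α ξ ℓ k s = 0
    · rw [hs, zero_mul]
    · have := h.coeffSupport _ _ hs
      omega
  jacobi n m l u hu := by
    rw [(hasCoeffs_stdG h c).jacobi_eq isOpen_univ (fun x _ => analyticAt_expF ξ τ c x)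
      h.coeffSupport (fun x _ i => pderiv_expF ξ τ c x i) hu (p := min n (min m l))
      (q := max n (max m l)) (by simp) (by simp) (by simp)]
    exact sum_sum_eq_zero_of_antisymm _ fun a c => h.jacobiCoeff_std hα n m l a c

theorem stdCoeff_top (h : Factorization α ξ τ ℓ) (hα : 1 ≤ α) (s : ℤ) :
    stdCoeff α ξ ℓ (2 * α + ξ : ℕ) s = if s = α then 1 else 0 := by
  split_ifs with hs
  · subst hs
    have hne : ℓ α ≠ 0 := by
      rw [h.ell_self]; exact mul_ne_zero h.zero_ne (inv_ne_zero h.last_ne)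
    rw [stdCoeff, if_pos (by omega), extZ_natCast,
      show ((α : ℤ) + (α + ξ) - (2 * α + ξ : ℕ)) = ((0 : ℕ) : ℤ) by push_cast; ring, extZ_natCast,
      h.ell_zero, mul_one, inv_mul_cancel₀ hne]
  · rw [stdCoeff, if_pos (by omega)]
    by_contra hk
    have h2 := h.extZ_ne (left_ne_zero_of_mul (right_ne_zero_of_mul hk))
    have h3 := h.extZ_ne (right_ne_zero_of_mul (right_ne_zero_of_mul hk))
    omega

theorem hasCoeffs_top {D : Set ℂ} {f : (Fin (ξ + 1) → ℂ) → ℂ}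
    {g : (k : ℕ) → (Fin (k + 1) → ℂ) → ℂ} {b : ℤ → ℤ → ℂ} (hg : HasCoeffs D f g b)
    (hb : ∀ s, b (2 * α + ξ : ℕ) s = if s = α then 1 else 0) {u : ℤ → ℂ} (hu : ∀ i, u i ∈ D) :
    g (2 * α + ξ) (window u 0 (2 * α + ξ)) = f (window u α ξ) := by
  rw [hg _ u hu, Finset.sum_eq_single_of_mem α (by simp; omega)]
  · rw [hb, if_pos rfl, one_mul]
  · intro s _ hs
    rw [hb, if_neg (by omega), zero_mul]

theorem isAlphaXi_stdBracket (hα : 1 ≤ α) (h : Factorization α ξ τ ℓ) {c : ℂ} (hc : c ≠ 0) :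
    IsAlphaXi α ξ (stdBracket hα h c) := by
  have hg := hasCoeffs_stdG h c
  refine ⟨expF ξ τ c, fun x _ => analyticAt_expF ξ τ c x, ⟨0, fun _ => trivial, ?_⟩,
    fun u hu => hasCoeffs_top hg (stdCoeff_top h hα) hu, fun k hk _ => ?_⟩
  · rw [pderiv_expF, pderiv_expF]
    simp [expF, hc, h.zero_ne, h.last_ne]
  · refine ⟨fun s => stdCoeff α ξ ℓ k s, fun u hu => ?_⟩
    show stdG α ξ τ ℓ c k _ = _
    rw [hg k u hu]
    symm
    refine Finset.sum_subset (Finset.range_mono (by omega)) fun s _ hs => ?_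
    rw [Finset.mem_range] at hs
    by_cases hs0 : stdCoeff α ξ ℓ k s = 0
    · simp only [hs0, zero_mul]
    · have := h.coeffSupport _ _ hs0
      omega

/-- The sum over `s` written as a double sum over `s, r` with `s - r = k - α - ξ`. -/
theorem sum_stdCoeff_eq (h : Factorization α ξ τ ℓ) {k : ℕ} (hk : 1 ≤ k) (y : ℕ → ℂ) :
    ∑ s ∈ range (k + 1), stdCoeff α ξ ℓ k s * y s =
      ∑ s ∈ range (α + 1), ∑ r ∈ range (α + 1),
        if α + ξ + s = k + r then ℓ r * (ℓ α)⁻¹ * ℓ s * y s else 0 := by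
  have h1 : ∑ s ∈ range (k + 1), stdCoeff α ξ ℓ k s * y s =
      ∑ s ∈ range (k + α + 1), stdCoeff α ξ ℓ k s * y s := by
    refine Finset.sum_subset (Finset.range_mono (by omega)) fun s _ hs => ?_
    rw [Finset.mem_range] at hs
    by_cases hs0 : stdCoeff α ξ ℓ k s = 0
    · rw [hs0, zero_mul]
    · have := h.coeffSupport _ _ hs0
      omega
  rw [h1]
  symm
  rw [← Finset.sum_subset (Finset.range_mono (show α + 1 ≤ k + α + 1 by omega))]
  · refine Finset.sum_congr rfl fun s _ => ?_
    rw [stdCoeff, if_pos (by omega), extZ_natCast]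
    by_cases hr : ∃ r ∈ range (α + 1), α + ξ + s = k + r
    · obtain ⟨r, hr, hrs⟩ := hr
      rw [Finset.sum_eq_single_of_mem r hr, if_pos hrs,
        show ((s : ℤ) + (α + ξ) - k) = (r : ℤ) by omega, extZ_natCast]
      · ring
      · intro r' _ hne
        rw [if_neg (by omega)]
    · push Not at hr
      rw [Finset.sum_eq_zero fun r hr' => if_neg (hr r hr')]
      have : extZ ℓ ((s : ℤ) + (α + ξ) - k) = 0 := by
        by_contra hne
        have := h.extZ_ne hne
        exact hr (s + (α + ξ) - k) (by rw [Finset.mem_range]; omega) (by omega)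
      rw [this]
      ring
  · intro s _ hs
    rw [Finset.mem_range] at hs
    rw [stdCoeff, if_pos (by omega), extZ_natCast, h.ell_gt s (by omega)]
    ring

end

/-! ### The leading coefficient is an exponential. -/

section
variable {D : Set ℂ} {ξ : ℕ} {f h : (Fin (ξ + 1) → ℂ) → ℂ}

theorem setOf_forall_mem_eq_pi (D : Set ℂ) (k : ℕ) :
    {x : Fin k → ℂ | ∀ i, x i ∈ D} = Set.univ.pi fun _ => D := by
  ext x
  simp

theorem isOpen_cube (hD : IsOpen D) (k : ℕ) : IsOpen {x : Fin k → ℂ | ∀ i, x i ∈ D} := by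
  rw [setOf_forall_mem_eq_pi]
  exact isOpen_set_pi Set.finite_univ fun _ _ => hD

theorem isPreconnected_cube (hD : IsPreconnected D) (k : ℕ) :
    IsPreconnected {x : Fin k → ℂ | ∀ i, x i ∈ D} := by
  rw [setOf_forall_mem_eq_pi]
  exact isPreconnected_univ_pi fun _ => hD

theorem update_mem_cube {k : ℕ} {x : Fin k → ℂ} (hx : ∀ i, x i ∈ D) (j : Fin k) {t : ℂ}
    (ht : t ∈ D) : ∀ i, Function.update x j t i ∈ D := by
  intro i
  rw [Function.update_apply]
  split_ifs
  exacts [ht, hx i]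

theorem hasDerivAt_update_of_analytic (hf : AnalyticOnNhd ℂ f {x | ∀ i, x i ∈ D})
    {x : Fin (ξ + 1) → ℂ} (hx : ∀ i, x i ∈ D) (i : Fin (ξ + 1)) :
    HasDerivAt (fun t => f (Function.update x i t)) (fderiv ℂ f x (Pi.single i 1)) (x i) := by
  have h1 : HasFDerivAt f (fderiv ℂ f x) (Function.update x i (x i)) := by
    rw [Function.update_eq_self]
    exact (hf x hx).differentiableAt.hasFDerivAt
  exact h1.comp_hasDerivAt (x i) (hasDerivAt_update x i (x i))

theorem pderiv_eq_fderiv (hf : AnalyticOnNhd ℂ f {x | ∀ i, x i ∈ D})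
    {x : Fin (ξ + 1) → ℂ} (hx : ∀ i, x i ∈ D) (i : Fin (ξ + 1)) :
    pderiv i f x = fderiv ℂ f x (Pi.single i 1) :=
  (hasDerivAt_update_of_analytic hf hx i).deriv

theorem continuousOn_pderiv (hf : AnalyticOnNhd ℂ f {x | ∀ i, x i ∈ D}) (i : Fin (ξ + 1)) :
    ContinuousOn (pderiv i f) {x | ∀ i, x i ∈ D} :=
  (hf.fderiv.continuousOn.clm_apply continuousOn_const).congr fun _ hx => pderiv_eq_fderiv hf hx i

/-- A function with `∂_i f = τ f` is exponential in its `i`-th variable. -/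
theorem update_eq_mul_exp (hD : IsOpen D) (hDc : IsPreconnected D)
    (hf : AnalyticOnNhd ℂ f {x | ∀ i, x i ∈ D}) {i : Fin (ξ + 1)} {τ : ℂ}
    (hτ : ∀ x, (∀ i, x i ∈ D) → pderiv i f x = τ * f x) {x : Fin (ξ + 1) → ℂ}
    (hx : ∀ i, x i ∈ D) {t : ℂ} (ht : t ∈ D) :
    f (Function.update x i t) = f x * Complex.exp (τ * (t - x i)) := by
  -- The integrating factor exp(-τ s) makes the product locally constant, hence constant on the
  -- connected set D.
  have hd : ∀ s ∈ D, HasDerivAt (fun s => f (Function.update x i s) * Complex.exp (-τ * s)) 0 s := by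
    intro s hs
    have h1 := hasDerivAt_update_of_analytic hf (update_mem_cube hx i hs) i
    rw [← pderiv_eq_fderiv hf (update_mem_cube hx i hs), hτ _ (update_mem_cube hx i hs)] at h1
    simp only [Function.update_idem, Function.update_self] at h1
    have h2 := h1.mul (((hasDerivAt_id s).const_mul (-τ)).cexp)
    refine h2.congr_deriv ?_
    simp only [id]
    ring
  have h3 := hD.is_const_of_deriv_eq_zero hDc
    (fun s hs => (hd s hs).differentiableAt.differentiableWithinAt)
    (fun s hs => (hd s hs).deriv) ht (hx i)
  simp only [Function.update_eq_self] at h3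
  have h4 : f (Function.update x i t) =
      f (Function.update x i t) * Complex.exp (-τ * t) * Complex.exp (τ * t) := by
    rw [mul_assoc, ← Complex.exp_add]
    simp
  rw [h4, h3, mul_assoc, ← Complex.exp_add]
  congr 2
  ring

theorem exists_exp_ne_one (hD : IsOpen D) {τ x : ℂ} (hτ : τ ≠ 0) (hx : x ∈ D) :
    ∃ t ∈ D, Complex.exp (τ * (t - x)) ≠ 1 := by
  by_contra! hcon
  have h1 : HasDerivAt (fun t => Complex.exp (τ * (t - x)))
      (Complex.exp (τ * (x - x)) * (τ * 1)) x :=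
    (((hasDerivAt_id x).sub_const x).const_mul τ).cexp
  have h2 : HasDerivAt (fun t => Complex.exp (τ * (t - x))) 0 x :=
    (hasDerivAt_const x (1 : ℂ)).congr_of_eventuallyEq
      (by filter_upwards [hD.mem_nhds hx] with t ht using hcon t ht)
  have := h1.unique h2
  simp at this
  exact hτ this

/-- If all partial derivatives of `f` are multiples of `f`, then `f` is an exponential. -/
theorem eq_expF (hD : IsOpen D) (hDc : IsConnected D)
    (hf : AnalyticOnNhd ℂ f {x | ∀ i, x i ∈ D}) {τ : ℕ → ℂ}
    (hτ : ∀ x : Fin (ξ + 1) → ℂ, (∀ i, x i ∈ D) → ∀ i, pderiv i f x = τ i * f x) :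
    ∃ c, ∀ x : Fin (ξ + 1) → ℂ, (∀ i, x i ∈ D) → f x = expF ξ τ c x := by
  obtain ⟨y, hy⟩ := hDc.nonempty
  refine ⟨f (fun _ => y) * Complex.exp (-∑ i : Fin (ξ + 1), τ i * y), fun x hx => ?_⟩
  have key : ∀ s : Finset (Fin (ξ + 1)), f (s.piecewise x fun _ => y) =
      f (fun _ => y) * Complex.exp (∑ i ∈ s, τ i * (x i - y)) := by
    intro s
    induction s using Finset.induction_on with
    | empty => simp
    | insert a s ha ih =>
      have hmem : ∀ i, s.piecewise x (fun _ => y) i ∈ D := by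
        intro i
        by_cases hi : i ∈ s <;> simp [hi, hx, hy]
      rw [Finset.piecewise_insert, update_eq_mul_exp hD hDc.isPreconnected hf
        (fun x hx => hτ x hx a) hmem (hx a), ih, mul_assoc, ← Complex.exp_add,
        Finset.piecewise_eq_of_notMem _ _ _ ha, Finset.sum_insert ha,
        add_comm (τ a * _)]
  have h1 := key Finset.univ
  rw [Finset.piecewise_univ] at h1
  rw [h1, expF, mul_assoc, ← Complex.exp_add]
  congr 2
  simp only [mul_sub, Finset.sum_sub_distrib]
  ring

/-- If `h (u_p, …) f (u_q, …)` vanishes identically and `f` does not, then `h` does. -/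
theorem eq_zero_of_window_mul (hD : IsOpen D) (hDc : IsPreconnected D)
    (hf : AnalyticOnNhd ℂ f {x | ∀ i, x i ∈ D}) (hf0 : ∃ x, (∀ i, x i ∈ D) ∧ f x ≠ 0)
    (hh : ContinuousOn h {x | ∀ i, x i ∈ D}) (p q : ℤ)
    (hmul : ∀ u : ℤ → ℂ, (∀ i, u i ∈ D) → h (window u p ξ) * f (window u q ξ) = 0) :
    ∀ x, (∀ i, x i ∈ D) → h x = 0 := by
  intro x hx
  by_contra hne
  obtain ⟨z, hz, hfz⟩ := hf0
  set u₀ : ℤ → ℂ := fun i => if hi : 0 ≤ i - p ∧ i - p ≤ ξ then x ⟨(i - p).toNat, by omega⟩ else x 0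
    with hu₀
  have hu₀D : ∀ i, u₀ i ∈ D := by
    intro i
    simp only [hu₀]
    split_ifs
    exacts [hx _, hx _]
  -- The q-window is made to vary freely. The two windows may overlap, so the p-window moves too,
  -- but it stays near x, where h does not vanish; then f vanishes on an open set.
  set U : (Fin (ξ + 1) → ℂ) → ℤ → ℂ := fun y i =>
    if hi : 0 ≤ i - q ∧ i - q ≤ ξ then y ⟨(i - q).toNat, by omega⟩ else u₀ i with hU
  have hUq : ∀ y, window (U y) q ξ = y := by
    intro y
    funext i
    have := i.2
    simp only [window, hU]
    rw [dif_pos (by omega)]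
    congr 1
    ext
    simp
  have hUp : window (U (window u₀ q ξ)) p ξ = x := by
    funext i
    have hi := i.2
    have e : u₀ (p + i) = x i := by
      simp only [hu₀]
      rw [dif_pos (by omega)]
      congr 1
      ext
      simp
    simp only [window, hU]
    split_ifs with h1
    · rw [← e]
      congr 1
      simp
      omega
    · exact e
  have hUc : Continuous fun y => window (U y) p ξ := by
    refine continuous_pi fun i => ?_
    simp only [window, hU]
    split_ifs
    · exact continuous_apply _
    · exact continuous_const
  have hev : ∀ᶠ y in nhds (window u₀ q ξ), f y = 0 := by
    have hcat : ContinuousAt (fun y => h (window (U y) p ξ)) (window u₀ q ξ) := by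
      refine ContinuousAt.comp (g := h) ?_ hUc.continuousAt
      rw [hUp]
      exact hh.continuousAt ((isOpen_cube hD _).mem_nhds hx)
    have h1 := hcat.eventually_ne (y := 0) (by rw [hUp]; exact hne)
    filter_upwards [h1, (isOpen_cube hD _).mem_nhds (window_mem hu₀D q ξ)] with y hy hyD
    have h2 := hmul (U y) (fun i => by
      simp only [hU]
      split_ifs
      exacts [hyD _, hu₀D _])
    rw [hUq] at h2
    exact (mul_eq_zero.1 h2).resolve_left hy
  exact hfz (hf.eqOn_zero_of_preconnected_of_eventuallyEq_zero (isPreconnected_cube hDc _)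
    (window_mem hu₀D q ξ) hev hz)

/-- A term whose last variable occurs nowhere else vanishes. -/
theorem mul_eq_zero_of_vary (hD : IsOpen D) {τ : ℂ} (hτ : τ ≠ 0)
    (hexp : ∀ x, (∀ i, x i ∈ D) → ∀ t ∈ D, f (Function.update x (Fin.last ξ) t) =
      f x * Complex.exp (τ * (t - x (Fin.last ξ)))) {A B : (ℤ → ℂ) → ℂ} (r : ℤ)
    (hA : ∀ u t, A (Function.update u (r + ξ) t) = A u)
    (hB : ∀ u t, B (Function.update u (r + ξ) t) = B u)
    (hAB : ∀ u : ℤ → ℂ, (∀ i, u i ∈ D) → A u * f (window u r ξ) = B u) :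
    ∀ u : ℤ → ℂ, (∀ i, u i ∈ D) → A u * f (window u r ξ) = 0 := by
  intro u hu
  obtain ⟨t, ht, hne⟩ := exists_exp_ne_one hD hτ (hu (r + ξ))
  have h1 := hAB u hu
  have h2 := hAB _ (update_mem hu (r + ξ) ht)
  have h3 := window_update_add u r (Fin.last ξ) t
  rw [Fin.val_last] at h3
  rw [hA, hB, h3, hexp _ (window_mem hu r ξ) t ht] at h2
  have h4 : window u r ξ (Fin.last ξ) = u (r + ξ) := by simp [window]
  rw [h4] at h2
  have h5 : A u * f (window u r ξ) * (Complex.exp (τ * (t - u (r + ξ))) - 1) = 0 := by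
    linear_combination h2 - h1
  exact (mul_eq_zero.1 h5).resolve_right (sub_ne_zero.2 hne)

/-- The terms with the largest shift m are peeled off by varying u_{m+ξ}. If m > q, this variable
occurs in no other term, so the term vanishes. If m = q, its coefficient is the required d. If all
shifts are below q, then u_{q+ξ} occurs on the left only and d = 0. -/
theorem exists_separated (hD : IsOpen D) {τ : ℂ} (hτ : τ ≠ 0)
    (hexp : ∀ x, (∀ i, x i ∈ D) → ∀ t ∈ D, f (Function.update x (Fin.last ξ) t) =
      f x * Complex.exp (τ * (t - x (Fin.last ξ)))) {p q : ℤ} (hpq : p < q) (S : Finset ℤ)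
    (c : ℤ → ℂ) (hS : ∀ u : ℤ → ℂ, (∀ i, u i ∈ D) → h (window u p ξ) * f (window u q ξ) =
      f (window u p ξ) * ∑ a ∈ S, c a * f (window u a ξ)) :
    ∃ d : ℂ, ∀ u : ℤ → ℂ, (∀ i, u i ∈ D) →
      (h (window u p ξ) - d * f (window u p ξ)) * f (window u q ξ) = 0 := by
  have hupd : ∀ (a r : ℤ), a < r → ∀ (u : ℤ → ℂ) t,
      window (Function.update u (r + ξ) t) a ξ = window u a ξ := fun a r har u t =>
    window_update_of_notMem u (Or.inr (by omega)) t
  induction S using Finset.induction_on_max with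
  | empty => exact ⟨0, fun u hu => by simpa using hS u hu⟩
  | insert m S hm ih =>
    have hnot : m ∉ S := fun hmem => lt_irrefl m (hm m hmem)
    simp only [Finset.sum_insert hnot] at hS
    rcases lt_trichotomy m q with hmq | rfl | hmq
    · refine ⟨0, mul_eq_zero_of_vary hD hτ hexp (A := fun u => h (window u p ξ) -
        0 * f (window u p ξ)) (B := fun u => f (window u p ξ) *
        (c m * f (window u m ξ) + ∑ a ∈ S, c a * f (window u a ξ))) q ?_ ?_ ?_⟩
      · intro u t
        simp only [hupd p q hpq]
      · intro u t
        simp only [hupd p q hpq, hupd m q hmq]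
        rw [Finset.sum_congr rfl fun a ha => by rw [hupd a q ((hm a ha).trans hmq)]]
      · intro u hu
        rw [← hS u hu]
        ring
    · refine ⟨c m, mul_eq_zero_of_vary hD hτ hexp (A := fun u => h (window u p ξ) -
        c m * f (window u p ξ)) (B := fun u => f (window u p ξ) *
        ∑ a ∈ S, c a * f (window u a ξ)) m ?_ ?_ ?_⟩
      · intro u t
        simp only [hupd p m hpq]
      · intro u t
        simp only [hupd p m hpq]
        rw [Finset.sum_congr rfl fun a ha => by rw [hupd a m (hm a ha)]]
      · intro u hu
        linear_combination hS u hu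
    · refine ih fun u hu => ?_
      have h1 := mul_eq_zero_of_vary hD hτ hexp (A := fun u => f (window u p ξ) * c m)
        (B := fun u => h (window u p ξ) * f (window u q ξ) -
          f (window u p ξ) * ∑ a ∈ S, c a * f (window u a ξ)) m
        (fun u t => by simp only [hupd p m (hpq.trans hmq)])
        (fun u t => by
          simp only [hupd p m (hpq.trans hmq), hupd q m hmq]
          rw [Finset.sum_congr rfl fun a ha => by rw [hupd a m (hm a ha)]])
        (fun u hu => by linear_combination -hS u hu) u hu
      linear_combination hS u hu + h1

end

/-- The coefficients are extended by zero to all integer indices, so that later sums need no bounds.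
At k = M the coefficients supplied by the definition are replaced by the unit vector at s = α, since
independence of the shifts of f is not yet known. -/
theorem IsAlphaXi.exists_coeffs {α ξ : ℕ} {P : Bracket (2 * α + ξ)} (hP : IsAlphaXi α ξ P) :
    ∃ (f : (Fin (ξ + 1) → ℂ) → ℂ) (b : ℤ → ℤ → ℂ), AnalyticOnNhd ℂ f {x | ∀ i, x i ∈ P.dom} ∧
      (∃ x : Fin (ξ + 1) → ℂ, (∀ i, x i ∈ P.dom) ∧
        pderiv 0 f x * pderiv (Fin.last ξ) f x ≠ 0) ∧
      CoeffSupport (2 * α + ξ) ξ b ∧ HasCoeffs P.dom f P.g b ∧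
      (1 ≤ α → ∀ s, b (2 * α + ξ : ℕ) s = if s = α then 1 else 0) := by
  obtain ⟨f, hf, hx, htop, hcomb⟩ := hP
  have hcomb' : ∀ k : ℕ, ∃ b : ℕ → ℂ, 1 ≤ k → k ≤ 2 * α + ξ → ∀ u : ℤ → ℂ,
      (∀ i, u i ∈ P.dom) → P.g k (window u 0 k) =
        ∑ s ∈ Finset.range (k + 1 - ξ), b s * f (window u (s : ℤ) ξ) := by
    intro k
    by_cases hk : 1 ≤ k ∧ k ≤ 2 * α + ξ
    · obtain ⟨b, hb⟩ := hcomb k hk.1 hk.2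
      exact ⟨b, fun _ _ => hb⟩
    · exact ⟨0, fun h1 h2 => absurd ⟨h1, h2⟩ hk⟩
  choose B hB using hcomb'
  have htop' : 1 ≤ α → ∀ s : ℤ, (if 1 ≤ ((2 * α + ξ : ℕ) : ℤ) ∧
      ((2 * α + ξ : ℕ) : ℤ) ≤ (2 * α + ξ : ℕ) ∧ 0 ≤ s ∧ s + ξ ≤ (2 * α + ξ : ℕ) then
      (if ((2 * α + ξ : ℕ) : ℤ) = (2 * α + ξ : ℕ) then (if s = α then 1 else 0) else
      B ((2 * α + ξ : ℕ) : ℤ).toNat s.toNat) else 0 : ℂ) = if s = α then 1 else 0 := by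
    intro hα s
    by_cases hs : s = α
    · rw [if_pos (by omega), if_pos rfl]
    · rw [if_neg hs, if_pos rfl, ite_self]
  refine ⟨f, fun k s => if 1 ≤ k ∧ k ≤ (2 * α + ξ : ℕ) ∧ 0 ≤ s ∧ s + ξ ≤ k then
    (if k = (2 * α + ξ : ℕ) then (if s = α then 1 else 0) else B k.toNat s.toNat) else 0,
    hf, hx, ?_, ?_, htop'⟩
  · intro k s hk
    dsimp only at hk
    split_ifs at hk with h1
    · exact h1
    · exact h1
    · exact h1
    · exact absurd rfl hk
  · intro k u hu
    rcases Nat.eq_zero_or_pos k with rfl | hk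
    · rw [P.g_zero _ (window_mem hu 0 0), Finset.sum_eq_zero]
      intro s _
      dsimp only
      rw [if_neg (by omega), zero_mul]
    rcases lt_trichotomy k (2 * α + ξ) with hkM | rfl | hkM
    · rw [hB k hk hkM.le u hu]
      have e : ∀ s ∈ range (k + 1 - ξ), B k s * f (window u (s : ℤ) ξ) =
          (if 1 ≤ (k : ℤ) ∧ (k : ℤ) ≤ (2 * α + ξ : ℕ) ∧ 0 ≤ (s : ℤ) ∧ (s : ℤ) + ξ ≤ k then
          (if (k : ℤ) = (2 * α + ξ : ℕ) then (if (s : ℤ) = α then 1 else 0) else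
          B (k : ℤ).toNat (s : ℤ).toNat) else 0) * f (window u (s : ℤ) ξ) := by
        intro s hs
        rw [Finset.mem_range] at hs
        rw [if_pos (by omega), if_neg (by omega), Int.toNat_natCast, Int.toNat_natCast]
      rw [Finset.sum_congr rfl e]
      refine Finset.sum_subset (Finset.range_mono (by omega)) fun s _ hs => ?_
      rw [Finset.mem_range] at hs
      rw [if_neg (by omega), zero_mul]
    · rw [htop u hu]
      symm
      rw [Finset.sum_eq_single α]
      · dsimp only
        rw [if_pos (by omega), if_pos rfl, if_pos rfl, one_mul]
      · intro s _ hs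
        dsimp only
        rw [if_pos rfl, if_neg (show ¬ (s : ℤ) = α by omega), ite_self, zero_mul]
      · intro hα
        simp at hα
        omega
    · rw [P.g_gt k hkM _ (window_mem hu 0 k), Finset.sum_eq_zero]
      intro s _
      dsimp only
      rw [if_neg (by omega), zero_mul]

theorem exists_windows {D : Set ℂ} {ξ : ℕ} {p q : ℤ} (hpq : p + ξ < q) {x y : Fin (ξ + 1) → ℂ}
    (hx : ∀ i, x i ∈ D) (hy : ∀ i, y i ∈ D) :
    ∃ u : ℤ → ℂ, (∀ i, u i ∈ D) ∧ window u p ξ = x ∧ window u q ξ = y := by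
  refine ⟨fun i => if h : 0 ≤ i - p ∧ i - p ≤ ξ then x ⟨(i - p).toNat, by omega⟩ else
    if h : 0 ≤ i - q ∧ i - q ≤ ξ then y ⟨(i - q).toNat, by omega⟩ else x 0, ?_, ?_, ?_⟩
  · intro i
    dsimp only
    split_ifs
    exacts [hx _, hy _, hx _]
  · funext i
    have := i.2
    simp only [window]
    rw [dif_pos (by omega)]
    congr 1
    ext
    simp
  · funext i
    have := i.2
    simp only [window]
    rw [dif_neg (by omega), dif_pos (by omega)]
    congr 1
    ext
    simp

section
variable {α ξ : ℕ} {D : Set ℂ} {f : (Fin (ξ + 1) → ℂ) → ℂ}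
  {g : (k : ℕ) → (Fin (k + 1) → ℂ) → ℂ} {b : ℤ → ℤ → ℂ}

theorem HasCoeffs.coordBracket_far (hg : HasCoeffs D f g b) (hb : CoeffSupport (2 * α + ξ) ξ b)
    {u : ℤ → ℂ} (hu : ∀ i, u i ∈ D) {n m : ℤ} (h : n + (2 * α + ξ) < m ∨ m + (2 * α + ξ) < n) :
    coordBracket g n m u = 0 := by
  rw [hg.coordBracket_eq hb hu subset_rfl]
  refine Finset.sum_eq_zero fun a _ => ?_
  have h1 : b (m - n) (a - n) = 0 := by
    by_contra hne
    have := hb _ _ hne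
    push_cast at this
    omega
  have h2 : b (n - m) (a - m) = 0 := by
    by_contra hne
    have := hb _ _ hne
    push_cast at this
    omega
  rw [brCoeff, h1, h2, sub_zero, zero_mul]

theorem brCoeff_top (hb : CoeffSupport (2 * α + ξ) ξ b)
    (htop : ∀ s, b (2 * α + ξ : ℕ) s = if s = α then 1 else 0) {n m : ℤ}
    (h : m = n + (2 * α + ξ)) (a : ℤ) :
    brCoeff b n m a = if a = n + α then 1 else 0 := by
  have h2 : b (n - m) (a - m) = 0 := by
    by_contra hne
    have := hb _ _ hne
    push_cast at this
    omega
  rw [brCoeff, h2, sub_zero, show m - n = (2 * α + ξ : ℕ) by push_cast; omega, htop]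
  congr 1
  apply propext
  constructor <;> intro hh <;> omega

theorem brCoeff_swap (i j a : ℤ) : brCoeff b i j a = -brCoeff b j i a := by
  unfold brCoeff
  ring

theorem HasCoeffs.coordBracket_top (hg : HasCoeffs D f g b) (hb : CoeffSupport (2 * α + ξ) ξ b)
    (htop : ∀ s, b (2 * α + ξ : ℕ) s = if s = α then 1 else 0) (hα : 1 ≤ α)
    {u : ℤ → ℂ} (hu : ∀ i, u i ∈ D) {n m : ℤ} (h : m = n + (2 * α + ξ)) :
    coordBracket g n m u = f (window u (n + α) ξ) ∧
      coordBracket g m n u = -f (window u (n + α) ξ) := by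
  have hmem : n + α ∈ Icc (min n m) (max n m) := by
    rw [Finset.mem_Icc]
    omega
  have hmem' : n + α ∈ Icc (min m n) (max m n) := by
    rw [Finset.mem_Icc]
    omega
  rw [hg.coordBracket_eq hb hu subset_rfl, hg.coordBracket_eq hb hu subset_rfl]
  constructor
  · rw [Finset.sum_eq_single_of_mem _ hmem, brCoeff_top hb htop h, if_pos rfl, one_mul]
    intro a _ ha
    rw [brCoeff_top hb htop h, if_neg ha, zero_mul]
  · rw [Finset.sum_eq_single_of_mem _ hmem', brCoeff_swap, brCoeff_top hb htop h, if_pos rfl,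
      neg_one_mul]
    intro a _ ha
    rw [brCoeff_swap, brCoeff_top hb htop h, if_neg ha, neg_zero, zero_mul]

/-- The Jacobi identity for `u_0, u_M, u_l` with `l = M + α + j`. -/
theorem HasCoeffs.jacobi_top (hD : IsOpen D) (hα : 1 ≤ α)
    (hf : AnalyticOnNhd ℂ f {x | ∀ i, x i ∈ D}) (hg : HasCoeffs D f g b)
    (hb : CoeffSupport (2 * α + ξ) ξ b)
    (htop : ∀ s, b (2 * α + ξ : ℕ) s = if s = α then 1 else 0)
    (hJ : ∀ n m l : ℤ, ∀ u : ℤ → ℂ, (∀ i, u i ∈ D) →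
      iteratedBracket g n m l u + iteratedBracket g m l n u + iteratedBracket g l n m u = 0)
    (j : ℕ) {u : ℤ → ℂ} (hu : ∀ i, u i ∈ D) :
    ∑ i : Fin (ξ + 1), pderiv i f (window u α ξ) *
        coordBracket g (α + ((i : ℕ) : ℤ)) (2 * α + ξ + α + j) u =
      b (α + j) 0 * (pderiv 0 f (window u (2 * α + ξ) ξ) * f (window u α ξ)) := by
  have h1 : iteratedBracket g 0 (2 * α + ξ) (2 * α + ξ + α + j) u =
      ∑ i : Fin (ξ + 1), pderiv i f (window u α ξ) *
        coordBracket g (α + ((i : ℕ) : ℤ)) (2 * α + ξ + α + j) u := by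
    have hmem : (α : ℤ) ∈ Icc (min 0 (2 * α + ξ : ℤ)) (max 0 (2 * α + ξ : ℤ)) := by
      rw [Finset.mem_Icc]; omega
    rw [hg.iteratedBracket_eq hD hf hb hu _ subset_rfl, Finset.sum_eq_single_of_mem _ hmem,
      brCoeff_top hb htop (by omega), if_pos (by omega), one_mul]
    intro a _ ha
    rw [brCoeff_top hb htop (by omega), if_neg (by omega), zero_mul]
  have h2 : iteratedBracket g (2 * α + ξ) (2 * α + ξ + α + j) 0 u =
      -(b (α + j) 0 * (pderiv 0 f (window u (2 * α + ξ) ξ) * f (window u α ξ))) := by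
    have hmem : (2 * α + ξ : ℤ) ∈ Icc (min (2 * α + ξ : ℤ) (2 * α + ξ + α + j : ℤ))
        (max (2 * α + ξ : ℤ) (2 * α + ξ + α + j : ℤ)) := by
      rw [Finset.mem_Icc]; omega
    rw [hg.iteratedBracket_eq hD hf hb hu _ subset_rfl, Finset.sum_eq_single_of_mem _ hmem,
      Finset.sum_eq_single_of_mem 0 (Finset.mem_univ _)]
    · have h3 := (hg.coordBracket_top hb htop hα hu (n := 0) (m := 2 * α + ξ) (by ring)).2
      have h4 : b (2 * α + ξ - (2 * α + ξ + α + j)) (2 * α + ξ - (2 * α + ξ + α + j)) = 0 := by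
        by_contra hne
        have := hb _ _ hne
        omega
      have h5 : brCoeff b (2 * α + ξ) (2 * α + ξ + α + j) (2 * α + ξ) = b (α + j) 0 := by
        rw [brCoeff, h4, sub_zero]
        congr 1 <;> ring
      rw [zero_add] at h3
      rw [h5, Fin.val_zero, Nat.cast_zero, add_zero, h3]
      ring
    · intro i _ hi
      have : (i : ℕ) ≠ 0 := fun hh => hi (Fin.ext hh)
      rw [hg.coordBracket_far hb hu (by omega), mul_zero]
    · intro a ha hne
      rw [Finset.mem_Icc] at ha
      rw [Finset.sum_eq_zero, mul_zero]
      intro i _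
      rw [hg.coordBracket_far hb hu (by omega), mul_zero]
  have h3 : iteratedBracket g (2 * α + ξ + α + j) 0 (2 * α + ξ) u = 0 := by
    rw [hg.iteratedBracket_eq hD hf hb hu _ subset_rfl]
    refine Finset.sum_eq_zero fun a _ => ?_
    have h1 : b (0 - (2 * α + ξ + α + j)) (a - (2 * α + ξ + α + j)) = 0 := by
      by_contra hne
      have := hb _ _ hne
      omega
    have h2 : b (2 * α + ξ + α + j - 0) (a - 0) = 0 := by
      by_contra hne
      have := hb _ _ hne
      push_cast at this
      omega
    rw [brCoeff, h1, h2, sub_zero, zero_mul]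
  have h4 := hJ 0 (2 * α + ξ) (2 * α + ξ + α + j) u hu
  rw [h1, h2, h3] at h4
  linear_combination h4

/-- All partial derivatives of the leading coefficient are multiples of it. -/
theorem HasCoeffs.exists_exponents (hD : IsOpen D) (hDc : IsConnected D) (hα : 1 ≤ α)
    (hf : AnalyticOnNhd ℂ f {x | ∀ i, x i ∈ D}) (hg : HasCoeffs D f g b)
    (hx : ∃ x : Fin (ξ + 1) → ℂ, (∀ i, x i ∈ D) ∧ pderiv 0 f x * pderiv (Fin.last ξ) f x ≠ 0)
    (hb : CoeffSupport (2 * α + ξ) ξ b)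
    (htop : ∀ s, b (2 * α + ξ : ℕ) s = if s = α then 1 else 0)
    (hJ : ∀ n m l : ℤ, ∀ u : ℤ → ℂ, (∀ i, u i ∈ D) →
      iteratedBracket g n m l u + iteratedBracket g m l n u + iteratedBracket g l n m u = 0) :
    ∃ τ : ℕ → ℂ, τ 0 ≠ 0 ∧ τ ξ ≠ 0 ∧ (∀ i, ξ < i → τ i = 0) ∧
      ∀ x : Fin (ξ + 1) → ℂ, (∀ i, x i ∈ D) → ∀ i, pderiv i f x = τ i * f x := by
  have key := fun j u hu => hg.jacobi_top hD hα hf hb htop hJ j (u := u) hu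
  obtain ⟨x, hxD, hxne⟩ := hx
  have hx0 := left_ne_zero_of_mul hxne
  have hxl := right_ne_zero_of_mul hxne
  -- the first and the last variable
  have hbase : ∀ y z : Fin (ξ + 1) → ℂ, (∀ i, y i ∈ D) → (∀ i, z i ∈ D) →
      pderiv (Fin.last ξ) f y * f z = b (α + ξ) 0 * (pderiv 0 f z * f y) := by
    intro y z hy hz
    -- The windows at α and 2α + ξ are disjoint because α ≥ 1, so y and z are independent. For j = ξ
    -- only the bracket of u_{α+ξ} with u_{M+α+ξ} is within range.
    obtain ⟨u, hu, rfl, rfl⟩ := exists_windows (p := α) (q := 2 * α + ξ) (by omega) hy hz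
    rw [← key ξ u hu, Finset.sum_eq_single_of_mem (Fin.last ξ) (Finset.mem_univ _)]
    · rw [(hg.coordBracket_top hb htop hα hu
        (by rw [Fin.val_last]; ring)).1, Fin.val_last]
      congr 3
      ring
    · intro i _ hi
      have h1 := i.2
      have h2 : (i : ℕ) ≠ ξ := fun hh => hi (Fin.ext hh)
      rw [hg.coordBracket_far hb hu (by omega), mul_zero]
  -- If f vanished identically, so would its first derivative.
  obtain ⟨z, hz, hfz⟩ : ∃ z, (∀ i, z i ∈ D) ∧ f z ≠ 0 := by
    by_contra! hcon
    have h1 := hbase x x hxD hxD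
    refine hx0 ?_
    rw [pderiv_eq_fderiv hf hxD]
    have h2 : f =ᶠ[nhds x] fun _ => 0 := by
      filter_upwards [(isOpen_cube hD _).mem_nhds hxD] with y hy using hcon y hy
    rw [h2.fderiv_eq]
    simp
  have hxz := hbase x z hxD hz
  have hxz' : b (α + ξ) 0 * (pderiv 0 f z * f x) ≠ 0 := by
    rw [← hxz]; exact mul_ne_zero hxl hfz
  have hb0 := left_ne_zero_of_mul hxz'
  have hfx := right_ne_zero_of_mul (right_ne_zero_of_mul hxz')
  -- Freezing z, respectively x, in the separated identity gives the two logarithmic derivatives as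
  -- constants.
  have hlast : ∃ t, ∀ y : Fin (ξ + 1) → ℂ, (∀ i, y i ∈ D) → pderiv (Fin.last ξ) f y = t * f y := by
    refine ⟨b (α + ξ) 0 * pderiv 0 f z / f z, fun y hy => ?_⟩
    field_simp
    linear_combination hbase y z hy hz
  have hfirst : ∃ t, ∀ y : Fin (ξ + 1) → ℂ, (∀ i, y i ∈ D) → pderiv 0 f y = t * f y := by
    refine ⟨pderiv (Fin.last ξ) f x / (b (α + ξ) 0 * f x), fun y hy => ?_⟩
    field_simp
    linear_combination -hbase x y hxD hy
  obtain ⟨τl, hτl⟩ := hlast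
  obtain ⟨τf, hτf⟩ := hfirst
  have hτl0 : τl ≠ 0 := by
    rintro rfl
    exact hxl (by rw [hτl x hxD, zero_mul])
  have hexp : ∀ x, (∀ i, x i ∈ D) → ∀ t ∈ D, f (Function.update x (Fin.last ξ) t) =
      f x * Complex.exp (τl * (t - x (Fin.last ξ))) := fun x hx t ht =>
    update_eq_mul_exp hD hDc.isPreconnected hf hτl hx ht
  -- the other variables, from the last one downwards
  have hall : ∀ d : ℕ, ∀ j : Fin (ξ + 1), (j : ℕ) + d = ξ →
      ∃ t, ∀ y : Fin (ξ + 1) → ℂ, (∀ i, y i ∈ D) → pderiv j f y = t * f y := by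
    intro d
    induction d using Nat.strong_induction_on with
    | _ d ih =>
      intro j hj
      rcases Nat.eq_zero_or_pos d with rfl | hd
      · obtain rfl : j = Fin.last ξ := Fin.ext (by simpa using hj)
        exact ⟨τl, hτl⟩
      have ht : ∀ i : Fin (ξ + 1), ∃ t, j < i → ∀ y : Fin (ξ + 1) → ℂ, (∀ i, y i ∈ D) →
          pderiv i f y = t * f y := by
        intro i
        by_cases hij : j < i
        · have hij' : (j : ℕ) < i := hij
          have hi := i.2
          obtain ⟨t, ht⟩ := ih (ξ - i) (by omega) i (by omega)
          exact ⟨t, fun _ => ht⟩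
        · exact ⟨0, fun h => absurd h hij⟩
      choose t ht using ht
      set S : Finset ℤ := Icc α (2 * α + ξ + α + j) with hS
      have hMS : (2 * α + ξ : ℤ) ∈ S := by rw [hS, Finset.mem_Icc]; omega
      -- In the identity with parameter j, the terms i < j are out of range and i = j gives ∂_j
      -- f(u_α, …) f_{2α+j}. In the terms i > j and on the right side, the derivatives of f are
      -- already known multiples of f, so all of these have the form f_α times a combination of
      -- shifts.
      obtain ⟨c, hc⟩ := exists_separated (h := pderiv j f) hD hτl0 hexp (p := α)
        (q := 2 * α + j) (by omega) S (fun a => (if a = 2 * α + ξ then b (α + j) 0 * τf else 0) -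
          ∑ i : Fin (ξ + 1), if j < i then
            t i * brCoeff b (α + ((i : ℕ) : ℤ)) (2 * α + ξ + α + j) a else 0) (by
        intro u hu
        have h1 := key j u hu
        rw [hτf _ (window_mem hu _ _)] at h1
        have h2 : ∀ i : Fin (ξ + 1), pderiv i f (window u α ξ) *
            coordBracket g (α + ((i : ℕ) : ℤ)) (2 * α + ξ + α + j) u =
            (if i = j then pderiv j f (window u α ξ) * f (window u (2 * α + j) ξ) else 0) +
            (if j < i then t i * f (window u α ξ) *
              ∑ a ∈ S, brCoeff b (α + ((i : ℕ) : ℤ)) (2 * α + ξ + α + j) a * f (window u a ξ)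
              else 0) := by
          intro i
          have hi := i.2
          have hj' := j.2
          rcases lt_trichotomy i j with hij | rfl | hij
          · have hij' : (i : ℕ) < j := hij
            rw [if_neg hij.ne, if_neg hij.not_gt, hg.coordBracket_far hb hu (by omega)]
            ring
          · rw [if_pos rfl, if_neg (lt_irrefl _), add_zero,
              (hg.coordBracket_top hb htop hα hu (by ring)).1]
            congr 3
            ring
          · have hij' : (j : ℕ) < i := hij
            rw [if_neg hij.ne', if_pos hij, zero_add, ht i hij _ (window_mem hu _ _),
              hg.coordBracket_eq hb hu (S := S)]
            exact Finset.Icc_subset_Icc (by omega) (by omega)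
        rw [Finset.sum_congr rfl fun i _ => h2 i, Finset.sum_add_distrib] at h1
        simp only [Finset.sum_ite_eq', Finset.mem_univ, if_true] at h1
        have h3 : ∑ i : Fin (ξ + 1), (if j < i then t i * f (window u α ξ) *
              ∑ a ∈ S, brCoeff b (α + ((i : ℕ) : ℤ)) (2 * α + ξ + α + j) a * f (window u a ξ)
              else 0) = f (window u α ξ) * ∑ a ∈ S, (∑ i : Fin (ξ + 1), if j < i then
            t i * brCoeff b (α + ((i : ℕ) : ℤ)) (2 * α + ξ + α + j) a else 0) *
              f (window u a ξ) := by
          simp only [Finset.sum_mul, Finset.mul_sum]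
          rw [Finset.sum_comm]
          refine Finset.sum_congr rfl fun i _ => ?_
          split_ifs with hij
          · exact Finset.sum_congr rfl fun a _ => by ring
          · simp
        simp only [sub_mul, Finset.sum_sub_distrib]
        rw [mul_sub, ← h3]
        simp only [ite_mul, zero_mul, Finset.sum_ite_eq', if_pos hMS]
        linear_combination h1)
      refine ⟨c, fun y hy => sub_eq_zero.1 ?_⟩
      exact eq_zero_of_window_mul (h := fun y => pderiv j f y - c * f y) hD hDc.isPreconnected hf
        ⟨z, hz, hfz⟩ ((continuousOn_pderiv hf j).sub (continuousOn_const.mul hf.continuousOn))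
        α (2 * α + j) hc y hy
  choose τ hτ using fun j : Fin (ξ + 1) => hall (ξ - j) j (by omega)
  have hτ0 : τ 0 ≠ 0 := fun h => hx0 (by rw [hτ 0 x hxD, h, zero_mul])
  have hτξ : τ (Fin.last ξ) ≠ 0 := fun h => hxl (by rw [hτ _ x hxD, h, zero_mul])
  refine ⟨fun i => if h : i < ξ + 1 then τ ⟨i, h⟩ else 0, ?_, ?_, ?_, ?_⟩
  · dsimp only; rw [dif_pos (by omega)]; exact hτ0
  · dsimp only; rw [dif_pos (by omega)]; exact hτξ
  · intro i hi
    dsimp only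
    rw [dif_neg (by omega)]
  · intro x hx i
    dsimp only
    rw [dif_pos i.2]
    exact hτ i x hx

end

/-! ### Independence of products of exponentials. -/

/-- The linear form `∑ τ_i u_{a+i}`. -/
noncomputable def linForm (ξ : ℕ) (τ : ℕ → ℂ) (a : ℤ) (u : ℤ → ℂ) : ℂ :=
  ∑ i ∈ range (ξ + 1), τ i * u (a + (i : ℤ))

/-- The character `u ↦ exp (∑ τ_i u_{a+i})`. -/
noncomputable def expChar (ξ : ℕ) (τ : ℕ → ℂ) (a : ℤ) : Multiplicative (ℤ → ℂ) →* ℂ where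
  toFun u := Complex.exp (linForm ξ τ a u.toAdd)
  map_one' := by simp [linForm]
  map_mul' u v := by
    rw [← Complex.exp_add]
    simp [linForm, mul_add, Finset.sum_add_distrib]

section
variable {ξ : ℕ} {τ : ℕ → ℂ}

theorem linForm_single (hτ : ∀ i, ξ < i → τ i = 0) (a m : ℤ) :
    linForm ξ τ a (Pi.single m 1) = extZ τ (m - a) := by
  unfold linForm extZ
  simp only [Pi.single_apply, mul_ite, mul_one, mul_zero]
  split_ifs with h
  · rcases le_or_gt (m - a).toNat ξ with h1 | h1
    · rw [Finset.sum_eq_single_of_mem (m - a).toNat (by rw [Finset.mem_range]; omega),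
        if_pos (by omega)]
      intro i _ hi
      rw [if_neg (by omega)]
    · rw [hτ _ h1, Finset.sum_eq_zero]
      intro i hi
      rw [Finset.mem_range] at hi
      rw [if_neg (by omega)]
  · exact Finset.sum_eq_zero fun i _ => if_neg (by omega)

/-- Equal characters have equal linear forms, that is, (z^a + z^c) T = (z^a' + z^c') T. The lowest
terms identify the smaller shifts, since neither τ_0 nor 2 τ_0 is zero; after cancellation the other
two agree. -/
theorem expChar_mul_inj (hτ0 : τ 0 ≠ 0) (hτ : ∀ i, ξ < i → τ i = 0) {a c a' c' : ℤ}
    (h : expChar ξ τ a * expChar ξ τ c = expChar ξ τ a' * expChar ξ τ c') :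
    (a = a' ∧ c = c') ∨ (a = c' ∧ c = a') := by
  have hlin : ∀ m : ℤ, extZ τ (m - a) + extZ τ (m - c) = extZ τ (m - a') + extZ τ (m - c') := by
    intro m
    by_contra hne
    obtain ⟨t, _, ht⟩ := exists_exp_ne_one isOpen_univ (sub_ne_zero.2 hne) (Set.mem_univ 0)
    refine ht ?_
    have h1 := DFunLike.congr_fun h (Multiplicative.ofAdd (t • (Pi.single m 1 : ℤ → ℂ)))
    have h2 : ∀ a, linForm ξ τ a (t • (Pi.single m 1 : ℤ → ℂ)) = t * extZ τ (m - a) := by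
      intro a
      rw [← linForm_single hτ, linForm, linForm, Finset.mul_sum]
      exact Finset.sum_congr rfl fun i _ => by simp only [Pi.smul_apply, smul_eq_mul]; ring
    simp only [MonoidHom.mul_apply, expChar, MonoidHom.coe_mk, OneHom.coe_mk, toAdd_ofAdd, h2,
      ← Complex.exp_add] at h1
    rw [show (extZ τ (m - a) + extZ τ (m - c) - (extZ τ (m - a') + extZ τ (m - c'))) * (t - 0) =
      (t * extZ τ (m - a) + t * extZ τ (m - c)) - (t * extZ τ (m - a') + t * extZ τ (m - c')) by ring,
      Complex.exp_sub, h1, div_self (Complex.exp_ne_zero _)]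
  have hz : extZ τ 0 = τ 0 := extZ_natCast τ 0
  have hneg : ∀ m : ℤ, m < 0 → extZ τ m = 0 := fun m hm => if_neg (by omega)
  have hpos : ∀ m : ℤ, m ≤ 0 → τ 0 + extZ τ m ≠ 0 := by
    intro m hm
    rcases hm.lt_or_eq with hm | rfl
    · rwa [hneg m hm, add_zero]
    · rw [hz]
      intro h2
      exact hτ0 (by linear_combination h2 / 2)
  have key : ∀ a c a' c' : ℤ, a ≤ c → a' ≤ c' →
      (∀ m : ℤ, extZ τ (m - a) + extZ τ (m - c) = extZ τ (m - a') + extZ τ (m - c')) →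
      a = a' ∧ c = c' := by
    intro a c a' c' hac hac' hlin
    have ha : a = a' := by
      rcases lt_trichotomy a a' with hlt | heq | hlt
      · have := hlin a
        rw [sub_self, hz, hneg (a - a') (by omega), hneg (a - c') (by omega), add_zero] at this
        exact absurd this (hpos _ (by omega))
      · exact heq
      · have := hlin a'
        rw [sub_self, hz, hneg (a' - a) (by omega), hneg (a' - c) (by omega), add_zero] at this
        exact absurd this.symm (hpos _ (by omega))
    subst ha
    have hlin' : ∀ m : ℤ, extZ τ (m - c) = extZ τ (m - c') := fun m => add_left_cancel (hlin m)
    refine ⟨rfl, ?_⟩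
    rcases lt_trichotomy c c' with hlt | heq | hlt
    · have := hlin' c
      rw [sub_self, hz, hneg (c - c') (by omega)] at this
      exact absurd this hτ0
    · exact heq
    · have := hlin' c'
      rw [sub_self, hz, hneg (c' - c) (by omega)] at this
      exact absurd this.symm hτ0
  rcases le_total a c with h1 | h1 <;> rcases le_total a' c' with h2 | h2
  · exact Or.inl (key a c a' c' h1 h2 hlin)
  · exact Or.inr (key a c c' a' h1 h2 fun m => by rw [hlin, add_comm])
  · have := key c a a' c' h1 h2 fun m => by rw [← hlin, add_comm]
    exact Or.inr ⟨this.2, this.1⟩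
  · have := key c a c' a' h1 h2 fun m => by rw [add_comm, hlin, add_comm]
    exact Or.inl ⟨this.2, this.1⟩

/-- A quadratic form in the exponentials that vanishes identically is antisymmetric. -/
theorem add_swap_eq_zero_of_sum_expChar (hτ0 : τ 0 ≠ 0) (hτ : ∀ i, ξ < i → τ i = 0)
    (S : Finset ℤ) (X : ℤ → ℤ → ℂ)
    (h : ∀ u : ℤ → ℂ, ∑ a ∈ S, ∑ c ∈ S, X a c *
      (Complex.exp (linForm ξ τ a u) * Complex.exp (linForm ξ τ c u)) = 0) {a c : ℤ}
    (ha : a ∈ S) (hc : c ∈ S) : X a c + X c a = 0 := by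
  classical
  set χ : ℤ × ℤ → (Multiplicative (ℤ → ℂ) →* ℂ) := fun p => expChar ξ τ p.1 * expChar ξ τ p.2
    with hχ
  -- Distinct characters are linearly independent (Dedekind), so the coefficients summed over each
  -- fibre of (a, c) ↦ χ vanish; the fibres are unordered pairs.
  have hli := linearIndependent_iff'.1 (linearIndependent_monoidHom (Multiplicative (ℤ → ℂ)) ℂ)
    ((S ×ˢ S).image χ) (fun ψ => ∑ p ∈ S ×ˢ S with χ p = ψ, X p.1 p.2) (by
      funext u
      rw [Finset.sum_apply]
      have h1 := h u.toAdd
      rw [← Finset.sum_product' S S (fun a c => X a c * (Complex.exp (linForm ξ τ a u.toAdd) *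
        Complex.exp (linForm ξ τ c u.toAdd)))] at h1
      rw [Pi.zero_apply, ← h1, ← Finset.sum_fiberwise_of_maps_to (s := S ×ˢ S)
        (t := (S ×ˢ S).image χ) (g := χ) (fun p hp => Finset.mem_image_of_mem _ hp)]
      refine Finset.sum_congr rfl fun ψ _ => ?_
      rw [Pi.smul_apply, smul_eq_mul, Finset.sum_mul]
      refine Finset.sum_congr rfl fun p hp => ?_
      rw [Finset.mem_filter] at hp
      rw [← hp.2]
      rfl) (χ (a, c)) (Finset.mem_image_of_mem _ (Finset.mk_mem_product ha hc))
  have hfib : (S ×ˢ S).filter (fun p => χ p = χ (a, c)) = {(a, c), (c, a)} := by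
    ext ⟨a', c'⟩
    simp only [Finset.mem_filter, Finset.mem_product, Finset.mem_insert, Finset.mem_singleton,
      Prod.mk.injEq]
    constructor
    · rintro ⟨_, h1⟩
      exact expChar_mul_inj hτ0 hτ h1
    · rintro (⟨rfl, rfl⟩ | ⟨rfl, rfl⟩)
      · exact ⟨⟨ha, hc⟩, rfl⟩
      · exact ⟨⟨hc, ha⟩, mul_comm _ _⟩
  rw [hfib] at hli
  by_cases hac : a = c
  · subst hac
    simp only [Finset.insert_eq_of_mem (Finset.mem_singleton_self _), Finset.sum_singleton] at hli
    rw [hli, add_zero]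
  · rwa [Finset.sum_pair (fun hh => hac (Prod.mk.inj hh).1)] at hli

/-- An identity between exponentials on an open set holds everywhere. -/
theorem sum_exp_eq_zero_of_open {D : Set ℂ} (hD : IsOpen D) (hne : D.Nonempty) (p q : ℤ)
    (X : ℤ → ℤ → ℂ)
    (h : ∀ u : ℤ → ℂ, (∀ i, u i ∈ D) → ∑ a ∈ Icc p q, ∑ c ∈ Icc p q, X a c *
      (Complex.exp (linForm ξ τ a u) * Complex.exp (linForm ξ τ c u)) = 0) (w : ℤ → ℂ) :
    ∑ a ∈ Icc p q, ∑ c ∈ Icc p q, X a c *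
      (Complex.exp (linForm ξ τ a w) * Complex.exp (linForm ξ τ c w)) = 0 := by
  obtain ⟨x, hx⟩ := hne
  -- A complex line from a constant sequence in D to w, on the finitely many variables that occur.
  -- The form is entire in t and vanishes near t = 0, hence also at t = 1.
  set U : ℂ → ℤ → ℂ := fun t i => x + t * (if i ∈ Icc p (q + ξ) then w i - x else 0) with hU
  have hdiff : ∀ a, Differentiable ℂ fun t => linForm ξ τ a (U t) := by
    intro a
    simp only [linForm, hU]
    fun_prop
  have hG : Differentiable ℂ fun t => ∑ a ∈ Icc p q, ∑ c ∈ Icc p q, X a c *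
      (Complex.exp (linForm ξ τ a (U t)) * Complex.exp (linForm ξ τ c (U t))) := by
    refine Differentiable.fun_sum fun a _ => Differentiable.fun_sum fun c _ => ?_
    exact (((hdiff a).cexp).mul ((hdiff c).cexp)).const_mul _
  have hev : ∀ᶠ t in nhds (0 : ℂ), ∀ i, U t i ∈ D := by
    have h1 : ∀ᶠ t in nhds (0 : ℂ), ∀ i ∈ Icc p (q + ξ), U t i ∈ D := by
      rw [Filter.eventually_all_finset]
      intro i _
      have hc : Continuous fun t => U t i := by
        simp only [hU]
        fun_prop
      exact hc.continuousAt.eventually_mem (hD.mem_nhds (by simpa [hU] using hx))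
    filter_upwards [h1] with t ht i
    by_cases hi : i ∈ Icc p (q + ξ)
    · exact ht i hi
    · simp only [hU, if_neg hi, mul_zero, add_zero]
      exact hx
  have hzero := (hG.differentiableOn.analyticOnNhd isOpen_univ).eqOn_of_preconnected_of_eventuallyEq
    (analyticOnNhd_const (v := (0 : ℂ))) isPreconnected_univ (Set.mem_univ 0)
    (by filter_upwards [hev] with t ht using h (U t) ht) (Set.mem_univ 1)
  have hlin : ∀ a ∈ Icc p q, linForm ξ τ a (U 1) = linForm ξ τ a w := by
    intro a ha
    rw [Finset.mem_Icc] at ha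
    refine Finset.sum_congr rfl fun i hi => ?_
    rw [Finset.mem_range] at hi
    simp only [hU]
    rw [if_pos (by rw [Finset.mem_Icc]; omega)]
    ring
  refine Eq.trans ?_ hzero
  refine Finset.sum_congr rfl fun a ha => Finset.sum_congr rfl fun c hc => ?_
  rw [hlin a ha, hlin c hc]

/-- The coefficients of the Jacobi identity. -/
theorem HasCoeffs.jacobiCoeff_add_swap {M : ℕ} {D : Set ℂ} {f : (Fin (ξ + 1) → ℂ) → ℂ}
    {g : (k : ℕ) → (Fin (k + 1) → ℂ) → ℂ} {b : ℤ → ℤ → ℂ} (hD : IsOpen D) (hDc : IsConnected D)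
    (hf : AnalyticOnNhd ℂ f {x | ∀ i, x i ∈ D}) (hg : HasCoeffs D f g b)
    (hb : CoeffSupport M ξ b)
    (hJ : ∀ n m l : ℤ, ∀ u : ℤ → ℂ, (∀ i, u i ∈ D) →
      iteratedBracket g n m l u + iteratedBracket g m l n u + iteratedBracket g l n m u = 0)
    (hτ0 : τ 0 ≠ 0) (hτ : ∀ i, ξ < i → τ i = 0) {e : ℂ} (he : e ≠ 0)
    (hfe : ∀ x : Fin (ξ + 1) → ℂ, (∀ i, x i ∈ D) → f x = expF ξ τ e x)
    (hpd : ∀ x : Fin (ξ + 1) → ℂ, (∀ i, x i ∈ D) → ∀ i, pderiv i f x = τ i * f x)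
    (n m l a c : ℤ) :
    jacobiCoeff ξ τ b n m l a c + jacobiCoeff ξ τ b n m l c a = 0 := by
  set p := min n (min m (min l (min a c)))
  set q := max n (max m (max l (max a c)))
  refine add_swap_eq_zero_of_sum_expChar hτ0 hτ (Icc p q) _
    (sum_exp_eq_zero_of_open hD hDc.nonempty p q _ fun u hu => ?_) (by simp [p, q]) (by simp [p, q])
  have h1 := hg.jacobi_eq hD hf hb hpd hu (n := n) (m := m) (l := l) (p := p) (q := q)
    (by simp [p, q]) (by simp [p, q]) (by simp [p, q])
  rw [hJ n m l u hu] at h1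
  have h2 : ∀ a, f (window u a ξ) = e * Complex.exp (linForm ξ τ a u) := fun a => by
    rw [hfe _ (window_mem hu a ξ), expF_window]
    rfl
  have h3 : e ^ 2 * ∑ a ∈ Icc p q, ∑ c ∈ Icc p q, jacobiCoeff ξ τ b n m l a c *
      (Complex.exp (linForm ξ τ a u) * Complex.exp (linForm ξ τ c u)) = 0 := by
    rw [h1]
    simp only [Finset.mul_sum, h2]
    exact Finset.sum_congr rfl fun a _ => Finset.sum_congr rfl fun c _ => by ring
  exact (mul_eq_zero.1 h3).resolve_left (pow_ne_zero 2 he)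

end

/-! ### Solving the Jacobi identity for the coefficients. -/

section
variable {α ξ : ℕ} {τ : ℕ → ℂ} {b : ℤ → ℤ → ℂ}

theorem CoeffSupport.eq_zero {M : ℕ} (hb : CoeffSupport M ξ b) {k s : ℤ}
    (h : k < 1 ∨ M < k ∨ s < 0 ∨ k < s + ξ) : b k s = 0 := by
  by_contra hne
  have := hb k s hne
  omega

theorem brCoeff_far {M : ℕ} (hb : CoeffSupport M ξ b) {i j : ℤ} (h : i + M < j ∨ j + M < i)
    (a : ℤ) : brCoeff b i j a = 0 := by
  rw [brCoeff, hb.eq_zero (by omega), hb.eq_zero (by omega), sub_zero]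

/-- Recursion along the diagonals, from the triples `u_0, u_M, u_l` with `l > M`. -/
theorem sum_coeff_diag (hα : 1 ≤ α) (hb : CoeffSupport (2 * α + ξ) ξ b)
    (htop : ∀ s, b (2 * α + ξ : ℕ) s = if s = α then 1 else 0)
    (hJ : ∀ n m l a c, jacobiCoeff ξ τ b n m l a c + jacobiCoeff ξ τ b n m l c a = 0)
    {k : ℤ} (hk : α + ξ < k) (s : ℤ) :
    ∑ i ∈ range (ξ + 1), τ i * b (k - i) (s - i) =
      if s = α + ξ then τ 0 * b (k - (α + ξ)) 0 else 0 := by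
  have hM : ((2 * α + ξ : ℕ) : ℤ) = 2 * α + ξ := by push_cast; ring
  have h := hJ 0 (2 * α + ξ) (k + α) α (s + α)
  have h1 : iterCoeff ξ τ b α (k + α) (s + α) = ∑ i ∈ range (ξ + 1), τ i * b (k - i) (s - i) := by
    refine Finset.sum_congr rfl fun i hi => ?_
    rw [Finset.mem_range] at hi
    rw [brCoeff, hb.eq_zero (k := α + i - (k + α)) (by omega), sub_zero]
    congr 2 <;> ring
  simp only [jacobiCoeff, brCoeff_top hb htop (zero_add _).symm,
    brCoeff_far hb (i := k + α) (j := 0) (by omega)] at h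
  rw [brCoeff_eq_zero hb (i := 2 * α + ξ) (j := k + α) (a := α) (by omega), h1] at h
  -- For s = 0 the two positions coincide, so the same term appears twice.
  by_cases hs : s = 0
  · subst hs
    rw [zero_add] at h
    rw [zero_add] at h1
    rw [if_neg (by omega)]
    simp only [if_true, h1,
      brCoeff_eq_zero hb (i := 2 * α + ξ) (j := k + α) (a := α) (by omega)] at h
    linear_combination h / 2
  · rw [if_pos (by ring), if_neg (show ¬ s + α = 0 + α by omega)] at h
    by_cases hsN : s = α + ξ
    · subst hsN
      rw [if_pos rfl]
      have h2 : iterCoeff ξ τ b (α + ξ + α) 0 α = -τ 0 := by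
        rw [iterCoeff, Finset.sum_eq_single_of_mem 0 (by simp)]
        · rw [brCoeff, hb.eq_zero (by omega),
            show (α + ξ + α + (0 : ℕ) - 0 : ℤ) = (2 * α + ξ : ℕ) by push_cast; ring, htop,
            if_pos (by ring)]
          ring
        · intro i _ hi
          rw [brCoeff_far hb (by omega), mul_zero]
      have h3 : brCoeff b (2 * α + ξ) (k + α) (α + ξ + α) = b (k - (α + ξ)) 0 := by
        rw [brCoeff, hb.eq_zero (k := 2 * α + ξ - (k + α)) (by omega), sub_zero]
        congr 1 <;> ring
      rw [h2, h3] at h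
      linear_combination h
    · rw [if_neg hsN]
      have h2 : brCoeff b (2 * α + ξ) (k + α) (s + α) * iterCoeff ξ τ b (s + α) 0 α = 0 := by
        rcases lt_or_ge s (α + ξ) with hlt | hge
        · rw [brCoeff_eq_zero hb (by omega), zero_mul]
        · rw [iterCoeff, Finset.sum_eq_zero, mul_zero]
          intro i _
          rw [brCoeff_far hb (by omega), mul_zero]
      rw [h2] at h
      linear_combination h

/-- Recursion in `k`, from the triples `u_{-m}, u_0, u_M` with `m ≥ 1`. -/
theorem sum_coeff_row (hα : 1 ≤ α) (hb : CoeffSupport (2 * α + ξ) ξ b)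
    (htop : ∀ s, b (2 * α + ξ : ℕ) s = if s = α then 1 else 0)
    (hJ : ∀ n m l a c, jacobiCoeff ξ τ b n m l a c + jacobiCoeff ξ τ b n m l c a = 0)
    {m : ℤ} (hm : 1 ≤ m) (s : ℤ) :
    ∑ i ∈ range (ξ + 1), τ i * b (m + α + i) s = if s + ξ = m then τ ξ * b m s else 0 := by
  have hM : ((2 * α + ξ : ℕ) : ℤ) = 2 * α + ξ := by push_cast; ring
  have h := hJ (-m) 0 (2 * α + ξ) α (s - m)
  have h1 : iterCoeff ξ τ b α (-m) (s - m) = -∑ i ∈ range (ξ + 1), τ i * b (m + α + i) s := by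
    rw [iterCoeff, ← Finset.sum_neg_distrib]
    refine Finset.sum_congr rfl fun i _ => ?_
    rw [brCoeff, hb.eq_zero (k := -m - (α + i)) (by omega), zero_sub, mul_neg]
    congr 3 <;> ring
  simp only [jacobiCoeff, brCoeff_top hb htop (zero_add _).symm,
    brCoeff_far hb (i := 2 * α + ξ) (j := -m) (by omega)] at h
  rw [brCoeff_eq_zero hb (i := -m) (j := 0) (a := α) (by omega), h1] at h
  -- Again the case of coinciding positions, in which the term is counted twice.
  by_cases hs : s = m + α
  · subst hs
    rw [if_neg (by omega)]
    have e : m + α - m = (α : ℤ) := by ring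
    rw [e] at h h1
    rw [h1, brCoeff_eq_zero hb (i := -m) (j := 0) (a := α) (by omega), if_pos (by ring)] at h
    linear_combination -h / 2
  · rw [if_pos (by ring), if_neg (show ¬ s - m = 0 + α by omega)] at h
    have h2 : brCoeff b (-m) 0 (s - m) = b m s := by
      rw [brCoeff, hb.eq_zero (k := -m - 0) (by omega), sub_zero]
      congr 1 <;> ring
    rw [h2] at h
    have h3 : b m s * iterCoeff ξ τ b (s - m) (2 * α + ξ) α =
        if s + ξ = m then τ ξ * b m s else 0 := by
      by_cases hms : b m s = 0
      · simp [hms]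
      have hsup := hb _ _ hms
      split_ifs with hsm
      · rw [iterCoeff, Finset.sum_eq_single_of_mem ξ (by simp), brCoeff_top hb htop (by omega),
          if_pos (by omega)]
        · ring
        · intro i hi hiξ
          rw [Finset.mem_range] at hi
          rw [brCoeff_far hb (by omega), mul_zero]
      · rw [iterCoeff, Finset.sum_eq_zero, mul_zero]
        intro i hi
        rw [Finset.mem_range] at hi
        rw [brCoeff_far hb (by omega), mul_zero]
    rw [h3] at h
    linear_combination -h

/-- `τ_0 b_{N,0} = τ_ξ` with `N = α + ξ`. -/
theorem tau_mul_coeff_corner (hα : 1 ≤ α) (hb : CoeffSupport (2 * α + ξ) ξ b)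
    (htop : ∀ s, b (2 * α + ξ : ℕ) s = if s = α then 1 else 0)
    (hJ : ∀ n m l a c, jacobiCoeff ξ τ b n m l a c + jacobiCoeff ξ τ b n m l c a = 0) :
    τ 0 * b (α + ξ) 0 = τ ξ := by
  -- On this diagonal only i = ξ stays within the order M, and it meets the leading coefficient
  -- b_{M,α} = 1.
  have h := sum_coeff_diag hα hb htop hJ (k := 2 * (α + ξ)) (by omega) (α + ξ)
  rw [if_pos rfl, Finset.sum_eq_single_of_mem ξ (by simp),
    show (2 * (α + ξ) - ξ : ℤ) = (2 * α + ξ : ℕ) by push_cast; ring, htop, if_pos (by ring),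
    show (2 * (α + ξ) - (α + ξ) : ℤ) = α + ξ by ring] at h
  · linear_combination -h
  · intro i hi hiξ
    rw [Finset.mem_range] at hi
    rw [hb.eq_zero (by omega), mul_zero]

/-- The coefficients factorize, from the triples `u_0, u_k, u_{a+2N}`. -/
theorem coeff_mul_corner (hα : 1 ≤ α) (hb : CoeffSupport (2 * α + ξ) ξ b)
    (htop : ∀ s, b (2 * α + ξ : ℕ) s = if s = α then 1 else 0)
    (hJ : ∀ n m l a c, jacobiCoeff ξ τ b n m l a c + jacobiCoeff ξ τ b n m l c a = 0)
    {k a : ℤ} (hk : 1 ≤ k) (hkM : k ≤ 2 * α + ξ) (haξ : 1 ≤ a + ξ) :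
    b k a * (τ 0 * b (α + ξ) 0) =
      b (a + 2 * (α + ξ) - k) (a + (α + ξ) - k) * (τ ξ * b (a + ξ) a) := by
  have hM : ((2 * α + ξ : ℕ) : ℤ) = 2 * α + ξ := by push_cast; ring
  have h := hJ 0 k (a + 2 * (α + ξ)) a (a + (α + ξ))
  have h1 : iterCoeff ξ τ b a (a + 2 * (α + ξ)) (a + (α + ξ)) = τ 0 * b (α + ξ) 0 := by
    have h2 := sum_coeff_diag hα hb htop hJ (k := 2 * (α + ξ)) (by omega) (α + ξ)
    rw [if_pos rfl, show (2 * (α + ξ) - (α + ξ) : ℤ) = α + ξ by ring] at h2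
    rw [← h2]
    refine Finset.sum_congr rfl fun i hi => ?_
    rw [Finset.mem_range] at hi
    rw [brCoeff, hb.eq_zero (k := a + i - (a + 2 * (α + ξ))) (by omega), sub_zero]
    congr 2 <;> ring
  have h2 : iterCoeff ξ τ b a 0 (a + (α + ξ)) = 0 := by
    refine Finset.sum_eq_zero fun i hi => ?_
    rw [Finset.mem_range] at hi
    rw [brCoeff_eq_zero hb (by omega), mul_zero]
  have h3 : iterCoeff ξ τ b (a + (α + ξ)) (a + 2 * (α + ξ)) a = 0 := by
    refine Finset.sum_eq_zero fun i hi => ?_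
    rw [brCoeff_eq_zero hb (by omega), mul_zero]
  have h4 : iterCoeff ξ τ b (a + (α + ξ)) 0 a = -(τ ξ * b (a + ξ) a) := by
    have h5 := sum_coeff_row hα hb htop hJ haξ a
    rw [if_pos rfl] at h5
    rw [← h5, iterCoeff, ← Finset.sum_neg_distrib]
    refine Finset.sum_congr rfl fun i _ => ?_
    rw [brCoeff, hb.eq_zero (k := 0 - (a + (α + ξ) + i)) (by omega), zero_sub, mul_neg]
    congr 3 <;> ring
  have h5 : brCoeff b 0 k a = b k a := by
    rw [brCoeff, hb.eq_zero (k := 0 - k) (by omega), sub_zero, sub_zero, sub_zero]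
  have h6 : brCoeff b k (a + 2 * (α + ξ)) (a + (α + ξ)) =
      b (a + 2 * (α + ξ) - k) (a + (α + ξ) - k) := by
    rw [brCoeff, hb.eq_zero (k := k - (a + 2 * (α + ξ))) (by omega), sub_zero]
  simp only [jacobiCoeff, brCoeff_far hb (i := a + 2 * (α + ξ)) (j := 0) (by omega), h1, h2, h3, h4,
    h5, h6] at h
  linear_combination h

/-- The coefficients of a Poisson bracket with exponential leading coefficient. -/
theorem exists_factorization_of_jacobi (hα : 1 ≤ α) (hb : CoeffSupport (2 * α + ξ) ξ b)
    (htop : ∀ s, b (2 * α + ξ : ℕ) s = if s = α then 1 else 0)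
    (hJ : ∀ n m l a c, jacobiCoeff ξ τ b n m l a c + jacobiCoeff ξ τ b n m l c a = 0)
    (hτ0 : τ 0 ≠ 0) (hτξ : τ ξ ≠ 0) (hτ : ∀ i, ξ < i → τ i = 0) :
    ∃ ℓ, Factorization α ξ τ ℓ ∧ b = stdCoeff α ξ ℓ := by
  have hM : ((2 * α + ξ : ℕ) : ℤ) = 2 * α + ξ := by push_cast; ring
  have hcorner := tau_mul_coeff_corner hα hb htop hJ
  set μ : ℂ := τ 0 * (τ ξ)⁻¹ with hμ
  have hμ0 : μ ≠ 0 := mul_ne_zero hτ0 (inv_ne_zero hτξ)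
  have hμb : μ * b (α + ξ) 0 = 1 := by
    rw [hμ]
    field_simp
    exact hcorner
  -- L is read off the diagonal k - s = N, where the expected value is ℓ_α⁻¹ ℓ_0 ℓ_s; the factor μ =
  -- τ_0 / τ_ξ is the future ℓ_α and normalizes ℓ_0 = 1.
  set ℓ : ℕ → ℂ := fun n => μ * b (α + ξ + n) n with hℓ
  have hext : ∀ s : ℤ, extZ ℓ s = μ * b (α + ξ + s) s := by
    intro s
    unfold extZ
    split_ifs with hs
    · simp only [hℓ]
      rw [Int.toNat_of_nonneg hs]
    · rw [hb.eq_zero (by omega), mul_zero]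
  have hF : Factorization α ξ τ ℓ := by
    refine ⟨hτ0, hτξ, hτ, fun j hj => ?_, fun n => ?_⟩
    · simp only [hℓ]
      rw [hb.eq_zero (by omega), mul_zero]
    · rcases Nat.eq_zero_or_pos n with rfl | hn
      · simp [hℓ, hμb]
      · rw [sum_antidiagonal_eq_sum_extZ hτ]
        have h1 := sum_coeff_diag hα hb htop hJ (k := α + ξ + n) (by omega) n
        have h2 : ∑ i ∈ range (ξ + 1), τ i * extZ ℓ (n - i) =
            μ * ∑ i ∈ range (ξ + 1), τ i * b (α + ξ + n - i) (n - i) := by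
          rw [Finset.mul_sum]
          refine Finset.sum_congr rfl fun i _ => ?_
          rw [hext, show (α + ξ + (n - i) : ℤ) = α + ξ + n - i by ring]
          ring
        rw [h2, h1]
        by_cases hnN : n = α + ξ
        · rw [if_pos (by omega), if_pos (by omega), hnN]
          rw [show (α + ξ + (α + ξ : ℕ) - (α + ξ) : ℤ) = α + ξ by push_cast; ring]
          linear_combination τ 0 * hμb
        · rw [if_neg (by omega), if_neg (by omega), mul_zero]
  -- Each coefficient is a product of one on the diagonal k - s = N and one on the extreme diagonal
  -- k - s = ξ.
  have hcorner' : ∀ k a : ℤ, 1 ≤ k → k ≤ 2 * α + ξ → 0 ≤ a → 1 ≤ a + ξ →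
      b k a = b (a + 2 * (α + ξ) - k) (a + (α + ξ) - k) * b (a + ξ) a := by
    intro k a h1 h2 h3 h4
    have := coeff_mul_corner hα hb htop hJ h1 h2 h4
    rw [hcorner] at this
    refine mul_left_cancel₀ hτξ ?_
    linear_combination this
  -- The extreme diagonal carries ℓ without a prefactor: for a ≤ α this is the product formula on
  -- the diagonal k - s = N, and for a > α the row recursion has no terms within range.
  have hleft : ∀ a : ℤ, 0 ≤ a → 1 ≤ a + ξ → b (a + ξ) a = extZ ℓ a := by
    intro a h1 h2
    rw [hext]
    rcases le_or_gt a α with h3 | h3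
    · have := hcorner' (α + ξ + a) a (by omega) (by omega) h1 h2
      rw [show (a + 2 * (α + ξ) - (α + ξ + a) : ℤ) = α + ξ by ring,
        show (a + (α + ξ) - (α + ξ + a) : ℤ) = 0 by ring] at this
      rw [this]
      linear_combination -b (a + ξ) a * hμb
    · have := sum_coeff_row hα hb htop hJ h2 a
      rw [if_pos rfl, Finset.sum_eq_zero] at this
      · rw [hb.eq_zero (k := α + ξ + a) (by omega), mul_zero]
        exact (mul_eq_zero.1 this.symm).resolve_left hτξ
      · intro i _
        rw [hb.eq_zero (by omega), mul_zero]
  have hmain : ∀ k a : ℤ, 1 ≤ k → k ≤ 2 * α + ξ → 0 ≤ a → 1 ≤ a + ξ →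
      b k a = stdCoeff α ξ ℓ k a := by
    intro k a h1 h2 h3 h4
    rw [hcorner' k a h1 h2 h3 h4, hleft a h3 h4, stdCoeff, if_pos h1, hF.ell_self, ← hμ,
      hext (a + (α + ξ) - k), show (α + ξ + (a + (α + ξ) - k) : ℤ) = a + 2 * (α + ξ) - k by ring]
    field_simp
  refine ⟨ℓ, hF, ?_⟩
  funext k s
  by_cases hks : 1 ≤ k ∧ k ≤ 2 * α + ξ ∧ 0 ≤ s
  · obtain ⟨h1, h2, h3⟩ := hks
    rcases lt_or_ge 0 (s + ξ) with h4 | h4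
    · exact hmain k s h1 h2 h3 (by omega)
    · -- only `s = 0`, `ξ = 0` is left
      obtain rfl : s = 0 := by omega
      obtain rfl : ξ = 0 := by omega
      -- For ξ = 0 the diagonal recursion reads b_{k+α,α} = b_{k,0}, which moves the missing case to
      -- s = α ≥ 1.
      have h5 := sum_coeff_diag hα hb htop hJ (k := k + α) (by push_cast; omega) α
      simp only [zero_add, Finset.sum_range_one, Nat.cast_zero, sub_zero, add_zero, if_true] at h5
      rw [show k + α - α = k by ring] at h5
      rw [← mul_left_cancel₀ hτ0 h5]
      have hℓα : ℓ α = 1 := by rw [hF.ell_self, mul_inv_cancel₀ hτ0]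
      have h6 : b (k + α) α = stdCoeff α 0 ℓ (k + α) α := by
        rcases le_or_gt (k + α) (2 * α + (0 : ℕ) : ℤ) with h7 | h7
        · exact hmain (k + α) α (by omega) h7 (by omega) (by push_cast; omega)
        · rw [hb.eq_zero (by omega)]
          by_contra hne
          have := hF.coeffSupport _ _ (Ne.symm hne)
          omega
      rw [h6, stdCoeff, stdCoeff, if_pos (by omega), if_pos h1, extZ_natCast, hℓα,
        show extZ ℓ 0 = 1 by rw [← hF.ell_zero]; exact extZ_natCast ℓ 0,
        show (α + (α + (0 : ℕ)) - (k + α) : ℤ) = 0 + (α + (0 : ℕ)) - k by ring]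
  · rw [hb.eq_zero (by omega)]
    by_contra hne
    have := hF.coeffSupport _ _ (Ne.symm hne)
    omega

end

/-! ### Coordinate changes and the parameters of a class. -/

/-- The bracket has the leading coefficient `c exp (∑ τ_i u_{α+i})`, and its other coefficients are
given by the factorization `T L = τ_0 (1 + z ^ (α + ξ))`. -/
structure HasParams {α ξ : ℕ} (P : Bracket (2 * α + ξ)) (τ ℓ : ℕ → ℂ) (c : ℂ) : Prop where
  ne_zero : c ≠ 0
  fact : Factorization α ξ τ ℓ
  coeffs : HasCoeffs P.dom (expF ξ τ c) P.g (stdCoeff α ξ ℓ)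

section
variable {α ξ : ℕ} {τ ℓ τ' ℓ' : ℕ → ℂ} {c c' : ℂ}

theorem exists_hasParams (hα : 1 ≤ α) (P : AlphaXiBracket α ξ) :
    ∃ τ ℓ c, HasParams P.1 τ ℓ c := by
  obtain ⟨f, b, hf, hx, hb, hg, htop⟩ := P.2.exists_coeffs
  obtain ⟨τ, hτ0, hτξ, hτ, hpd⟩ := hg.exists_exponents P.1.dom_open P.1.dom_connected hα hf hx hb
    (htop hα) P.1.jacobi
  obtain ⟨c, hfc⟩ := eq_expF P.1.dom_open P.1.dom_connected hf hpd
  have hc : c ≠ 0 := by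
    rintro rfl
    obtain ⟨x, hxD, hne⟩ := hx
    refine hne ?_
    rw [hpd x hxD, hfc x hxD]
    simp [expF]
  obtain ⟨ℓ, hF, rfl⟩ := exists_factorization_of_jacobi hα hb (htop hα)
    (hg.jacobiCoeff_add_swap P.1.dom_open P.1.dom_connected hf hb P.1.jacobi hτ0 hτ hc hfc hpd)
    hτ0 hτξ hτ
  refine ⟨τ, ℓ, c, hc, hF, fun k u hu => ?_⟩
  rw [hg k u hu]
  exact Finset.sum_congr rfl fun s _ => by rw [hfc _ (window_mem hu s ξ)]

theorem HasParams.leading {P : Bracket (2 * α + ξ)} (h : HasParams P τ ℓ c) (hα : 1 ≤ α)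
    {u : ℤ → ℂ} (hu : ∀ i, u i ∈ P.dom) :
    P.g (2 * α + ξ) (window u 0 (2 * α + ξ)) = expF ξ τ c (window u α ξ) :=
  hasCoeffs_top h.coeffs (stdCoeff_top h.fact hα) hu

theorem expF_ne_zero (hc : c ≠ 0) (x : Fin (ξ + 1) → ℂ) : expF ξ τ c x ≠ 0 :=
  mul_ne_zero hc (Complex.exp_ne_zero _)

theorem hasDerivAt_expF_update (x : Fin (ξ + 1) → ℂ) (i : Fin (ξ + 1)) :
    HasDerivAt (fun t => expF ξ τ c (Function.update x i t)) (τ i * expF ξ τ c x) (x i) := by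
  have hf : AnalyticOnNhd ℂ (expF ξ τ c) {x | ∀ i, x i ∈ (Set.univ : Set ℂ)} :=
    fun x _ => analyticAt_expF ξ τ c x
  have h := hasDerivAt_update_of_analytic hf (x := x) (fun _ => trivial) i
  rwa [← pderiv_eq_fderiv hf (fun _ => trivial), pderiv_expF] at h

/-- Local changes of the coordinate rescale the exponents. -/
theorem LocalChange.exists_smul (hα : 1 ≤ α) {P Q : AlphaXiBracket α ξ} (hPQ : LocalChange P Q)
    (hP : HasParams P.1 τ ℓ c) (hQ : HasParams Q.1 τ' ℓ' c') : ∃ a : ℂ, a ≠ 0 ∧ τ = a • τ' := by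
  obtain ⟨U, φ, hU, hUc, hUP, hφ, _, hφQ, h⟩ := hPQ
  obtain ⟨x, hx⟩ := hUc.nonempty
  have key : ∀ u : ℤ → ℂ, (∀ i, u i ∈ U) → expF ξ τ' c' (window (fun i => φ (u i)) α ξ) =
      deriv φ (u 0) * deriv φ (u (2 * α + ξ : ℕ)) * expF ξ τ c (window u α ξ) := by
    intro u hu
    rw [← hP.leading hα (fun i => hUP (hu i)), ← h _ u hu, hQ.leading hα (fun i => hφQ (hu i))]
  have hconst : ∀ y k a, window (fun _ => y) a k = fun _ => y := fun _ _ _ => rfl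
  have h0 := key (fun _ => x) fun _ => hx
  simp only [hconst] at h0
  have hne : deriv φ x * deriv φ x * expF ξ τ c (fun _ => x) ≠ 0 := by
    rw [← h0]
    exact expF_ne_zero hQ.ne_zero _
  have ha : deriv φ x ≠ 0 := left_ne_zero_of_mul (left_ne_zero_of_mul hne)
  refine ⟨deriv φ x, ha, ?_⟩
  funext n
  rw [Pi.smul_apply, smul_eq_mul]
  rcases lt_or_ge ξ n with hn | hn
  · rw [hP.fact.tau_gt n hn, hQ.fact.tau_gt n hn, mul_zero]
  set i : Fin (ξ + 1) := ⟨n, by omega⟩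
  have h1 : ∀ t ∈ U, expF ξ τ' c' (Function.update (fun _ => φ x) i (φ t)) =
      deriv φ x * deriv φ x * expF ξ τ c (Function.update (fun _ => x) i t) := by
    intro t ht
    -- Only u_{α+i} is moved away from the constant sequence. Since 0 < α + i < M, the factors
    -- φ'(u_0) and φ'(u_M) stay constant, and differentiation in t compares the exponents.
    have h2 := key (Function.update (fun _ => x) (α + ((i : ℕ) : ℤ)) t)
      (update_mem (fun _ => hx) _ ht)
    rw [window_update_add, Function.update_of_ne (by omega), Function.update_of_ne
      (by have := i.2; push_cast; omega)] at h2
    have h3 : (fun j => φ (Function.update (fun _ : ℤ => x) (α + ((i : ℕ) : ℤ)) t j)) =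
        Function.update (fun _ => φ x) (α + ((i : ℕ) : ℤ)) (φ t) := by
      funext j
      simp only [Function.update_apply]
      split_ifs <;> rfl
    rw [h3, window_update_add] at h2
    exact h2
  have hd1 : HasDerivAt (fun t => expF ξ τ' c' (Function.update (fun _ => φ x) i (φ t)))
      (τ' n * expF ξ τ' c' (fun _ => φ x) * deriv φ x) x :=
    HasDerivAt.comp (h₂ := fun s => expF ξ τ' c' (Function.update (fun _ => φ x) i s)) x
      (hasDerivAt_expF_update (fun _ => φ x) i) (hφ x hx).differentiableAt.hasDerivAt
  have hd2 : HasDerivAt (fun t => deriv φ x * deriv φ x *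
      expF ξ τ c (Function.update (fun _ => x) i t))
      (deriv φ x * deriv φ x * (τ n * expF ξ τ c (fun _ => x))) x :=
    (hasDerivAt_expF_update (fun _ => x) i).const_mul _
  have hd := (hd2.congr_of_eventuallyEq
    (by filter_upwards [hU.mem_nhds hx] with t ht using h1 t ht)).unique hd1
  rw [h0] at hd
  refine mul_right_cancel₀ hne ?_
  linear_combination hd

/-- The standard bracket as an `(α, ξ)`-bracket. -/
noncomputable def stdAlphaXi (hα : 1 ≤ α) (h : Factorization α ξ τ ℓ) (hc : c ≠ 0) :
    AlphaXiBracket α ξ := ⟨stdBracket hα h c, isAlphaXi_stdBracket hα h hc⟩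

theorem hasParams_stdAlphaXi (hα : 1 ≤ α) (h : Factorization α ξ τ ℓ) (hc : c ≠ 0) :
    HasParams (stdAlphaXi hα h hc).1 τ ℓ c :=
  ⟨hc, h, hasCoeffs_stdG h c⟩

theorem HasParams.localChange_id {P Q : AlphaXiBracket α ξ} (hP : HasParams P.1 τ ℓ c)
    (hQ : HasParams Q.1 τ ℓ c) (hPQ : P.1.dom ⊆ Q.1.dom) : LocalChange P Q := by
  refine ⟨P.1.dom, id, P.1.dom_open, P.1.dom_connected, subset_rfl, analyticOnNhd_id,
    Function.injective_id.injOn, hPQ, fun k u hu => ?_⟩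
  simp only [id, deriv_id', one_mul]
  rw [hP.coeffs k u hu, hQ.coeffs k u fun i => hPQ (hu i)]

/-- The affine map x ↦ a x + β rescales the exponents by its slope. The translation multiplies the
exponential by exp(T'(1) β), where T' = ∑ τ'_i z^i, and T'(1) ≠ 0 allows any nonzero constant to be
reached. -/
theorem localChange_stdAlphaXi (hα : 1 ≤ α) (h : Factorization α ξ τ ℓ) (hc : c ≠ 0)
    (h' : Factorization α ξ τ' ℓ') (hc' : c' ≠ 0) {a : ℂ} (ha : a ≠ 0) (hτ : τ = a • τ') :
    LocalChange (stdAlphaXi hα h hc) (stdAlphaXi hα h' hc') := by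
  subst hτ
  have hℓ : ℓ = ℓ' := by rw [h.ell_eq hα, (h'.smul ha).ell_eq hα]
  subst hℓ
  set σ : ℂ := ∑ i ∈ range (ξ + 1), τ' i with hσ
  have hσ0 : σ ≠ 0 := h'.sum_ne_zero
  -- The solution of c' exp(σ β) = a² c; the factor a² comes from the two derivatives of the
  -- coordinate change.
  set β : ℂ := Complex.log (a * a * c * c'⁻¹) / σ with hβ
  have hexp : c' * Complex.exp (σ * β) = a * a * c := by
    rw [hβ, mul_div_cancel₀ _ hσ0, Complex.exp_log]
    · field_simp
    · exact mul_ne_zero (mul_ne_zero (mul_ne_zero ha ha) hc) (inv_ne_zero hc')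
  have hderiv : ∀ x, deriv (fun x => a * x + β) x = a := by
    intro x
    have : HasDerivAt (fun x => a * x + β) (a * 1) x :=
      ((hasDerivAt_id x).const_mul a).add_const β
    rw [this.deriv, mul_one]
  refine ⟨Set.univ, fun x => a * x + β, isOpen_univ, isConnected_univ, subset_rfl, ?_, ?_,
    fun _ _ => trivial, fun k u _ => ?_⟩
  · intro x _
    fun_prop
  · intro x _ y _ hxy
    exact mul_left_cancel₀ ha (add_right_cancel hxy)
  · rw [hderiv, hderiv]
    show stdG α ξ τ' ℓ c' k _ = a * a * stdG α ξ (a • τ') ℓ c k _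
    rw [hasCoeffs_stdG h' c' k _ fun _ => trivial, hasCoeffs_stdG h c k _ fun _ => trivial,
      Finset.mul_sum]
    refine Finset.sum_congr rfl fun s _ => ?_
    rw [expF_window, expF_window]
    have h1 : ∑ i ∈ range (ξ + 1), τ' i * (a * u (s + (i : ℤ)) + β) =
        σ * β + ∑ i ∈ range (ξ + 1), (a • τ') i * u (s + (i : ℤ)) := by
      rw [hσ, Finset.sum_mul, ← Finset.sum_add_distrib]
      refine Finset.sum_congr rfl fun i _ => ?_
      simp only [Pi.smul_apply, smul_eq_mul]
      ring
    rw [h1, Complex.exp_add]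
    linear_combination stdCoeff α ξ ℓ k s *
      Complex.exp (∑ i ∈ range (ξ + 1), (a • τ') i * u (s + (i : ℤ))) * hexp

/-- Brackets with proportional exponents are equivalent. -/
theorem HasParams.mk_eq_mk (hα : 1 ≤ α) {P Q : AlphaXiBracket α ξ} (hP : HasParams P.1 τ ℓ c)
    (hQ : HasParams Q.1 τ' ℓ' c') {a : ℂ} (ha : a ≠ 0) (hτ : τ = a • τ') :
    Quot.mk LocalChange P = Quot.mk LocalChange Q := by
  have h1 := Quot.sound (hP.localChange_id (hasParams_stdAlphaXi hα hP.fact hP.ne_zero)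
    (Set.subset_univ _))
  have h2 := Quot.sound (hQ.localChange_id (hasParams_stdAlphaXi hα hQ.fact hQ.ne_zero)
    (Set.subset_univ _))
  rw [h1, h2]
  exact Quot.sound (localChange_stdAlphaXi hα hP.fact hP.ne_zero hQ.fact hQ.ne_zero ha hτ)

theorem coords_smul (a : ℂ) (τ : ℕ → ℂ) : coords α ξ (a • τ) = a • coords α ξ τ := by
  funext i
  simp only [coords, Pi.smul_apply]
  split_ifs <;> rfl

theorem Factorization.coords_ne_zero (h : Factorization α ξ τ ℓ) (hα : 1 ≤ α) :
    coords α ξ τ ≠ 0 := by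
  intro h0
  have := congrFun h0 0
  rw [coords_zero hα] at this
  exact h.zero_ne this

theorem HasParams.coeff_formula {P : Bracket (2 * α + ξ)} (h : HasParams P τ ℓ c) (hα : 1 ≤ α)
    {k : ℕ} (hk : 1 ≤ k) {u : ℤ → ℂ} (hu : ∀ i, u i ∈ P.dom) :
    P.g k (window u 0 k) = ∑ s ∈ range (α + 1), ∑ r ∈ range (α + 1),
      if α + ξ + s = k + r then
        lam α ξ (coords α ξ τ) r * (lam α ξ (coords α ξ τ) α)⁻¹ * lam α ξ (coords α ξ τ) s
          * (c * Complex.exp (∑ i ∈ range (ξ + 1), τ i * u ((s : ℤ) + (i : ℤ))))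
      else 0 := by
  rw [h.coeffs k u hu, sum_stdCoeff_eq h.fact hk, ← h.fact.ell_eq hα]
  simp only [expF_window]

end

end LatticePB

/-! ### The bijection between classes and points. -/

theorem mainTheorem2 (α ξ : ℕ) (hα : 1 ≤ α) :
    -- the left-minus-right sides of the `θ = min α ξ` equations are homogeneous polynomials, once
    -- the powers of `τ_0` and `τ_ξ` in the denominators are cleared
    ∃ F : Fin (min α ξ) → MvPolynomial (Fin (min α ξ + 1)) ℂ,
      (∀ p, F p ≠ 0 ∧ (∃ d : ℕ, (F p).IsHomogeneous d) ∧
        ∃ m : ℕ, ∀ v : Fin (min α ξ + 1) → ℂ, v 0 ≠ 0 → v (Fin.last (min α ξ)) ≠ 0 →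
          MvPolynomial.eval v (F p) =
            (v 0 * v (Fin.last (min α ξ))) ^ m * LatticePB.eqn α ξ p v) ∧
      -- the classes of brackets correspond to the common points of the hypersurfaces `F p = 0`
      -- (with `τ_0 ≠ 0` and `τ_ξ ≠ 0`)
      ∃ e : LatticePB.BracketClass α ξ ≃
          {x : Projectivization ℂ (Fin (min α ξ + 1) → ℂ) //
            x.rep 0 ≠ 0 ∧ x.rep (Fin.last (min α ξ)) ≠ 0 ∧
              ∀ p, MvPolynomial.eval x.rep (F p) = 0},
        -- the point that corresponds to a bracket has the coordinates `[τ_0 : … : τ_{θ-1} : τ_ξ]`,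
        -- where the leading coefficient is `c * exp (∑ τ_i u_{n+α+i})`, and the scalars `λ` are
        -- the coefficients of the bracket
        ∀ P : LatticePB.AlphaXiBracket α ξ,
          ∃ (c : ℂ) (τ : ℕ → ℂ) (hτ : LatticePB.coords α ξ τ ≠ 0), c ≠ 0 ∧
            (∀ u : ℤ → ℂ, (∀ i, u i ∈ P.1.dom) →
              P.1.g (2 * α + ξ) (LatticePB.window u 0 (2 * α + ξ)) =
                c * Complex.exp (∑ i ∈ Finset.range (ξ + 1), τ i * u ((α : ℤ) + (i : ℤ)))) ∧
            (∀ k : ℕ, 1 ≤ k → ∀ u : ℤ → ℂ, (∀ i, u i ∈ P.1.dom) →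
              P.1.g k (LatticePB.window u 0 k) =
                ∑ s ∈ Finset.range (α + 1), ∑ r ∈ Finset.range (α + 1),
                  if α + ξ + s = k + r then
                    LatticePB.lam α ξ (LatticePB.coords α ξ τ) r
                      * (LatticePB.lam α ξ (LatticePB.coords α ξ τ) α)⁻¹
                      * LatticePB.lam α ξ (LatticePB.coords α ξ τ) s
                      * (c * Complex.exp
                          (∑ i ∈ Finset.range (ξ + 1), τ i * u ((s : ℤ) + (i : ℤ))))
                  else 0) ∧
            (e (Quot.mk LatticePB.LocalChange P)).1 =
              Projectivization.mk ℂ (LatticePB.coords α ξ τ) hτ := by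
  open LatticePB in
  obtain ⟨F, hF⟩ := exists_polynomial_eqn α ξ
  refine ⟨F, hF, ?_⟩
  choose τ ℓ c hP using exists_hasParams (α := α) (ξ := ξ) hα
  have hne : ∀ P, coords α ξ (τ P) ≠ 0 := fun P => (hP P).fact.coords_ne_zero hα
  have hpt : ∀ P, (Projectivization.mk ℂ (coords α ξ (τ P)) (hne P)).rep 0 ≠ 0 ∧
      (Projectivization.mk ℂ (coords α ξ (τ P)) (hne P)).rep (Fin.last (min α ξ)) ≠ 0 ∧
      ∀ p, MvPolynomial.eval (Projectivization.mk ℂ (coords α ξ (τ P)) (hne P)).rep (F p) = 0 := by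
    intro P
    obtain ⟨a, ha⟩ := Projectivization.exists_smul_eq_mk_rep ℂ (coords α ξ (τ P)) (hne P)
    rw [Units.smul_def, ← coords_smul] at ha
    have hfact := (hP P).fact.smul a.ne_zero
    rw [← ha]
    have h0 : coords α ξ ((a : ℂ) • τ P) 0 ≠ 0 := by rw [coords_zero hα]; exact hfact.zero_ne
    have h1 : coords α ξ ((a : ℂ) • τ P) (Fin.last _) ≠ 0 := by
      rw [coords_last]; exact hfact.last_ne
    refine ⟨h0, h1, fun p => ?_⟩
    obtain ⟨m, hm⟩ := (hF p).2.2
    rw [hm _ h0 h1, hfact.eqn_eq_zero hα p.2, mul_zero]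
  let pt : BracketClass α ξ → {x : Projectivization ℂ (Fin (min α ξ + 1) → ℂ) //
      x.rep 0 ≠ 0 ∧ x.rep (Fin.last (min α ξ)) ≠ 0 ∧ ∀ p, MvPolynomial.eval x.rep (F p) = 0} :=
    -- Parameters are chosen for each bracket; a coordinate change rescales them, so the projective
    -- point is well defined.
    Quot.lift (fun P => ⟨Projectivization.mk ℂ (coords α ξ (τ P)) (hne P), hpt P⟩) (by
      intro P Q hPQ
      obtain ⟨a, _, ha⟩ := hPQ.exists_smul hα (hP P) (hP Q)
      refine Subtype.ext ((Projectivization.mk_eq_mk_iff' ℂ _ _ _ _).2 ⟨a, ?_⟩)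
      rw [← coords_smul, ha])
  have hbij : Function.Bijective pt := by
    constructor
    · rintro ⟨P⟩ ⟨Q⟩ hPQ
      obtain ⟨a, ha⟩ := (Projectivization.mk_eq_mk_iff ℂ _ _ _ _).1 (congrArg Subtype.val hPQ)
      rw [Units.smul_def, ← coords_smul] at ha
      exact (hP P).mk_eq_mk hα (hP Q) a.ne_zero
        ((hP P).fact.eq_of_coords_eq ((hP Q).fact.smul a.ne_zero) hα ha.symm)
    · rintro ⟨x, h0, h1, hx⟩
      have heq : ∀ p < min α ξ, eqn α ξ p x.rep = 0 := by
        intro p hp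
        obtain ⟨m, hm⟩ := (hF ⟨p, hp⟩).2.2
        have h2 := hx ⟨p, hp⟩
        rw [hm _ h0 h1] at h2
        exact (mul_eq_zero.1 h2).resolve_left (pow_ne_zero _ (mul_ne_zero h0 h1))
      obtain ⟨t, ht, hfact⟩ := exists_factorization hα h0 h1 heq
      have hR := hasParams_stdAlphaXi hα hfact one_ne_zero
      refine ⟨Quot.mk _ (stdAlphaXi hα hfact one_ne_zero), Subtype.ext ?_⟩
      -- The parameters chosen for this standard bracket need not be t itself; the identity change
      -- of coordinate shows that they are proportional to it.
      obtain ⟨a, _, ha⟩ := (hR.localChange_id hR subset_rfl).exists_smul hα (hP _) hR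
      show Projectivization.mk ℂ _ _ = x
      refine Eq.trans ?_ x.mk_rep
      refine (Projectivization.mk_eq_mk_iff' ℂ _ _ _ _).2 ⟨a, ?_⟩
      rw [ha, coords_smul, ht]
  refine ⟨Equiv.ofBijective pt hbij, fun P => ⟨c P, τ P, hne P, (hP P).ne_zero, ?_, ?_, rfl⟩⟩
  · intro u hu
    rw [(hP P).leading hα hu, expF_window]
  · intro k hk u hu
    exact (hP P).coeff_formula hα hk hu
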